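/- Let $\mathcal O$ be a complete discrete valuation ring with residue field $k$ of characteristic $p>0$, let $H$ be a normal subgroup of a finite group $G$, and let $\bar G=G/H$, $\bar g=gH$. Let $A$ be a $\bar G$-graded $G$-interior $\mathcal O$-algebra, finitely generated as an $\mathcal O$-module (so $A=\bigoplus_{x\in\bar G}A_x$ is $\bar G$-graded and there is a homomorphism $G\to A^\times$, written $g\mapsto g$, with $g\in A_{\bar g}$), and let $B=A_1$. Let $P\le G$, let $\gamma$ be a point of $P$ on $B$, and let $i\in\gamma$, a primitive idempotent of $B^P$; assume that $P\to (iAi)^\times$, $u\mapsto ui$, is injective. Let $A'\to A$ be an embedding of $\bar G$-graded $P$-interior algebras, that is, up to isomorphism, the inclusion of $A'=eAe$ in $A$, where $e\in B^P$ is an idempotent, and assume that $ei=ie=i$. Let $B'=eBe$ and let $\gamma'$ be the point of $P$ on $B'$ containing $i$. *Notation.* - $N=N_G(P_\gamma)$ and $E=N/C_H(P)$. $F$ is the group of pairs $(\varphi,x)\in\operatorname{Aut}(P)\times\bar G$ such that $\overline{\varphi(u)}=x\bar ux^{-1}$ for all $u\in P$, and $Ai\simeq (Ai)(x^{-1})_\varphi$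 as $\bar G$-graded $(A,\mathcal OP)$-bimodules. Here $M(y)_x=M_{xy}$, and $M_\varphi$ is $M$ with $u\in P$ acting on the right as $\varphi(u)$. - $C=\mathcal OP*F$ is the skew group algebra. It is $\bar G$-graded, $u*(\varphi,x)$ having degree $\bar ux$. $\mathcal F$ is the opposite of the algebra of those endomorphisms of the $(A,C)$-bimodule $Ai\otimes_{\mathcal OP}C$ which preserve the $\bar G$-grading; it is $F$-graded. $\overline{\mathcal F}=\mathcal F/J_{gr}(\mathcal F)$, where $J_{gr}$ is the graded Jacobson radical. - $m_\gamma$ is the maximal ideal of $B^P$ not containing $i$, $B(P_\gamma)=B^P/m_\gamma$, and $V_\gamma=B(P_\gamma)\bar i$ is its simple module. With the crossed product $B(P_\gamma)*E$, $\overline{\mathcal E}=\operatorname{End}_{B(P_\gamma)*E}\bigl((B(P_\gamma)*E)\otimes_{B(P_\gamma)}V_\gamma\bigr)^{\mathrm{op}}$. - $\operatorname{Br}_P:B^P\to B(P)$ is the Brauer map. The point $\gamma$ is local if $\operatorname{Br}_P(i)\ne0$. In this case $b_\gamma$ is the block (primitive central idempotent) of $B(P)$ with $b_\gamma\operatorname{Br}_P(i)=\operatorname{Br}_P(i)$,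 $m_{\operatorname{Br}_P(\gamma)}$ is the maximal ideal of $B(P)$ not containing $\operatorname{Br}_P(i)$, $m^*=m_{\operatorname{Br}_P(\gamma)}\cap B(P)b_\gamma$, and $\overline{\mathcal E}(P)$ is defined as $\overline{\mathcal E}$, with $B(P)b_\gamma/m^*$ instead of $B(P_\gamma)$. - $F',\mathcal F',\overline{\mathcal F'}$ and $m_{\gamma'}$, $B'(P_{\gamma'})$, $V_{\gamma'}$, $b_{\gamma'}$, etc. are the same objects for $A'$, $B'$, $\gamma'$. For the remaining ones, which involve the action of $G$, let $R'=\bigoplus_g e(B^Pg)e$, an $N_G(P)$-graded algebra with identity component $eB^Pe=B'^P$. $N'=N_G(P_{\gamma'})$ is the group of all $g\in N_G(P)$ such that $R'i$ is isomorphic, as a graded left ideal, to its shift by $g$, that is, $zz'=z'z=i$ for some $z\in iR'_gi$ and $z'\in iR'_{g^{-1}}i$. $E'=N'/C_H(P)$. For a quotient $T$ of $B'^P$, $T*E'$ is the quotient of $e(B^P*E')e$ by the ideal generated by the kernel of $B'^P\to T$. $\overline{\mathcal E'}$ and $\overline{\mathcal E'}(P)$ are then defined as above. When $e$ is fixed by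 $G$, so that $A'$ is itself $G$-interior, these are the constructions for $A'$; for $e=1$ they are those for $A$. **Proposition.** $N_G(P_{\gamma'})=N_G(P_\gamma)$, and if $g\in N_G(P)$ fixes $e$, then $g\in N_G(P_{\gamma'})$ if and only if ${}^gi$ is conjugate to $i$ under $(B'^P)^\times$. The embedding induces group isomorphisms $E\simeq E'$, mapping the class of $g$ to the class of $g$, and $F\simeq F'$, mapping $(\varphi,x)$ to $(\varphi,x)$. They are compatible with the injective homomorphisms $E\to F$ and $E'\to F'$ which map the class of $g$ to $(c_g,\bar g)$, where $c_g$ is the conjugation by $g$ on $P$. Moreover there is a commutative diagram $$\begin{array}{ccccc}\overline{\mathcal F}&\longleftarrow&\overline{\mathcal E}&\stackrel{\simeq}{\longrightarrow}&\overline{\mathcal E}(P)\\ \downarrow\simeq&&\downarrow\simeq&&\downarrow\simeq\\ \overline{\mathcal F'}&\longleftarrow&\overline{\mathcal E'}&\stackrel{\simeq}{\longrightarrow}&\overline{\mathcal E'}(P)\end{array}$$ of $F$-graded $k$-algebras ($E$-graded algebras being regarded as $F$-graded through $E\to F$), where the right-hand square is for $\gamma$ local. The maps marked $\simeq$ are isomorphisms,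 and the maps $\overline{\mathcal E}\to\overline{\mathcal F}$ and $\overline{\mathcal E'}\to\overline{\mathcal F'}$ are injective, with image the sum of the components of degrees in the image of $E$, respectively $E'$. All the maps are the canonical ones: they send the class of the endomorphism given by the right multiplication by a homogeneous element $y\in i(B^Pg)i=i\,e(B^Pg)e\,i$ (respectively, for $\overline{\mathcal F}\to\overline{\mathcal F'}$, by an element $y\in iAi=iA'i$ inducing an endomorphism of degree $\varphi\in F$ of $Ai\otimes_{\mathcal OP}C$) to the class of the endomorphism given by the right multiplication by the same element. -/

import Mathlib

open scoped TensorProduct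

/-! ### Group-graded interior algebras, points, embeddings -/

/-- A `Γ`-grading of an `O`-algebra by submodules indexed by a (multiplicative) group `Γ`. -/
structure IsGradedBy {O Γ A : Type*} [CommRing O] [Group Γ] [Ring A] [Algebra O A]
    (comp : Γ → Submodule O A) : Prop where
  one_mem : (1 : A) ∈ comp 1
  mul_mem : ∀ {x y : Γ} {a b : A}, a ∈ comp x → b ∈ comp y → a * b ∈ comp (x * y)
  internal : letI := Classical.decEq Γ; DirectSum.IsInternal comp

/-- A `Γ`-graded `L`-interior `O`-algebra, with respect to `d : L →* Γ`: a `Γ`-graded algebra `A`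
with a group homomorphism `L → Aˣ` sending `u` to a unit of degree `d u` (that is, the structural
map `O L → A` is a homomorphism of `Γ`-graded algebras). -/
structure GradedInterior (O : Type*) {L Γ : Type*} [CommRing O] [Group L] [Group Γ] (d : L →* Γ)
    (A : Type*) [Ring A] [Algebra O A] where
  comp : Γ → Submodule O A
  graded : IsGradedBy comp
  str : L →* Aˣ
  str_mem : ∀ u : L, (str u : A) ∈ comp (d u)

namespace GradedInterior

variable {O L Γ A : Type*} [CommRing O] [Group L] [Group Γ] {d : L →* Γ} [Ring A] [Algebra O A]

/-- Restriction of the interior structure to a subgroup. -/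
def res (𝔄 : GradedInterior O d A) (P : Subgroup L) : GradedInterior O (d.comp P.subtype) A where
  comp := 𝔄.comp
  graded := 𝔄.graded
  str := 𝔄.str.comp P.subtype
  str_mem u := 𝔄.str_mem u

/-- `B^Q`, for `B` the identity component and `Q` a subgroup of `L` acting by conjugation. -/
def fixedBy (𝔄 : GradedInterior O d A) (Q : Subgroup L) : Subalgebra O A where
  carrier := {a | a ∈ 𝔄.comp 1 ∧ ∀ u ∈ Q, (𝔄.str u : A) * a = a * (𝔄.str u : A)}
  mul_mem' := by
    rintro a b ⟨ha, ha'⟩ ⟨hb, hb'⟩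
    refine ⟨by simpa using 𝔄.graded.mul_mem ha hb, fun u hu => ?_⟩
    rw [← mul_assoc, ha' u hu, mul_assoc, hb' u hu, mul_assoc]
  add_mem' := by
    rintro a b ⟨ha, ha'⟩ ⟨hb, hb'⟩
    exact ⟨add_mem ha hb, fun u hu => by rw [mul_add, add_mul, ha' u hu, hb' u hu]⟩
  algebraMap_mem' r := by
    refine ⟨?_, fun u _ => (Algebra.commutes r _).symm⟩
    rw [Algebra.algebraMap_eq_smul_one]
    exact Submodule.smul_mem _ _ 𝔄.graded.one_mem

/-- `B^L`. -/
abbrev fixed (𝔄 : GradedInterior O d A) : Subalgebra O A := 𝔄.fixedBy ⊤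

theorem mem_fixed {𝔄 : GradedInterior O d A} {a : A} :
    a ∈ 𝔄.fixed ↔ a ∈ 𝔄.comp 1 ∧ ∀ u : L, (𝔄.str u : A) * a = a * (𝔄.str u : A) :=
  ⟨fun h => ⟨h.1, fun u => h.2 u trivial⟩, fun h => ⟨h.1, fun u _ => h.2 u⟩⟩

/-- A primitive idempotent `i` of `B^L`; it stands for the point of `L` on `B` (the conjugacy
class under `(B^L)ˣ`) that contains it. -/
structure Point (𝔄 : GradedInterior O d A) where
  i : A
  mem : i ∈ 𝔄.fixed
  idem : i * i = i
  ne_zero : i ≠ 0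
  primitive : ∀ j ∈ 𝔄.fixed, j * j = j → i * j = j → j * i = j → j = 0 ∨ j = i

end GradedInterior

/-- An embedding `A' → A` of `Γ`-graded `L`-interior algebras: an injective, not necessarily
unital, algebra homomorphism `f` with image `eAe`, where `e = f 1`, which preserves the degrees and
commutes with the left and right multiplication by the elements of `L`. -/
structure GradedEmbedding {O L Γ A A' : Type*} [CommRing O] [Group L] [Group Γ] {d : L →* Γ}
    [Ring A] [Algebra O A] [Ring A'] [Algebra O A']
    (𝔅 : GradedInterior O d A') (𝔄 : GradedInterior O d A) where
  f : A' →ₙₐ[O] A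
  injective : Function.Injective f
  range : ∀ a : A, f 1 * a = a → a * f 1 = a → ∃ a' : A', f a' = a
  map_comp : ∀ (x : Γ) (a : A'), a ∈ 𝔅.comp x → f a ∈ 𝔄.comp x
  map_str_mul : ∀ (u : L) (a : A'), f ((𝔅.str u : A') * a) = (𝔄.str u : A) * f a
  map_mul_str : ∀ (u : L) (a : A'), f (a * (𝔅.str u : A')) = f a * (𝔄.str u : A)

namespace GradedEmbedding

variable {O L Γ A A' : Type*} [CommRing O] [Group L] [Group Γ] {d : L →* Γ}
    [Ring A] [Algebra O A] [Ring A'] [Algebra O A']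
    {𝔅 : GradedInterior O d A'} {𝔄 : GradedInterior O d A}

/-- The identity of `A`, as an embedding. -/
def refl (𝔄 : GradedInterior O d A) : GradedEmbedding 𝔄 𝔄 where
  f := NonUnitalAlgHom.id O A
  injective _ _ h := h
  range a _ _ := ⟨a, rfl⟩
  map_comp _ _ h := h
  map_str_mul _ _ := rfl
  map_mul_str _ _ := rfl

theorem map_fixed (ε : GradedEmbedding 𝔅 𝔄) {a : A'} (ha : a ∈ 𝔅.fixed) : ε.f a ∈ 𝔄.fixed := by
  rw [GradedInterior.mem_fixed] at ha ⊢
  exact ⟨ε.map_comp _ _ ha.1, fun u => by rw [← ε.map_str_mul, ha.2 u, ε.map_mul_str]⟩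

theorem mem_comp_of_map (ε : GradedEmbedding 𝔅 𝔄) {x : Γ} {a : A'} (ha : ε.f a ∈ 𝔄.comp x) :
    a ∈ 𝔅.comp x := by
  classical
  have h𝔄 : DirectSum.IsInternal 𝔄.comp := by
    have := 𝔄.graded.internal
    convert this
  have h𝔅 : DirectSum.IsInternal 𝔅.comp := by
    have := 𝔅.graded.internal
    convert this
  obtain ⟨b, hb⟩ := h𝔅.surjective a
  have key : ∀ b : DirectSum Γ (fun x => 𝔅.comp x),
      ∃ c : DirectSum Γ (fun x => 𝔄.comp x), DirectSum.coeAddMonoidHom 𝔄.comp c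
        = ε.f (DirectSum.coeAddMonoidHom 𝔅.comp b) ∧ ∀ y, (c y : A) = ε.f (b y) := by
    intro b
    induction b using DirectSum.induction_on with
    | zero => exact ⟨0, by simp, by simp⟩
    | of y m =>
      refine ⟨DirectSum.of (fun x => 𝔄.comp x) y ⟨ε.f m, ε.map_comp _ _ m.2⟩, by simp, ?_⟩
      intro z
      by_cases hz : y = z
      · subst hz; simp
      · rw [DirectSum.of_eq_of_ne _ _ _ (Ne.symm hz), DirectSum.of_eq_of_ne _ _ _ (Ne.symm hz)]
        simp
    | add b₁ b₂ h₁ h₂ =>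
      obtain ⟨c₁, h₁, k₁⟩ := h₁
      obtain ⟨c₂, h₂, k₂⟩ := h₂
      refine ⟨c₁ + c₂, by simp [h₁, h₂], fun y => ?_⟩
      change ((c₁ y + c₂ y : 𝔄.comp y) : A) = ε.f ((b₁ y + b₂ y : 𝔅.comp y) : A')
      simp [k₁, k₂]
  obtain ⟨c, hc, hcb⟩ := key b
  have hc' : c = DirectSum.of (fun x => 𝔄.comp x) x ⟨ε.f a, ha⟩ := by
    apply h𝔄.injective
    rw [hc, hb]; simp
  have hb' : b = DirectSum.of (fun x => 𝔅.comp x) x (b x) := by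
    refine DFinsupp.ext fun y => ?_
    by_cases hy : x = y
    · subst hy; simp
    · have h0 := hcb y
      rw [hc', DirectSum.of_eq_of_ne _ _ _ (Ne.symm hy)] at h0
      have h1 : ((b y : 𝔅.comp y) : A') = 0 := ε.injective (by simpa using h0.symm)
      have h2 : b y = 0 := Subtype.ext h1
      have h3 := DirectSum.of_eq_of_ne (β := fun x => 𝔅.comp x) x y (b x) (Ne.symm hy)
      rw [h2, h3]
  rw [← hb, hb']
  simp

theorem mem_fixed_of_map (ε : GradedEmbedding 𝔅 𝔄) {a : A'} (ha : ε.f a ∈ 𝔄.fixed) :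
    a ∈ 𝔅.fixed := by
  rw [GradedInterior.mem_fixed] at ha ⊢
  exact ⟨ε.mem_comp_of_map ha.1,
    fun u => ε.injective (by rw [ε.map_str_mul, ε.map_mul_str, ha.2 u])⟩

/-- If `e = f 1` satisfies `ei = i = ie`, then `i` determines a point of `L` on `B'`, namely
the one containing the preimage of `i`. -/
noncomputable def pullback (ε : GradedEmbedding 𝔅 𝔄) (γ : 𝔄.Point)
    (h : ε.f 1 * γ.i = γ.i) (h' : γ.i * ε.f 1 = γ.i) : 𝔅.Point where
  i := (ε.range γ.i h h').choose
  mem := ε.mem_fixed_of_map (by rw [(ε.range γ.i h h').choose_spec]; exact γ.mem)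
  idem := ε.injective (by rw [map_mul, (ε.range γ.i h h').choose_spec, γ.idem])
  ne_zero h0 := γ.ne_zero (by
    have := (ε.range γ.i h h').choose_spec
    rw [h0, map_zero] at this
    exact this.symm)
  primitive j hj hjj h1 h2 := by
    have hs := (ε.range γ.i h h').choose_spec
    rcases γ.primitive (ε.f j) (ε.map_fixed hj) (by rw [← map_mul, hjj])
      (by rw [← hs, ← map_mul, h1]) (by rw [← hs, ← map_mul, h2]) with h3 | h3
    · exact Or.inl (ε.injective (by simpa using h3))
    · exact Or.inr (ε.injective (by rw [h3, hs]))

end GradedEmbedding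

/-! ### General constructions on rings and graded algebras -/

/-- The two-sided ideal `m_γ` associated with the primitive idempotent `i`: the largest two-sided
ideal that does not contain `i`. -/
noncomputable def pointIdeal {R : Type*} [Ring R] (i : R) : TwoSidedIdeal R :=
  sSup {I : TwoSidedIdeal R | i ∉ I}

/-- `b` is the block of `R` (a primitive idempotent of the centre) to which the idempotent `j`
belongs. -/
structure IsBlockOf {R : Type*} [Ring R] (b j : R) : Prop where
  central : ∀ r : R, b * r = r * b
  idem : IsIdempotentElem b
  ne_zero : b ≠ 0
  primitive : ∀ c : R, (∀ r : R, c * r = r * c) → c * c = c → b * c = c → c = 0 ∨ c = b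
  mul_eq : b * j = j

section gradedJacobson

variable {O Γ R : Type*} [CommRing O] [Group Γ] [Ring R] [Algebra O R]

/-- A graded left ideal: it is generated by its homogeneous elements. -/
def IsGradedLeftIdeal (comp : Γ → Submodule O R) (I : Ideal R) : Prop :=
  I ≤ Ideal.span {r | r ∈ I ∧ ∃ x, r ∈ comp x}

/-- A maximal graded left ideal. -/
def IsMaxGradedLeftIdeal (comp : Γ → Submodule O R) (I : Ideal R) : Prop :=
  Maximal (fun J : Ideal R => IsGradedLeftIdeal comp J ∧ J ≠ ⊤) I

/-- The graded Jacobson radical: the elements annihilating all the gr-simple modules `R / I`, with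
`I` a maximal graded left ideal. -/
def gradedJacobson (comp : Γ → Submodule O R) : TwoSidedIdeal R :=
  TwoSidedIdeal.mk' {r | ∀ I : Ideal R, IsMaxGradedLeftIdeal comp I → ∀ s : R, r * s ∈ I}
    (fun I _ s => by simp)
    (fun hr hr' I hI s => by rw [add_mul]; exact I.add_mem (hr I hI s) (hr' I hI s))
    (fun hr I hI s => by rw [neg_mul]; exact I.neg_mem (hr I hI s))
    (fun {t r} hr I hI s => by
      change t * r * s ∈ I
      rw [mul_assoc]; exact I.mul_mem_left _ (hr I hI s))
    (fun {r t} hr I hI s => by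
      change r * t * s ∈ I
      rw [mul_assoc]; exact hr I hI _)

end gradedJacobson

section externalAlgebra

variable {O Γ A : Type*} [CommRing O] [Group Γ] [Ring A] [Algebra O A]

/-- The `Γ`-graded algebra `⨁ₓ C x` attached to a multiplicative family of submodules of `A`
(whose sum in `A` need not be direct), realised inside the group algebra `A[Γ]`: its elements
are the sums of terms `a · x` with `a ∈ C x`. -/
noncomputable def externalAlgebra (C : Γ → Submodule O A) (h1 : (1 : A) ∈ C 1)
    (hmul : ∀ (x y : Γ) (a b : A), a ∈ C x → b ∈ C y → a * b ∈ C (x * y)) :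
    Subalgebra O (MonoidAlgebra A Γ) where
  carrier := {s | ∀ x, s.coeff x ∈ C x}
  mul_mem' := by
    classical
    intro a b ha hb x
    rw [MonoidAlgebra.coeff_mul]
    refine Submodule.sum_mem _ fun y _ => Submodule.sum_mem _ fun z _ => ?_
    dsimp only
    split_ifs with h
    · exact h ▸ hmul _ _ _ _ (ha y) (hb z)
    · exact zero_mem _
  add_mem' := by
    intro a b ha hb x
    exact add_mem (ha x) (hb x)
  algebraMap_mem' r x := by
    classical
    rw [Algebra.algebraMap_eq_smul_one, MonoidAlgebra.coeff_smul, Finsupp.smul_apply,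
      MonoidAlgebra.one_def, MonoidAlgebra.coeff_single, Finsupp.single_apply]
    split_ifs with h
    · exact h ▸ Submodule.smul_mem _ _ h1
    · simp

/-- The homogeneous component of degree `x` of `externalAlgebra`. -/
def externalComp (S : Subalgebra O (MonoidAlgebra A Γ)) (x : Γ) : Submodule O S where
  carrier := {s | ∃ a : A, (s : MonoidAlgebra A Γ) = MonoidAlgebra.single x a}
  add_mem' := by
    rintro s t ⟨a, ha⟩ ⟨b, hb⟩
    exact ⟨a + b, by rw [Subalgebra.coe_add, ha, hb, MonoidAlgebra.single_add]⟩
  zero_mem' := ⟨0, by simp⟩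
  smul_mem' := by
    rintro r s ⟨a, ha⟩
    exact ⟨r • a, by rw [Subalgebra.coe_smul, ha, MonoidAlgebra.smul_single]⟩

end externalAlgebra

/-! ### Clifford extension algebras of induced modules

Data: a `Γ`-graded algebra `S` with components `comp`, a homomorphism `ι : S₁ → S` identifying `S₁`
with the component of degree `1`, a surjective homomorphism `q : S₁ → T` and an idempotent `i` of
`S₁`. With `R = S / ⟨ι (ker q)⟩` (when `S = S₁ * Γ` is a crossed product and `ker q` is invariant,
this is the crossed product `T * Γ`) and the left `T`-module `V = T q(i)`, the algebra defined
below is `End_R (R ⊗_T V)ᵒᵖ`. -/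

section clifford

variable {O Γ S S₁ T : Type*} [CommRing O] [Group Γ] [Ring S] [Algebra O S] [Ring S₁] [Ring T]

/-- The two-sided ideal of `S` generated by `ker q`. -/
def kerIdeal (ι : S₁ →+* S) (q : S₁ →+* T) : TwoSidedIdeal S :=
  TwoSidedIdeal.span (ι '' {s | q s = 0})

/-- The graded algebra `R = S / ⟨ι (ker q)⟩`. -/
abbrev QuotAlgebra (ι : S₁ →+* S) (q : S₁ →+* T) : Type _ := S ⧸ (kerIdeal ι q).asIdeal

/-- The class in `R` of an element of `S`. -/
def toQuot (ι : S₁ →+* S) (q : S₁ →+* T) : S →+* QuotAlgebra ι q :=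
  Ideal.Quotient.mk (kerIdeal ι q).asIdeal

/-- The left `T`-module `V = T q(i)`. -/
abbrev HeadModule (q : S₁ →+* T) (i : S₁) : Type _ := Ideal.span {q i}

/-- The generator `q(i)` of `V`. -/
def headGen (q : S₁ →+* T) (i : S₁) : HeadModule q i :=
  ⟨q i, Ideal.subset_span rfl⟩

/-- The relations `r s ⊗ v = r ⊗ s v`, for `s ∈ S₁`. -/
def inducedRel (ι : S₁ →+* S) (q : S₁ →+* T) (i : S₁) :
    Submodule (QuotAlgebra ι q) (QuotAlgebra ι q ⊗[ℤ] HeadModule q i) :=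
  Submodule.span _ {m | ∃ (r : QuotAlgebra ι q) (s : S₁) (v : HeadModule q i),
    m = (r * toQuot ι q (ι s)) ⊗ₜ[ℤ] v - r ⊗ₜ[ℤ] (q s • v)}

/-- The induced `R`-module `R ⊗_T V` (the same as `R ⊗_{S₁} V`, since `q` is surjective). -/
abbrev InducedModule (ι : S₁ →+* S) (q : S₁ →+* T) (i : S₁) : Type _ :=
  (QuotAlgebra ι q ⊗[ℤ] HeadModule q i) ⧸ inducedRel ι q i

/-- The element `s ⊗ v` of `R ⊗_T V`, for `s ∈ S`. -/
def inducedMk (ι : S₁ →+* S) (q : S₁ →+* T) (i : S₁) (s : S) (v : HeadModule q i) :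
    InducedModule ι q i :=
  Submodule.Quotient.mk (toQuot ι q s ⊗ₜ[ℤ] v)

/-- The component of degree `x` of `R ⊗_T V`: the span of the `s ⊗ v` with `s` of degree `x`. -/
def inducedComp (comp : Γ → Submodule O S) (ι : S₁ →+* S) (q : S₁ →+* T) (i : S₁) (x : Γ) :
    Submodule O (InducedModule ι q i) :=
  Submodule.span O {m | ∃ s ∈ comp x, ∃ v, m = inducedMk ι q i s v}

/-- `End_R (R ⊗_T V)ᵒᵖ`. -/
def CliffordEnd (ι : S₁ →+* S) (q : S₁ →+* T) (i : S₁) : Type _ :=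
  (Module.End (QuotAlgebra ι q) (InducedModule ι q i))ᵐᵒᵖ

noncomputable instance (ι : S₁ →+* S) (q : S₁ →+* T) (i : S₁) : Ring (CliffordEnd ι q i) :=
  inferInstanceAs (Ring (Module.End (QuotAlgebra ι q) (InducedModule ι q i))ᵐᵒᵖ)

noncomputable instance (ι : S₁ →+* S) (q : S₁ →+* T) (i : S₁) : Algebra O (CliffordEnd ι q i) :=
  inferInstanceAs (Algebra O (Module.End (QuotAlgebra ι q) (InducedModule ι q i))ᵐᵒᵖ)

/-- The underlying endomorphism. -/
def CliffordEnd.toEnd {ι : S₁ →+* S} {q : S₁ →+* T} {i : S₁} (φ : CliffordEnd ι q i) :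
    Module.End (QuotAlgebra ι q) (InducedModule ι q i) :=
  MulOpposite.unop φ

/-- The component of degree `x` of `End_R (R ⊗_T V)ᵒᵖ`: the endomorphisms mapping the component of
degree `y` to the component of degree `y * x`, for all `y`. -/
def cliffordComp (comp : Γ → Submodule O S) (ι : S₁ →+* S) (q : S₁ →+* T) (i : S₁) (x : Γ) :
    Submodule O (CliffordEnd ι q i) where
  carrier := {φ | ∀ y, ∀ m ∈ inducedComp comp ι q i y, φ.toEnd m ∈ inducedComp comp ι q i (y * x)}
  add_mem' h h' y m hm := add_mem (h y m hm) (h' y m hm)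
  zero_mem' _ _ _ := zero_mem _
  smul_mem' r _ h y m hm := Submodule.smul_mem _ r (h y m hm)

/-- The endomorphism `φ` maps the generator `1 ⊗ q(i)` to `s ⊗ q(i)`; that is, `φ` is induced by the
right multiplication by `s`. -/
def IsRightMulBy (ι : S₁ →+* S) (q : S₁ →+* T) (i : S₁) (φ : CliffordEnd ι q i) (s : S) : Prop :=
  φ.toEnd (inducedMk ι q i 1 (headGen q i)) = inducedMk ι q i s (headGen q i)

end clifford

/-! ### Fusions and the algebra `ℱ` of a point of a graded interior algebra -/

section fusion

variable {O P Γ A : Type*} [CommRing O] [Group P] [Group Γ] {d : P →* Γ} [Ring A] [Algebra O A]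

/-- The left `A`-module `Ai`. -/
abbrev LeftIdealOf (i : A) : Type _ := Ideal.span {i}

/-- `f` is an isomorphism `Ai ≃ (Ai)(x⁻¹)_φ` of `Γ`-graded `(A, OP)`-bimodules; the
component of degree `y` of `(Ai)(x⁻¹)` is `(Ai)_{y x⁻¹}`, and `u` acts on the right of `(Ai)_φ` as
`φ u` does on the right of `Ai`. -/
structure IsFusionIso {𝔄 : GradedInterior O d A} (γ : 𝔄.Point) (φ : MulAut P) (x : Γ)
    (f : LeftIdealOf γ.i ≃ₗ[A] LeftIdealOf γ.i) : Prop where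
  map_comp : ∀ (y : Γ) (m : LeftIdealOf γ.i), (m : A) ∈ 𝔄.comp y ↔ (f m : A) ∈ 𝔄.comp (y * x⁻¹)
  map_str : ∀ (u : P) (m m' : LeftIdealOf γ.i), (m' : A) = m * (𝔄.str u : A) →
    (f m' : A) = f m * (𝔄.str (φ u) : A)

/-- The group of `(A, Γ)`-fusions `F_A^Γ(P_γ)`: the pairs `(φ, x)` in `Aut(P) × Γ` with
`d (φ u) = x (d u) x⁻¹` for all `u` in `P` and `Ai ≃ (Ai)(x⁻¹)_φ` as `Γ`-graded
`(A, OP)`-bimodules. -/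
def fusionGroup {𝔄 : GradedInterior O d A} (γ : 𝔄.Point) : Subgroup (MulAut P × Γ) where
  carrier := {φ | (∀ u : P, d (φ.1 u) = φ.2 * d u * φ.2⁻¹) ∧
    ∃ f : LeftIdealOf γ.i ≃ₗ[A] LeftIdealOf γ.i, IsFusionIso γ φ.1 φ.2 f}
  one_mem' := ⟨by simp, LinearEquiv.refl A _, ⟨by simp, fun u m m' h => by simpa using h⟩⟩
  mul_mem' := by
    rintro ⟨φ, x⟩ ⟨ψ, y⟩ ⟨h, f, hf⟩ ⟨h', g, hg⟩
    refine ⟨fun u => ?_, g.trans f, ⟨fun z m => ?_, fun u m m' hm => ?_⟩⟩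
    · have := h (ψ u)
      simp only at this h' ⊢
      simp [this, h', mul_assoc]
    · rw [hg.map_comp, hf.map_comp]
      simp [mul_assoc]
    · exact hf.map_str _ _ _ (hg.map_str _ _ _ hm)
  inv_mem' := by
    rintro ⟨φ, x⟩ ⟨h, f, hf⟩
    refine ⟨fun u => ?_, f.symm, ⟨fun z m => ?_, fun u m m' hm => ?_⟩⟩
    · have := h (φ⁻¹ u)
      simp only [MulAut.apply_inv_self] at this
      simp [this, mul_assoc]
    · have := hf.map_comp (z * x) (f.symm m)
      simp at this
      simpa using this.symm
    · have hmem : (f.symm m : A) * (𝔄.str (φ⁻¹ u) : A) ∈ Ideal.span {γ.i} := by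
        obtain ⟨a, ha⟩ := Ideal.mem_span_singleton'.1 (f.symm m).2
        rw [← ha, mul_assoc, ← (GradedInterior.mem_fixed.1 γ.mem).2, ← mul_assoc]
        exact Ideal.mul_mem_left _ _ (Ideal.subset_span rfl)
      have h1 := hf.map_str (φ⁻¹ u) (f.symm m) ⟨_, hmem⟩ rfl
      rw [LinearEquiv.apply_symm_apply, MulAut.apply_inv_self, ← hm] at h1
      have h2 : f ⟨_, hmem⟩ = m' := Subtype.ext h1
      rw [← h2, LinearEquiv.symm_apply_apply]
      rfl

/-- The action of `F` on `P`. -/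
def fusionAction {𝔄 : GradedInterior O d A} (γ : 𝔄.Point) : fusionGroup γ →* MulAut P :=
  (MonoidHom.fst (MulAut P) Γ).comp (fusionGroup γ).subtype

/-- The crossed product `C = OP * F`, that is, the group algebra of the semidirect product
`P ⋊ F`; here `u * φ` is the group element `⟨u, φ⟩`. -/
abbrev FusionCrossed {𝔄 : GradedInterior O d A} (γ : 𝔄.Point) : Type _ :=
  MonoidAlgebra O (P ⋊[fusionAction γ] fusionGroup γ)

/-- The relations `m u ⊗ c = m ⊗ u c`, for `u ∈ P`. -/
noncomputable def fusionRel {𝔄 : GradedInterior O d A} (γ : 𝔄.Point) :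
    Submodule A (LeftIdealOf γ.i ⊗[O] FusionCrossed γ) :=
  Submodule.span A {t | ∃ (u : P) (m m' : LeftIdealOf γ.i) (c : FusionCrossed γ),
    (m' : A) = m * (𝔄.str u : A) ∧
    t = m' ⊗ₜ[O] c - m ⊗ₜ[O] (MonoidAlgebra.single (SemidirectProduct.inl u) 1 * c)}

/-- The `(A, C)`-bimodule `Ai ⊗_{OP} C`. -/
abbrev FusionModule {𝔄 : GradedInterior O d A} (γ : 𝔄.Point) : Type _ :=
  (LeftIdealOf γ.i ⊗[O] FusionCrossed γ) ⧸ fusionRel γ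

/-- `m ⊗ c` as an element of `Ai ⊗_{OP} C`. -/
noncomputable def fusionMk {𝔄 : GradedInterior O d A} (γ : 𝔄.Point) (m : LeftIdealOf γ.i) (c : FusionCrossed γ) :
    FusionModule γ :=
  Submodule.Quotient.mk (m ⊗ₜ[O] c)

/-- The right multiplication by `c` on `Ai ⊗_{OP} C`. -/
noncomputable def fusionRight {𝔄 : GradedInterior O d A} (γ : 𝔄.Point) (c : FusionCrossed γ) :
    FusionModule γ →ₗ[A] FusionModule γ :=
  Submodule.mapQ _ _
    (TensorProduct.AlgebraTensorModule.map (LinearMap.id : LeftIdealOf γ.i →ₗ[A] LeftIdealOf γ.i)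
      (LinearMap.mulRight O c))
    (by
      rw [fusionRel, Submodule.span_le]
      rintro _ ⟨u, m, m', c', h, rfl⟩
      refine Submodule.subset_span ⟨u, m, m', c' * c, h, ?_⟩
      simp [mul_assoc])

/-- The component of degree `y ∈ Γ` of `Ai ⊗_{OP} C`, where `C` is `Γ`-graded with `u * (φ, x)` of
degree `d u * x`. -/
noncomputable def fusionGradΓ {𝔄 : GradedInterior O d A} (γ : 𝔄.Point) (y : Γ) : Submodule O (FusionModule γ) :=
  Submodule.span O {t | ∃ (z : Γ) (m : LeftIdealOf γ.i) (u : P) (φ : fusionGroup γ),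
    (m : A) ∈ 𝔄.comp z ∧ z * (d u * φ.1.2) = y ∧
    t = fusionMk γ m (MonoidAlgebra.single ⟨u, φ⟩ 1)}

/-- The component of degree `ψ ∈ F` of `Ai ⊗_{OP} C`. -/
noncomputable def fusionGradF {𝔄 : GradedInterior O d A} (γ : 𝔄.Point) (ψ : fusionGroup γ) :
    Submodule O (FusionModule γ) :=
  Submodule.span O {t | ∃ (m : LeftIdealOf γ.i) (u : P),
    t = fusionMk γ m (MonoidAlgebra.single ⟨u, ψ⟩ 1)}

/-- The endomorphisms of the `(A, C)`-bimodule `Ai ⊗_{OP} C` that preserve the `Γ`-grading. -/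
noncomputable def fusionEnd {𝔄 : GradedInterior O d A} (γ : 𝔄.Point) :
    Subalgebra O (Module.End A (FusionModule γ)) where
  carrier := {h | (∀ c t, h (fusionRight γ c t) = fusionRight γ c (h t)) ∧
    ∀ y, ∀ t ∈ fusionGradΓ γ y, h t ∈ fusionGradΓ γ y}
  mul_mem' := by
    rintro a b ⟨ha, ha'⟩ ⟨hb, hb'⟩
    exact ⟨fun c t => by simp [hb, ha], fun y t ht => ha' y _ (hb' y t ht)⟩
  add_mem' := by
    rintro a b ⟨ha, ha'⟩ ⟨hb, hb'⟩
    exact ⟨fun c t => by simp [hb, ha], fun y t ht => add_mem (ha' y t ht) (hb' y t ht)⟩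
  algebraMap_mem' r := by
    refine ⟨fun c t => ?_, fun y t ht => ?_⟩
    · simp only [Module.algebraMap_end_apply]
      exact (LinearMap.map_smul_of_tower (fusionRight γ c) r t).symm
    · simp only [Module.algebraMap_end_apply]
      exact Submodule.smul_mem _ r ht

/-- The algebra `ℱ = End_{A-Gr ⊗ Cᵒᵖ}(Ai ⊗_{OP} C)ᵒᵖ`. -/
def FAlg {𝔄 : GradedInterior O d A} (γ : 𝔄.Point) : Type _ := (fusionEnd γ)ᵐᵒᵖ

noncomputable instance {𝔄 : GradedInterior O d A} (γ : 𝔄.Point) : Ring (FAlg γ) :=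
  inferInstanceAs (Ring (fusionEnd γ)ᵐᵒᵖ)

noncomputable instance {𝔄 : GradedInterior O d A} (γ : 𝔄.Point) : Algebra O (FAlg γ) :=
  inferInstanceAs (Algebra O (fusionEnd γ)ᵐᵒᵖ)

/-- The underlying endomorphism. -/
noncomputable def FAlg.toEnd {𝔄 : GradedInterior O d A} {γ : 𝔄.Point} (h : FAlg γ) :
    Module.End A (FusionModule γ) :=
  (MulOpposite.unop (α := fusionEnd γ) h).1

/-- The component of degree `φ ∈ F` of `ℱ`. Bimodule endomorphisms map the component of degree `ψ` of
`Ai ⊗_{OP} C` to that of degree `χ ψ`, for a fixed `χ ∈ F`; because of the opposite multiplication in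
`ℱ`, their degree in `ℱ` is `χ⁻¹`. -/
noncomputable def fComp {𝔄 : GradedInterior O d A} (γ : 𝔄.Point) (φ : fusionGroup γ) : Submodule O (FAlg γ) where
  carrier := {h | ∀ ψ, ∀ t ∈ fusionGradF γ ψ,
    h.toEnd t ∈ fusionGradF γ (φ⁻¹ * ψ)}
  add_mem' h h' _ _ hm := add_mem (h _ _ hm) (h' _ _ hm)
  zero_mem' _ _ _ := zero_mem _
  smul_mem' r _ h _ _ hm := Submodule.smul_mem _ r (h _ _ hm)

/-- The residual algebra `ℱ / J_gr(ℱ)`. -/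
def FBar {𝔄 : GradedInterior O d A} (γ : 𝔄.Point) : Type _ :=
  FAlg γ ⧸ (gradedJacobson (fComp γ)).asIdeal

noncomputable instance {𝔄 : GradedInterior O d A} (γ : 𝔄.Point) : Ring (FBar γ) :=
  inferInstanceAs (Ring (FAlg γ ⧸ (gradedJacobson (fComp γ)).asIdeal))

noncomputable instance {𝔄 : GradedInterior O d A} (γ : 𝔄.Point) : Algebra O (FBar γ) :=
  inferInstanceAs (Algebra O (FAlg γ ⧸ (gradedJacobson (fComp γ)).asIdeal))

/-- The projection from `ℱ` to its residual algebra. -/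
noncomputable def toFBar {𝔄 : GradedInterior O d A} (γ : 𝔄.Point) : FAlg γ →ₐ[O] FBar γ :=
  Ideal.Quotient.mkₐ O (gradedJacobson (fComp γ)).asIdeal

/-- The component of degree `φ ∈ F` of the residual algebra. -/
noncomputable def fBarComp {𝔄 : GradedInterior O d A} (γ : 𝔄.Point) (φ : fusionGroup γ) : Submodule O (FBar γ) :=
  (fComp γ φ).map (toFBar γ).toLinearMap

/-- The element `h` of `ℱ` maps the generator `i ⊗ 1` to `y ⊗ φ⁻¹`; that is, `h` is the element of
degree `φ` induced by the right multiplication by `y`. -/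
def IsFRightMulBy {𝔄 : GradedInterior O d A} (γ : 𝔄.Point) (h : FAlg γ) (φ : fusionGroup γ) (y : A) :
    Prop :=
  ∃ m₀ m : LeftIdealOf γ.i, (m₀ : A) = γ.i ∧ (m : A) = y ∧
    h.toEnd (fusionMk γ m₀ 1)
      = fusionMk γ m (MonoidAlgebra.single (SemidirectProduct.inr φ⁻¹) 1)

end fusion

/-! ### Local points and the Brauer quotient -/

section brauer

variable {O L Γ A : Type*} [CommRing O] [IsLocalRing O] [Group L] [Group Γ] {d : L →* Γ} [Ring A]
  [Algebra O A]

/-- The primitive idempotent of a point, as an element of `B^L`. -/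
def GradedInterior.Point.elt {𝔄 : GradedInterior O d A} (γ : 𝔄.Point) : 𝔄.fixed := ⟨γ.i, γ.mem⟩

/-- The kernel of the Brauer map `Br_L`: the ideal `∑_{Q < L} Tr_Q^L (B^Q) + J(O) B^L` of `B^L`. -/
noncomputable def brauerIdeal (𝔄 : GradedInterior O d A) : TwoSidedIdeal 𝔄.fixed :=
  TwoSidedIdeal.span
    ({t | ∃ Q : Subgroup L, Q ≠ ⊤ ∧ ∃ a ∈ 𝔄.fixedBy Q,
        (t : A) = ∑ᶠ x : L ⧸ Q, (𝔄.str x.out : A) * a * (𝔄.str (x.out)⁻¹ : A)} ∪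
      {t | ∃ r ∈ IsLocalRing.maximalIdeal O, t = algebraMap O 𝔄.fixed r})

/-- The Brauer quotient `B(L)`. -/
def BrauerQuotient (𝔄 : GradedInterior O d A) : Type _ := 𝔄.fixed ⧸ (brauerIdeal 𝔄).asIdeal

noncomputable instance (𝔄 : GradedInterior O d A) : Ring (BrauerQuotient 𝔄) :=
  inferInstanceAs (Ring (𝔄.fixed ⧸ (brauerIdeal 𝔄).asIdeal))

/-- The Brauer map `Br_L : B^L → B(L)`. -/
noncomputable def brauerMap (𝔄 : GradedInterior O d A) : 𝔄.fixed →+* BrauerQuotient 𝔄 :=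
  Ideal.Quotient.mk (brauerIdeal 𝔄).asIdeal

/-- The point is local: `Br_L(i) ≠ 0`. -/
def GradedInterior.Point.IsLocal {𝔄 : GradedInterior O d A} (γ : 𝔄.Point) : Prop :=
  brauerMap 𝔄 γ.elt ≠ 0

/-- `b` is the block `b_γ` of `B(L)` to which the point `Br_L(γ)` belongs. -/
def GradedInterior.Point.IsBlock {𝔄 : GradedInterior O d A} (γ : 𝔄.Point)
    (b : BrauerQuotient 𝔄) : Prop :=
  IsBlockOf b (brauerMap 𝔄 γ.elt)

/-- The simple quotient `B(L_γ) = B^L / m_γ` of `B^L`. -/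
def SimpleQuotient {𝔄 : GradedInterior O d A} (γ : 𝔄.Point) : Type _ :=
  𝔄.fixed ⧸ (pointIdeal γ.elt).asIdeal

noncomputable instance {𝔄 : GradedInterior O d A} (γ : 𝔄.Point) : Ring (SimpleQuotient γ) :=
  inferInstanceAs (Ring (𝔄.fixed ⧸ (pointIdeal γ.elt).asIdeal))

/-- The projection `B^L → B(L_γ)`. -/
noncomputable def toSimpleQuotient {𝔄 : GradedInterior O d A} (γ : 𝔄.Point) :
    𝔄.fixed →+* SimpleQuotient γ :=
  Ideal.Quotient.mk (pointIdeal γ.elt).asIdeal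

variable {𝔄 : GradedInterior O d A} (γ : 𝔄.Point) {b : BrauerQuotient 𝔄} (hb : γ.IsBlock b)

/-- The ideal `m^* = m_{Br(γ)} ∩ B(L) b_γ` of the block algebra `B(L) b_γ`. -/
noncomputable def starIdeal : TwoSidedIdeal (IsBlockOf.idem hb).Corner :=
  TwoSidedIdeal.mk' {x | x.1 ∈ pointIdeal (brauerMap 𝔄 γ.elt)}
    (TwoSidedIdeal.zero_mem (pointIdeal (brauerMap 𝔄 γ.elt)))
    (fun {x y} h h' => by
      have h'' : x.1 + y.1 ∈ pointIdeal (brauerMap 𝔄 γ.elt) := TwoSidedIdeal.add_mem _ h h'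
      exact h'')
    (fun {x} h => by
      have h' : -x.1 ∈ pointIdeal (brauerMap 𝔄 γ.elt) := TwoSidedIdeal.neg_mem _ h
      exact h')
    (fun {x y} h => by
      have h' : x.1 * y.1 ∈ pointIdeal (brauerMap 𝔄 γ.elt) :=
        TwoSidedIdeal.mul_mem_left _ _ _ h
      exact h')
    (fun {x y} h => by
      have h' : x.1 * y.1 ∈ pointIdeal (brauerMap 𝔄 γ.elt) :=
        TwoSidedIdeal.mul_mem_right _ _ _ h
      exact h')

/-- The quotient `B(L) b_γ / m^*`. -/
def LocalQuotient : Type _ := (IsBlockOf.idem hb).Corner ⧸ (starIdeal γ hb).asIdeal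

noncomputable instance : Ring (LocalQuotient γ hb) :=
  inferInstanceAs (Ring ((IsBlockOf.idem hb).Corner ⧸ (starIdeal γ hb).asIdeal))

/-- The homomorphism `B^L → B(L) b_γ / m^*` mapping `a` to the class of `Br_L(a) b_γ`. -/
noncomputable def toLocalQuotient : 𝔄.fixed →+* LocalQuotient γ hb :=
  (Ideal.Quotient.mk (starIdeal γ hb).asIdeal).comp
    { toFun := fun a => ⟨b * brauerMap 𝔄 a * b, brauerMap 𝔄 a, rfl⟩
      map_one' := Subtype.ext (by
        change b * brauerMap 𝔄 1 * b = b
        rw [map_one, mul_one, hb.idem.eq])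
      map_mul' := fun x y => Subtype.ext (by
        change b * brauerMap 𝔄 (x * y) * b
          = (b * brauerMap 𝔄 x * b) * (b * brauerMap 𝔄 y * b)
        simp only [map_mul, hb.central, mul_assoc, hb.idem.eq])
      map_zero' := Subtype.ext (by
        change b * brauerMap 𝔄 0 * b = 0
        simp)
      map_add' := fun x y => Subtype.ext (by
        change b * brauerMap 𝔄 (x + y) * b = b * brauerMap 𝔄 x * b + b * brauerMap 𝔄 y * b
        simp [mul_add, add_mul]) }

end brauer

/-! ### The group `E` and the algebras `ℰ̄` and `ℰ̄(P)` -/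

section groupE

variable {G : Type*} [Group G]

/-- `C_H(P)`, as a subgroup of `N_G(P)`. -/
def centralizerIn (H P : Subgroup G) : Subgroup (Subgroup.normalizer (P : Set G)) :=
  (H ⊓ Subgroup.centralizer (P : Set G)).subgroupOf (Subgroup.normalizer (P : Set G))

instance (H P : Subgroup G) [H.Normal] : (centralizerIn H P).Normal := by
  refine ⟨fun c hc g => ?_⟩
  obtain ⟨hc1, hc2⟩ := Subgroup.mem_subgroupOf.1 hc
  refine Subgroup.mem_subgroupOf.2 ⟨by simpa using Subgroup.Normal.conj_mem ‹_› _ hc1 (g : G), ?_⟩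
  refine Subgroup.mem_centralizer_iff.2 fun u hu => ?_
  have hu' : (g : G)⁻¹ * u * g ∈ P := (Subgroup.mem_normalizer_iff''.1 g.2 u).1 hu
  have := Subgroup.mem_centralizer_iff.1 hc2 _ hu'
  simp only [Subgroup.coe_mul, InvMemClass.coe_inv]
  calc u * ((g : G) * c * (g : G)⁻¹) = g * (((g : G)⁻¹ * u * g) * c) * (g : G)⁻¹ := by group
    _ = _ := by rw [this]; group

/-- The group `N / C_H(P)`, where `N` is the stabilizer of a pointed group in `N_G(P)`. -/
abbrev EGroup (H P : Subgroup G) [H.Normal] (N : Subgroup (Subgroup.normalizer (P : Set G))) :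
    Type _ :=
  N ⧸ (centralizerIn H P).subgroupOf N

/-- The projection `N → N / C_H(P)`. -/
def toE (H P : Subgroup G) [H.Normal] (N : Subgroup (Subgroup.normalizer (P : Set G))) :
    N →* EGroup H P N :=
  QuotientGroup.mk' ((centralizerIn H P).subgroupOf N)

theorem toE_surjective (H P : Subgroup G) [H.Normal]
    (N : Subgroup (Subgroup.normalizer (P : Set G))) : Function.Surjective (toE H P N) :=
  QuotientGroup.mk'_surjective _

variable {O A A' : Type*} [CommRing O] [Ring A] [Algebra O A] [Ring A'] [Algebra O A']
  {H : Subgroup G} [H.Normal] (𝔄 : GradedInterior O (QuotientGroup.mk' H) A) (P : Subgroup G)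

/-- `N_G(P)` acts on `B^P`. -/
theorem conj_mem_fixed {g : G} (hg : g ∈ Subgroup.normalizer (P : Set G)) {a : A}
    (ha : a ∈ (𝔄.res P).fixed) :
    (𝔄.str g : A) * a * (𝔄.str g⁻¹ : A) ∈ (𝔄.res P).fixed := by
  rw [GradedInterior.mem_fixed] at ha ⊢
  refine ⟨?_, fun u => ?_⟩
  · have h1 : (𝔄.str g : A) * a * (𝔄.str g⁻¹ : A) ∈ 𝔄.comp _ :=
      𝔄.graded.mul_mem (𝔄.graded.mul_mem (𝔄.str_mem g) ha.1) (𝔄.str_mem g⁻¹)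
    have h0 : QuotientGroup.mk' H g * 1 * QuotientGroup.mk' H g⁻¹ = 1 := by simp
    rwa [h0] at h1
  · have hu' : g⁻¹ * u * g ∈ P := (Subgroup.mem_normalizer_iff''.1 hg u).1 u.2
    have h2 : (𝔄.str (g⁻¹ * u * g) : A) * a = a * (𝔄.str (g⁻¹ * u * g) : A) := ha.2 ⟨_, hu'⟩
    change (𝔄.str u : A) * _ = _ * (𝔄.str u : A)
    have e1 : (𝔄.str u : A) * (𝔄.str g : A) = (𝔄.str g : A) * (𝔄.str (g⁻¹ * u * g) : A) := by
      rw [← Units.val_mul, ← Units.val_mul, ← map_mul, ← map_mul]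
      congr 2; group
    have e2 : (𝔄.str (g⁻¹ * u * g) : A) * (𝔄.str g⁻¹ : A) = (𝔄.str g⁻¹ : A) * (𝔄.str u : A) := by
      rw [← Units.val_mul, ← Units.val_mul, ← map_mul, ← map_mul]
      congr 2; group
    calc (𝔄.str u : A) * ((𝔄.str g : A) * a * (𝔄.str g⁻¹ : A))
        = ((𝔄.str u : A) * (𝔄.str g : A)) * a * (𝔄.str g⁻¹ : A) := by simp only [mul_assoc]
      _ = (𝔄.str g : A) * ((𝔄.str (g⁻¹ * u * g) : A) * a) * (𝔄.str g⁻¹ : A) := by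
          rw [e1]; simp only [mul_assoc]
      _ = (𝔄.str g : A) * a * ((𝔄.str (g⁻¹ * u * g) : A) * (𝔄.str g⁻¹ : A)) := by
          rw [h2]; simp only [mul_assoc]
      _ = _ := by rw [e2]; simp only [mul_assoc]

/-- The stabilizer `N_G(P_γ)` in `N_G(P)` of the point `γ` of `P` on `B`: the elements `g` such that
`ᵍi` is conjugate to `i` under the group of units of `B^P`. -/
def pointNormalizer (γ : (𝔄.res P).Point) : Subgroup (Subgroup.normalizer (P : Set G)) where
  carrier := {g | ∃ a ∈ (𝔄.res P).fixed, ∃ a' ∈ (𝔄.res P).fixed, a * a' = 1 ∧ a' * a = 1 ∧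
    (𝔄.str g : A) * γ.i * (𝔄.str (g : G)⁻¹ : A) = a * γ.i * a'}
  mul_mem' := by
    rintro g h ⟨a, ha, a', ha', h1, h2, h3⟩ ⟨c, hc, c', hc', k1, k2, k3⟩
    have hinv : (𝔄.str (g : G)⁻¹ : A) * (𝔄.str g : A) = 1 := by simp
    have key : ∀ x y : A, (𝔄.str g : A) * (x * y) * (𝔄.str (g : G)⁻¹ : A)
        = ((𝔄.str g : A) * x * (𝔄.str (g : G)⁻¹ : A)) *
          ((𝔄.str g : A) * y * (𝔄.str (g : G)⁻¹ : A)) := fun x y => by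
      calc _ = (𝔄.str g : A) * x * 1 * y * (𝔄.str (g : G)⁻¹ : A) := by
            simp only [mul_assoc, mul_one]
        _ = _ := by rw [← hinv]; simp only [mul_assoc]
    have hone : (𝔄.str g : A) * 1 * (𝔄.str (g : G)⁻¹ : A) = 1 := by simp
    refine ⟨_, mul_mem (conj_mem_fixed 𝔄 P g.2 hc) ha, _,
      mul_mem ha' (conj_mem_fixed 𝔄 P g.2 hc'), ?_, ?_, ?_⟩
    · calc _ = ((𝔄.str g : A) * c * (𝔄.str (g : G)⁻¹ : A)) * (a * a') *
            ((𝔄.str g : A) * c' * (𝔄.str (g : G)⁻¹ : A)) := by simp only [mul_assoc]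
        _ = 1 := by rw [h1, mul_one, ← key, k1, hone]
    · calc _ = a' * (((𝔄.str g : A) * c' * (𝔄.str (g : G)⁻¹ : A)) *
            ((𝔄.str g : A) * c * (𝔄.str (g : G)⁻¹ : A))) * a := by simp only [mul_assoc]
        _ = 1 := by rw [← key, k2, hone, mul_one, h2]
    · have e1 : (𝔄.str ((g * h : Subgroup.normalizer (P : Set G)) : G) : A) = (𝔄.str g : A) * (𝔄.str h : A) := by simp
      have e2 : (𝔄.str ((g * h : Subgroup.normalizer (P : Set G)) : G)⁻¹ : A)
          = (𝔄.str (h : G)⁻¹ : A) * (𝔄.str (g : G)⁻¹ : A) := by simp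
      rw [e1, e2]
      calc _ = (𝔄.str g : A) * ((𝔄.str h : A) * γ.i * (𝔄.str (h : G)⁻¹ : A)) *
            (𝔄.str (g : G)⁻¹ : A) := by simp only [mul_assoc]
        _ = ((𝔄.str g : A) * c * (𝔄.str (g : G)⁻¹ : A)) *
            ((𝔄.str g : A) * γ.i * (𝔄.str (g : G)⁻¹ : A)) *
            ((𝔄.str g : A) * c' * (𝔄.str (g : G)⁻¹ : A)) := by rw [k3, key, key]
        _ = _ := by rw [h3]; simp only [mul_assoc]
  one_mem' := ⟨1, one_mem _, 1, one_mem _, by simp, by simp, by simp⟩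
  inv_mem' := by
    rintro g ⟨a, ha, a', ha', h1, h2, h3⟩
    have hinv : (𝔄.str (g : G)⁻¹ : A) * (𝔄.str g : A) = 1 := by simp
    have hinv' : (𝔄.str (g : G) : A) * (𝔄.str (g : G)⁻¹ : A) = 1 := by simp
    have m1 := conj_mem_fixed 𝔄 P (inv_mem g.2) ha
    have m2 := conj_mem_fixed 𝔄 P (inv_mem g.2) ha'
    rw [inv_inv] at m1 m2
    have key : ∀ x y : A, (𝔄.str (g : G)⁻¹ : A) * (x * y) * (𝔄.str (g : G) : A)
        = ((𝔄.str (g : G)⁻¹ : A) * x * (𝔄.str (g : G) : A)) *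
          ((𝔄.str (g : G)⁻¹ : A) * y * (𝔄.str (g : G) : A)) := fun x y => by
      calc _ = (𝔄.str (g : G)⁻¹ : A) * x * 1 * y * (𝔄.str (g : G) : A) := by
            simp only [mul_assoc, mul_one]
        _ = _ := by rw [← hinv']; simp only [mul_assoc]
    refine ⟨_, m2, _, m1, by rw [← key, h2, mul_one, hinv], by rw [← key, h1, mul_one, hinv], ?_⟩
    change (𝔄.str (g : G)⁻¹ : A) * γ.i * (𝔄.str ((g : G)⁻¹)⁻¹ : A) = _
    rw [inv_inv]
    have h4 : γ.i = a' * ((𝔄.str g : A) * γ.i * (𝔄.str (g : G)⁻¹ : A)) * a := by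
      rw [h3]
      calc γ.i = (a' * a) * γ.i * (a' * a) := by rw [h2]; simp
        _ = _ := by simp only [mul_assoc]
    have h5 : (𝔄.str (g : G)⁻¹ : A) * ((𝔄.str g : A) * γ.i * (𝔄.str (g : G)⁻¹ : A)) *
        (𝔄.str (g : G) : A) = γ.i := by
      calc _ = ((𝔄.str (g : G)⁻¹ : A) * (𝔄.str g : A)) * γ.i *
            ((𝔄.str (g : G)⁻¹ : A) * (𝔄.str g : A)) := by simp only [mul_assoc]
        _ = _ := by rw [hinv]; simp
    conv_lhs => rw [h4]
    rw [key, key, h5]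

variable {𝔄 P} {𝔅 : GradedInterior O ((QuotientGroup.mk' H).comp P.subtype) A'}
  (ε : GradedEmbedding 𝔅 (𝔄.res P))

/-- For `e = f 1`, the preimage in `A'` of the submodule `e (B^P g) e` of `eAe`. -/
def fineComp (g : G) : Submodule O A' where
  carrier := {a | ε.f a * (𝔄.str g⁻¹ : A) ∈ (𝔄.res P).fixed}
  add_mem' h h' := by
    simp only [Set.mem_ofPred_eq, map_add, add_mul] at *
    exact add_mem h h'
  zero_mem' := by simp
  smul_mem' r a h := by
    simp only [Set.mem_ofPred_eq, map_smul, smul_mul_assoc] at *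
    exact Subalgebra.smul_mem _ h r

theorem mem_fineComp {g : G} {a : A'} :
    a ∈ fineComp ε g ↔ ε.f a * (𝔄.str g⁻¹ : A) ∈ (𝔄.res P).fixed := Iff.rfl

theorem fineComp_mul {g h : G} (hg : g ∈ Subgroup.normalizer (P : Set G)) {a b : A'}
    (ha : a ∈ fineComp ε g) (hb : b ∈ fineComp ε h) : a * b ∈ fineComp ε (g * h) := by
  rw [mem_fineComp] at *
  have h1 := mul_mem ha (conj_mem_fixed 𝔄 P hg hb)
  convert h1 using 1
  have e2 : (𝔄.str (g * h)⁻¹ : A) = (𝔄.str h⁻¹ : A) * (𝔄.str g⁻¹ : A) := by simp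
  have hinv : (𝔄.str g⁻¹ : A) * (𝔄.str g : A) = 1 := by simp
  rw [e2, map_mul]
  calc _ = ε.f a * 1 * ε.f b * (𝔄.str h⁻¹ : A) * (𝔄.str g⁻¹ : A) := by
        simp only [mul_assoc, one_mul]
    _ = _ := by rw [← hinv]; simp only [mul_assoc]

theorem fineComp_of_fixed {g : G} (hg : g ∈ H ⊓ Subgroup.centralizer (P : Set G)) {a : A'}
    (ha : a ∈ 𝔅.fixed) : a ∈ fineComp ε g := by
  rw [mem_fineComp]
  refine mul_mem (ε.map_fixed ha) (GradedInterior.mem_fixed.2 ⟨?_, fun u => ?_⟩)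
  · have h1 := 𝔄.str_mem g⁻¹
    rwa [show QuotientGroup.mk' H g⁻¹ = 1 from
      (QuotientGroup.eq_one_iff _).2 (inv_mem hg.1)] at h1
  · change (𝔄.str u : A) * (𝔄.str g⁻¹ : A) = (𝔄.str g⁻¹ : A) * (𝔄.str u : A)
    rw [← Units.val_mul, ← Units.val_mul, ← map_mul, ← map_mul]
    congr 2
    exact Subgroup.mem_centralizer_iff.1 (inv_mem hg.2) _ u.2

/-- The stabilizer `N_G(P_{γ'})` in `N_G(P)` of a point `γ'` of `P` on `B' = eBe`, for
`e` an idempotent of `B^P`. The algebra `⨁_g e (B^P g) e` is `N_G(P)`-graded, with `B'^P = eB^Pe` as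
identity component; the stabilizer consists of the `g` such that the graded left ideal generated by
`i'` is isomorphic to its shift by `g`: there is an element `z` of degree `g`, and an element `z'`
of degree `g⁻¹`, which are mutually inverse in the corner of `i'`. If `g` fixes `e`, this means that
`ᵍγ' = γ'`. -/
def embeddedPointNormalizer (γ' : 𝔅.Point) : Subgroup (Subgroup.normalizer (P : Set G)) where
  carrier := {g | ∃ z ∈ fineComp ε (g : G), ∃ z' ∈ fineComp ε (g : G)⁻¹,
    z * z' = γ'.i ∧ z' * z = γ'.i ∧ γ'.i * z = z ∧ γ'.i * z' = z'}
  mul_mem' := by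
    rintro g h ⟨z, hz, z', hz', h1, h2, h3, h4⟩ ⟨w, hw, w', hw', k1, k2, k3, k4⟩
    refine ⟨z * w, fineComp_mul ε g.2 hz hw, w' * z', ?_, ?_, ?_, ?_, ?_⟩
    · have := fineComp_mul ε (inv_mem h.2) hw' hz'
      simpa using this
    · calc z * w * (w' * z') = z * ((w * w') * z') := by simp only [mul_assoc]
        _ = γ'.i := by rw [k1, h4, h1]
    · calc w' * z' * (z * w) = w' * ((z' * z) * w) := by simp only [mul_assoc]
        _ = γ'.i := by rw [h2, k3, k2]
    · rw [← mul_assoc, h3]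
    · rw [← mul_assoc, k4]
  one_mem' := by
    have h : γ'.i ∈ fineComp ε (1 : G) := fineComp_of_fixed ε (one_mem _) γ'.mem
    exact ⟨γ'.i, h, γ'.i, by simpa using h, γ'.idem, γ'.idem, γ'.idem, γ'.idem⟩
  inv_mem' := by
    rintro g ⟨z, hz, z', hz', h1, h2, h3, h4⟩
    exact ⟨z', by simpa using hz', z, by simpa using hz, h2, h1, h4, h3⟩

variable (N : Subgroup (Subgroup.normalizer (P : Set G)))

/-- For `e = f 1` and `x ∈ E = N / C_H(P)`, the preimage in `A'` of `e (B^P g) e`, where `g ∈ N` is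
any representative of `x`. -/
def crossedComp (x : EGroup H P N) : Submodule O A' :=
  ⨅ (g : N) (_ : toE H P N g = x), fineComp ε (g : G)

theorem mem_crossedComp {x : EGroup H P N} {a : A'} :
    a ∈ crossedComp ε N x ↔ ∀ g : N, toE H P N g = x → a ∈ fineComp ε (g : G) := by
  simp [crossedComp, Submodule.mem_iInf]

theorem crossedComp_of_fixed {a : A'} (ha : a ∈ 𝔅.fixed) : a ∈ crossedComp ε N 1 := by
  refine (mem_crossedComp ε N).2 fun g hg => fineComp_of_fixed ε ?_ ha
  have h1 : g ∈ (centralizerIn H P).subgroupOf N := (QuotientGroup.eq_one_iff g).1 hg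
  exact Subgroup.mem_subgroupOf.1 (Subgroup.mem_subgroupOf.1 h1)

/-- The `E`-graded algebra `e (B^P * E) e`, where `B^P * E` is the crossed product of the
`C_H(P)`-interior `N`-algebra `B^P` with `E = N / C_H(P)`. Its component of degree `x`, represented
by `g`, is `e (B^P ⊗ g) e`, identified with `e (B^P g) e` by means of the map `b ⊗ g ↦ bg` to `A`
(which is injective on `B^P ⊗ g`, because `g` is invertible in `A`). If `N` fixes `e`, this is the
crossed product `(eB^Pe) * E`; in particular, for the identity of `A`, it is `B^P * E`. -/
noncomputable def crossedProduct : Subalgebra O (MonoidAlgebra A' (EGroup H P N)) :=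
  externalAlgebra (crossedComp ε N) (crossedComp_of_fixed ε N (one_mem _)) (by
    intro x y a b ha hb
    refine (mem_crossedComp ε N).2 fun g hg => ?_
    obtain ⟨h, rfl⟩ := toE_surjective H P N x
    have h1 := (mem_crossedComp ε N).1 ha h rfl
    have h2 := (mem_crossedComp ε N).1 hb (h⁻¹ * g) (by
      rw [map_mul, hg, map_inv]
      exact inv_mul_cancel_left _ _)
    have h3 := fineComp_mul ε (h : Subgroup.normalizer (P : Set G)).2 h1 h2
    simpa using h3)

/-- The inclusion of `B'^P` as the component of degree `1`. -/
noncomputable def crossedOne : 𝔅.fixed →+* crossedProduct ε N where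
  toFun a := ⟨MonoidAlgebra.single 1 (a : A'), fun x => by
    classical
    rw [MonoidAlgebra.coeff_single, Finsupp.single_apply]
    split_ifs with h
    · exact h ▸ crossedComp_of_fixed ε N a.2
    · exact zero_mem _⟩
  map_one' := rfl
  map_mul' a b := Subtype.ext (by simp [MonoidAlgebra.single_mul_single])
  map_zero' := Subtype.ext (by simp)
  map_add' a b := Subtype.ext (by simp [MonoidAlgebra.single_add])

/-- The homomorphism `E → F` maps the class of `g` to `(c_g, ḡ)`, where `c_g` is the automorphism
of `P` given by the conjugation with `g`. -/
def IsConjugationHom {γ' : 𝔅.Point} (θ : EGroup H P N →* fusionGroup γ') : Prop :=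
  ∀ g : N, (∀ u : P, (((θ (toE H P N g)).1.1 u : P) : G) = g * u * (g : G)⁻¹) ∧
    (θ (toE H P N g)).1.2 = QuotientGroup.mk' H (g : G)

end groupE

section residual

variable {G O A A' T : Type*} [Group G] [CommRing O] [IsLocalRing O] [Ring A] [Algebra O A]
  [Ring A'] [Algebra O A'] [Ring T] {H : Subgroup G} [H.Normal]
  {𝔄 : GradedInterior O (QuotientGroup.mk' H) A} {P : Subgroup G}
  {𝔅 : GradedInterior O ((QuotientGroup.mk' H).comp P.subtype) A'}
  (ε : GradedEmbedding 𝔅 (𝔄.res P)) (N : Subgroup (Subgroup.normalizer (P : Set G)))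
  (γ' : 𝔅.Point) (q : 𝔅.fixed →+* T)

/-- For a quotient `q : B'^P → T` whose kernel does not contain `i'`, the algebra
`End_{T * E}((T * E) ⊗_T V)ᵒᵖ`, where `V = T q(i')`. -/
abbrev EndCrossed : Type _ := CliffordEnd (crossedOne ε N) q γ'.elt

/-- The component of degree `x ∈ E` of `End_{T * E}((T * E) ⊗_T V)ᵒᵖ`. -/
noncomputable def endCrossedComp (x : EGroup H P N) : Submodule O (EndCrossed ε N γ' q) :=
  cliffordComp (externalComp (crossedProduct ε N)) (crossedOne ε N) q γ'.elt x

/-- The endomorphism `φ` is of degree `x`, induced by the right multiplication by `y ∈ e (B^P g) e`,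
where `g ∈ N` represents `x`: it maps `1 ⊗ q(i')` to the class of `y` tensored with `q(i')`. -/
def IsEndRightMulBy (φ : EndCrossed ε N γ' q) (x : EGroup H P N) (y : A') : Prop :=
  ∃ s : crossedProduct ε N, (s : MonoidAlgebra A' (EGroup H P N)) = MonoidAlgebra.single x y ∧
    IsRightMulBy (crossedOne ε N) q γ'.elt φ s

/-- The residual algebra `ℰ̄ = End_{B(P_γ) * E}((B(P_γ) * E) ⊗ V_γ)ᵒᵖ`, with `V_γ` the simple
module `B(P_γ) ī` of `B(P_γ)`. -/
abbrev EBar : Type _ := EndCrossed ε N γ' (toSimpleQuotient γ')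

/-- The residual algebra
`ℰ̄(P) = End_{(B(P)b_γ/m^*) * E}(((B(P)b_γ/m^*) * E) ⊗ V_γ)ᵒᵖ`. -/
abbrev ELocal {b : BrauerQuotient 𝔅} (hb : γ'.IsBlock b) : Type _ :=
  EndCrossed ε N γ' (toLocalQuotient γ' hb)

end residual

/-! # Residual algebras of a point and embeddings

All the algebras in the statement are made of the same elements. For `φ = (ψ, x)` in `Aut(P) ×
G/H`, let `D φ` be the set of the `y ∈ iAi` of degree `x` such that `ψ(u) y = y u` for all `u ∈ P`
(`GradedInterior.Point.intertwiner`). Then `D φ * D φ' ⊆ D (φ φ')`, and `D 1 = iB^Pi` is a local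
ring, because `i` is primitive, `O` is complete and `A` is finite over `O` (`isLocalIdempotent`).
Hence the elements of `D φ` without an inverse in `D φ⁻¹` form a submodule, and these submodules
form a graded ideal. The pair `φ` belongs to `F` if and only if the image in `G/H` of `ψ(u)` is
that of `u` conjugated by `x`, for all `u`, and `D φ` contains an invertible element
(`mem_fusionGroup_iff`), and `g` belongs to `N` if and only if `D (c_g, ḡ)` contains one
(`mem_embeddedPointNormalizer_iff`), because in the corner of `i` the elements of `e(B^Pg)e` are
those of `D (c_g, ḡ)` (`mem_fineComp_iff`).

The structure `IsResidual` says that a graded algebra `X` is the quotient of `⨁ D φ`, the sum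
being over a group of degrees, by the ideal of the non-invertible elements. This holds for all the
algebras in the diagram:
* `ℱ` is `⨁_{φ ∈ F} D φ`, an endomorphism of the bimodule `Ai ⊗ C` being determined by the image
  of `i ⊗ 1`, and the non-invertible homogeneous elements span the only maximal graded left ideal
  of `ℱ` (`FAlg.mem_gradedJacobson_iff`, `isResidual_fusionProj`);
* for a quotient `T` of `B^P`, `End((T * E) ⊗_T V)ᵒᵖ` is the corner of `i` in the crossed product
  `T * E`, and the ideal generated by the kernel of `B^P → T` meets `D (c_g, ḡ)` in the
  non-invertible elements as soon as it does so for `D 1` (`isResidual_crossedProj`). Both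
  `B(P_γ)` and `B(P)b_γ/m^*` have this property (`toSimpleQuotient_eq_zero_iff`,
  `toLocalQuotient_eq_zero_iff`).

Finally, the embedding maps `iA'i` onto `iAi`, so it identifies the intertwiners of `γ'` with
those of `γ`, with the same invertible elements. A residual algebra is therefore determined up to
a unique isomorphism by its group of degrees alone (`IsResidual.exists_algEquiv`), and an
injective homomorphism of groups of degrees induces an injective homomorphism
(`IsResidual.exists_injective_algHom`). All the maps of the diagram arise in this way, hence they
are canonical, and the diagram commutes. -/

/-! ### Local idempotents -/

section localIdempotent

variable {R : Type*} [Ring R]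

/-- `a`, an element of the corner ring `iRi`, is invertible in `iRi`. -/
def CornerUnit (i a : R) : Prop := ∃ b, i * b = b ∧ b * i = b ∧ a * b = i ∧ b * a = i

/-- `i` is an idempotent whose corner ring `iRi` is local. -/
structure IsLocalIdempotent (i : R) : Prop where
  idem : i * i = i
  ne_zero : i ≠ 0
  unit_or : ∀ a, i * a = a → a * i = a → CornerUnit i a ∨ CornerUnit i (i - a)

namespace IsLocalIdempotent

variable {i a b : R}

theorem eq_zero_or_eq (h : IsLocalIdempotent i) (ha : i * a = a) (ha' : a * i = a)
    (haa : a * a = a) : a = 0 ∨ a = i := by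
  rcases h.unit_or a ha ha' with ⟨b, -, -, h1, -⟩ | ⟨b, -, -, h1, -⟩
  · right
    calc a = a * (a * b) := by rw [h1, ha']
      _ = i := by rw [← mul_assoc, haa, h1]
  · left
    calc a = a * ((i - a) * b) := by rw [h1, ha']
      _ = (a * i - a * a) * b := by noncomm_ring
      _ = 0 := by rw [ha', haa, sub_self, zero_mul]

theorem not_unit_zero (h : IsLocalIdempotent i) : ¬ CornerUnit i 0 := by
  rintro ⟨b, -, -, h1, -⟩
  exact h.ne_zero (by rw [← h1, zero_mul])

theorem unit_self (h : IsLocalIdempotent i) : CornerUnit i i :=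
  ⟨i, h.idem, h.idem, h.idem, h.idem⟩

/-- In a local ring, one-sided inverses are inverses: `ba` is a nonzero idempotent if `ab = 1`. -/
theorem mul_comm_eq (h : IsLocalIdempotent i) (hb' : b * i = b)
    (ha' : a * i = a) (hb : i * b = b) (hab : a * b = i) : b * a = i := by
  have hidem : b * a * (b * a) = b * a := by
    calc b * a * (b * a) = b * (a * b) * a := by noncomm_ring
      _ = b * a := by rw [hab, hb']
  rcases h.eq_zero_or_eq (a := b * a) (by rw [← mul_assoc, hb]) (by rw [mul_assoc, ha'])
    hidem with h0 | h0
  · exfalso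
    apply h.ne_zero
    calc i = (a * b) * (a * b) := by rw [hab, h.idem]
      _ = a * (b * a) * b := by noncomm_ring
      _ = 0 := by rw [h0, mul_zero, zero_mul]
  · exact h0

theorem unit_of_mul_left (h : IsLocalIdempotent i) (ha' : a * i = a)
    (hb : i * b = b) (hu : CornerUnit i (a * b)) : CornerUnit i a := by
  obtain ⟨c, hc, hc', h1, h2⟩ := hu
  have h3 : a * (b * c) = i := by rw [← mul_assoc, h1]
  have h4 : i * (b * c) = b * c := by rw [← mul_assoc, hb]
  have h5 : b * c * i = b * c := by rw [mul_assoc, hc']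
  exact ⟨b * c, h4, h5, h3, h.mul_comm_eq h5 ha' h4 h3⟩

theorem unit_of_mul_right (h : IsLocalIdempotent i) (ha' : a * i = a)
    (hb : i * b = b) (hb' : b * i = b) (hu : CornerUnit i (a * b)) : CornerUnit i b := by
  obtain ⟨c, hc, hc', h1, h2⟩ := hu
  have h3 : c * a * b = i := by rw [mul_assoc, h2]
  have h4 : i * (c * a) = c * a := by rw [← mul_assoc, hc]
  have h5 : c * a * i = c * a := by rw [mul_assoc, ha']
  exact ⟨c * a, h4, h5, h.mul_comm_eq hb' h5 hb h3, h3⟩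

theorem unit_of_add (h : IsLocalIdempotent i) (ha : i * a = a) (ha' : a * i = a)
    (hb : i * b = b) (hb' : b * i = b) (hu : CornerUnit i (a + b)) :
    CornerUnit i a ∨ CornerUnit i b := by
  obtain ⟨c, hc, hc', h1, h2⟩ := hu
  have h3 : c * b = i - c * a := by rw [← h2, mul_add]; abel
  rcases h.unit_or (c * a) (by rw [← mul_assoc, hc]) (by rw [mul_assoc, ha']) with h4 | h4
  · exact Or.inl (h.unit_of_mul_right hc' ha ha' h4)
  · rw [← h3] at h4
    exact Or.inr (h.unit_of_mul_right hc' hb hb' h4)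

/-- If `i` is local, the largest two-sided ideal that does not contain `i` consists of the `a` such
that `iRaRi` contains no unit of `iRi`; by locality, this condition is additive in `a`. -/
theorem mem_pointIdeal_iff (h : IsLocalIdempotent i) {a : R} :
    a ∈ pointIdeal i ↔ ∀ s t, ¬ CornerUnit i (i * s * a * t * i) := by
  have hl : ∀ x, i * (i * x) = i * x := fun x => by rw [← mul_assoc, h.idem]
  have hr : ∀ x, x * i * i = x * i := fun x => by rw [mul_assoc, h.idem]
  let M : TwoSidedIdeal R := TwoSidedIdeal.mk' {a | ∀ s t, ¬ CornerUnit i (i * s * a * t * i)}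
    (fun s t => by simpa using h.not_unit_zero)
    (fun {x y} hx hy s t hu => by
      have e : i * s * (x + y) * t * i = i * s * x * t * i + i * s * y * t * i := by noncomm_ring
      rw [e] at hu
      rcases h.unit_of_add (by simp only [mul_assoc, hl]) (hr _) (by simp only [mul_assoc, hl])
        (hr _) hu with h1 | h1
      · exact hx s t h1
      · exact hy s t h1)
    (fun {x} hx s t hu => hx (-s) t (by
      have e : i * -s * x * t * i = i * s * -x * t * i := by noncomm_ring
      rwa [e]))
    (fun {x y} hy s t hu => hy (s * x) t (by
      have e : i * (s * x) * y * t * i = i * s * (x * y) * t * i := by noncomm_ring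
      rwa [e]))
    (fun {x y} hx s t hu => hx s (y * t) (by
      have e : i * s * x * (y * t) * i = i * s * (x * y) * t * i := by noncomm_ring
      rwa [e]))
  have hM : ∀ a, a ∈ M ↔ ∀ s t, ¬ CornerUnit i (i * s * a * t * i) := fun a => by
    simp only [M, TwoSidedIdeal.mem_mk']
    rfl
  have : pointIdeal i = M := by
    apply le_antisymm
    · refine sSup_le fun I hI a ha => (hM a).2 fun s t => ?_
      rintro ⟨b, -, -, h1, -⟩
      refine hI ?_
      rw [← h1]
      exact I.mul_mem_right _ _ (I.mul_mem_right _ _ (I.mul_mem_right _ _ (I.mul_mem_left _ _ ha)))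
    · refine le_sSup ?_
      intro hi
      refine (hM i).1 hi 1 1 ?_
      simpa [h.idem] using h.unit_self
  rw [this, hM]

theorem mem_pointIdeal_iff_not_unit (h : IsLocalIdempotent i) (ha : i * a = a) (ha' : a * i = a) :
    a ∈ pointIdeal i ↔ ¬ CornerUnit i a := by
  rw [h.mem_pointIdeal_iff]
  constructor
  · intro h1 h2
    refine h1 1 1 ?_
    simpa [ha, ha'] using h2
  · intro h1 s t h2
    have e : i * s * a * t * i = (i * s * i) * (a * (i * t * i)) := by
      calc _ = i * s * (i * a * i) * t * i := by rw [ha, ha']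
        _ = _ := by noncomm_ring
    rw [e] at h2
    have hl : ∀ x, i * (i * x) = i * x := fun x => by rw [← mul_assoc, h.idem]
    have hr : ∀ x, x * i * i = x * i := fun x => by rw [mul_assoc, h.idem]
    have e1 : a * (i * t * i) * i = a * (i * t * i) := by rw [mul_assoc a, hr]
    have h3 := h.unit_of_mul_right (hr _) (by rw [← mul_assoc, ha]) e1 h2
    exact h1 (h.unit_of_mul_left ha' (by simp only [mul_assoc, hl]) h3)

section map

variable {R' : Type*} [Ring R'] (ρ : R →+* R')

theorem unit_map (hu : CornerUnit i a) : CornerUnit (ρ i) (ρ a) := by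
  obtain ⟨b, h1, h2, h3, h4⟩ := hu
  exact ⟨ρ b, by rw [← map_mul, h1], by rw [← map_mul, h2], by rw [← map_mul, h3],
    by rw [← map_mul, h4]⟩

theorem map (h : IsLocalIdempotent i) (hρ : Function.Surjective ρ) (h0 : ρ i ≠ 0) :
    IsLocalIdempotent (ρ i) where
  idem := by rw [← map_mul, h.idem]
  ne_zero := h0
  unit_or a ha ha' := by
    obtain ⟨b, rfl⟩ := hρ a
    have e : ρ b = ρ (i * b * i) := by rw [map_mul, map_mul, ha, ha']
    rcases h.unit_or (i * b * i) (by simp only [← mul_assoc, h.idem])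
      (by rw [mul_assoc, h.idem]) with h1 | h1
    · left
      rw [e]
      exact unit_map ρ h1
    · right
      rw [e, ← map_sub]
      exact unit_map ρ h1

theorem unit_map_iff (h : IsLocalIdempotent i) (hρ : Function.Surjective ρ) (h0 : ρ i ≠ 0)
    (ha : i * a = a) (ha' : a * i = a) : CornerUnit (ρ i) (ρ a) ↔ CornerUnit i a := by
  refine ⟨?_, unit_map ρ⟩
  rintro ⟨b, hb, hb', h1, -⟩
  obtain ⟨b, rfl⟩ := hρ b
  have e : ρ (a * (i * b * i)) = ρ i := by rw [map_mul, map_mul, map_mul, hb, hb', h1]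
  have hl : i * (i * b * i) = i * b * i := by simp only [← mul_assoc, h.idem]
  have hr : i * b * i * i = i * b * i := by rw [mul_assoc, h.idem]
  rcases h.unit_or (a * (i * b * i)) (by rw [← mul_assoc, ha]) (by rw [mul_assoc, hr]) with h2 | h2
  · exact h.unit_of_mul_left ha' hl h2
  · exfalso
    have h3 := unit_map ρ h2
    rw [map_sub, e, sub_self] at h3
    exact (h.map ρ hρ h0).not_unit_zero h3

end map

end IsLocalIdempotent

/-- Two equivalent idempotents `i = ww'` and `j = w'w` of which `i` is local are conjugate if `iji`
is invertible in `iRi`: if `c` is its inverse, then `ij + (1 - i)(1 - j)` is a unit, which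
intertwines `i` and `j`. -/
theorem exists_conj_of_cornerUnit {R : Type*} [Ring R] {i j w w' : R} (h : IsLocalIdempotent i)
    (hj : j * j = j) (h1 : w * w' = i) (h2 : w' * w = j) (hu : CornerUnit i (i * j * i)) :
    ∃ u u', u * u' = 1 ∧ u' * u = 1 ∧ i * u = u * j := by
  obtain ⟨c, hc, hc', hc1, hc2⟩ := hu
  have hi := h.idem
  have k1 : i * j * c = i := by
    calc i * j * c = i * j * (i * c) := by rw [hc]
      _ = i := by rw [← mul_assoc, hc1]
  have k2 : c * j * i = i := by
    calc c * j * i = (c * i) * j * i := by rw [hc']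
      _ = c * (i * j * i) := by noncomm_ring
      _ = i := hc2
  have k3 : j * c * j = j := by
    have e1 : w * (j * c * j) * w' * (w * (j * c * j) * w') = w * (j * c * j) * w' := by
      calc _ = w * (j * c * j) * (w' * w) * (j * c * j) * w' := by noncomm_ring
        _ = w * (j * c * (j * j * j) * c * j) * w' := by rw [h2]; noncomm_ring
        _ = w * (j * (c * i) * (j * c) * j) * w' := by rw [hj, hj, hc']; noncomm_ring
        _ = w * (j * c * (i * j * c) * j) * w' := by noncomm_ring
        _ = w * (j * c * j) * w' := by
            rw [k1]
            calc w * (j * c * i * j) * w' = w * (j * (c * i) * j) * w' := by noncomm_ring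
              _ = _ := by rw [hc']
    have e2 : i * (w * (j * c * j) * w') = w * (j * c * j) * w' := by
      calc i * (w * (j * c * j) * w') = (w * w') * (w * (j * c * j) * w') := by rw [h1]
        _ = w * (w' * w) * (j * c * j) * w' := by noncomm_ring
        _ = w * (j * j * c * j) * w' := by rw [h2]; noncomm_ring
        _ = _ := by rw [hj]
    have e3 : w * (j * c * j) * w' * i = w * (j * c * j) * w' := by
      calc (w * (j * c * j) * w') * i = (w * (j * c * j) * w') * (w * w') := by rw [h1]
        _ = w * (j * c * j) * (w' * w) * w' := by noncomm_ring
        _ = w * (j * c * (j * j)) * w' := by rw [h2]; noncomm_ring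
        _ = _ := by rw [hj, mul_assoc j c j]
    rcases h.eq_zero_or_eq (a := w * (j * c * j) * w') e2 e3 e1 with h0 | h0
    · exfalso
      have e2 : j * c * j = 0 := by
        calc j * c * j = (w' * w) * (j * c * j) * (w' * w) := by
              rw [h2]; simp only [← mul_assoc, hj]; simp only [mul_assoc, hj]
          _ = w' * (w * (j * c * j) * w') * w := by noncomm_ring
          _ = 0 := by rw [h0, mul_zero, zero_mul]
      apply h.ne_zero
      calc i = (i * j * c) * (i * j * c) := by rw [k1, hi]
        _ = i * (j * (c * i) * j) * c := by noncomm_ring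
        _ = 0 := by rw [hc', e2, mul_zero, zero_mul]
    · calc j * c * j = (w' * w) * (j * c * j) * (w' * w) := by
            rw [h2]; simp only [← mul_assoc, hj]; simp only [mul_assoc, hj]
        _ = w' * (w * (j * c * j) * w') * w := by noncomm_ring
        _ = j := by
            rw [h0, ← h1]
            calc w' * (w * w') * w = (w' * w) * (w' * w) := by noncomm_ring
              _ = j := by rw [h2, hj]
  have k4 : c * i * j = c * j := by rw [hc']
  have k5 : c * j * i * j = i * j := by rw [k2]
  refine ⟨i * j + (1 - i) * (1 - j), j * c + (1 - j) * (1 - c * j), ?_, ?_, ?_⟩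
  · calc _ = i * (j * j) * c + i * (j - j * j) * (1 - c * j) + (1 - i) * (j - j * j) * c
          + (1 - i) * (1 - j - (j - j * j)) * (1 - c * j) := by noncomm_ring
      _ = i * j * c + (1 - i) * (1 - j) * (1 - c * j) := by rw [hj]; noncomm_ring
      _ = i + (1 - i) * (1 - c * j - j + j * c * j) := by rw [k1]; noncomm_ring
      _ = i + (1 - i) * (1 - c * j) := by rw [k3]; noncomm_ring
      _ = 1 - c * j + i * c * j := by noncomm_ring
      _ = 1 := by rw [hc]; noncomm_ring
  · calc _ = j * (c * i) * j + j * (c - c * i) * (1 - j) + (1 - j) * (i * j - c * j * i * j)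
          + (1 - j) * (1 - i - c * j + c * j * i) * (1 - j) := by noncomm_ring
      _ = j * c * j + (1 - j) * (1 - c * j) * (1 - j) := by rw [hc', k5, k2]; noncomm_ring
      _ = j + (1 - j) * ((1 - j) - c * (j - j * j)) := by rw [k3]; noncomm_ring
      _ = j + (1 - j) * (1 - j) := by rw [hj, sub_self, mul_zero, sub_zero]
      _ = 1 - j + j * j := by noncomm_ring
      _ = 1 := by rw [hj, sub_add_cancel]
  · calc _ = i * i * j + (i - i * i) * (1 - j) := by noncomm_ring
      _ = i * j := by rw [hi]; noncomm_ring
      _ = i * (j * j) + (1 - i) * (j - j * j) := by rw [hj]; noncomm_ring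
      _ = _ := by noncomm_ring

/-- Two equivalent idempotents `i = ww'` and `j = w'w`, of which `i` is local, are conjugate: either
`iji` or `i(1 - j)i` is invertible in `iRi`. In the second case, `i` is conjugate to an idempotent
`(1 - j)c(1 - j)`, which is orthogonal to `j` and equivalent to it, and can be exchanged
with `j`. -/
theorem exists_conj_of_equiv {R : Type*} [Ring R] {i j w w' : R} (h : IsLocalIdempotent i)
    (hj : j * j = j) (h1 : w * w' = i) (h2 : w' * w = j) (hw : i * w = w) (hw' : w' * i = w') :
    ∃ u u', u * u' = 1 ∧ u' * u = 1 ∧ i * u = u * j := by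
  have hi := h.idem
  rcases h.unit_or (i * j * i) (by simp only [← mul_assoc, hi]) (by rw [mul_assoc, hi]) with hu | hu
  · exact exists_conj_of_cornerUnit h hj h1 h2 hu
  · have e1 : i - i * j * i = i * (1 - j) * i := by
      calc i - i * j * i = i * i - i * j * i := by rw [hi]
        _ = _ := by noncomm_ring
    rw [e1] at hu
    obtain ⟨c, hc, hc', hc1, hc2⟩ := hu
    set k := 1 - j with hk
    have hkk : k * k = k := by
      rw [hk]
      calc _ = 1 - j - (j - j * j) := by noncomm_ring
        _ = _ := by rw [hj]; noncomm_ring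
    have hkj : k * j = 0 := by rw [hk, sub_mul, one_mul, hj, sub_self]
    have hjk : j * k = 0 := by rw [hk, mul_sub, mul_one, hj, sub_self]
    have hckc : c * k * c = c := by
      calc c * k * c = (c * i) * k * (i * c) := by rw [hc, hc']
        _ = c * (i * k * i * c) := by noncomm_ring
        _ = c := by rw [hc1, hc']
    have hik : i * k * c = i := by
      calc i * k * c = i * k * (i * c) := by rw [hc]
        _ = i := by rw [← mul_assoc, hc1]
    have hki : c * k * i = i := by
      calc c * k * i = (c * i) * k * i := by rw [hc']
        _ = c * (i * k * i) := by noncomm_ring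
        _ = i := hc2
    obtain ⟨u, u', huu, huu', hui⟩ := exists_conj_of_cornerUnit (j := k * c * k) (w := i * k)
      (w' := k * c)
      h (by calc _ = k * (c * (k * k) * c) * k := by noncomm_ring
              _ = _ := by rw [hkk, hckc])
      (by calc _ = i * (k * k) * c := by noncomm_ring
            _ = i := by rw [hkk, hik])
      (by calc _ = k * (c * i) * k := by noncomm_ring
            _ = _ := by rw [hc'])
      (by
        have e2 : i * (k * c * k) * i = i * k * i := by
          calc _ = i * k * (c * k * i) := by noncomm_ring
            _ = _ := by rw [hki]
        rw [e2]
        exact ⟨c, hc, hc', hc1, hc2⟩)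
    have hwj : w * j = w := by rw [← h2, ← mul_assoc, h1, hw]
    have hjw : j * w' = w' := by rw [← h2, mul_assoc, h1, hw']
    have hwk : w * k = 0 := by rw [← hwj, mul_assoc, hjk, mul_zero]
    have hkw : k * w' = 0 := by rw [← hjw, ← mul_assoc, hkj, zero_mul]
    -- `x` and `x'` are mutually inverse equivalences between `m = kck` and `j`, and the involution
    -- `x + x' + (1 - m - j)` exchanges these orthogonal idempotents
    set m := k * c * k with hm
    set x := k * c * w with hx
    set x' := w' * k with hx'
    have xx : x * x = 0 := by
      calc _ = k * c * (w * k) * c * w := by simp only [hx, mul_assoc]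
        _ = 0 := by rw [hwk, mul_zero, zero_mul, zero_mul]
    have xx' : x * x' = m := by
      calc _ = k * (c * (w * w')) * k := by simp only [hx, hx', mul_assoc]
        _ = m := by rw [h1, hc']
    have x'x : x' * x = j := by
      calc _ = w' * (k * k) * c * w := by simp only [hx, hx', mul_assoc]
        _ = (w' * i) * k * c * w := by rw [hkk, hw']
        _ = w' * (i * k * c) * w := by simp only [mul_assoc]
        _ = j := by rw [hik, hw', h2]
    have x'x' : x' * x' = 0 := by
      calc _ = w' * (k * w') * k := by simp only [hx', mul_assoc]
        _ = 0 := by rw [hkw, mul_zero, zero_mul]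
    have xm : x * m = 0 := by
      calc _ = k * c * (w * k) * c * k := by simp only [hx, hm, mul_assoc]
        _ = 0 := by rw [hwk, mul_zero, zero_mul, zero_mul]
    have xj : x * j = x := by rw [hx, mul_assoc, hwj]
    have mx : m * x = x := by
      calc _ = k * (c * (k * k) * c) * w := by simp only [hx, hm, mul_assoc]
        _ = x := by rw [hkk, hckc]
    have jx : j * x = 0 := by rw [hx, ← mul_assoc, ← mul_assoc, hjk, zero_mul, zero_mul]
    have x'm : x' * m = x' := by
      calc _ = w' * (k * k) * c * k := by simp only [hx', hm, mul_assoc]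
        _ = (w' * i) * k * c * k := by rw [hkk, hw']
        _ = w' * (i * k * c) * k := by simp only [mul_assoc]
        _ = x' := by rw [hik, hw']
    have x'j : x' * j = 0 := by rw [hx', mul_assoc, hkj, mul_zero]
    have mx' : m * x' = 0 := by
      calc _ = k * c * (k * w') * k := by simp only [hx', hm, mul_assoc]
        _ = 0 := by rw [hkw, mul_zero, zero_mul]
    have jx' : j * x' = x' := by rw [hx', ← mul_assoc, hjw]
    have mm : m * m = m := by rw [← xx', mul_assoc, ← mul_assoc x', x'x, jx']
    have mj : m * j = 0 := by rw [hm, mul_assoc, hkj, mul_zero]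
    have jm : j * m = 0 := by rw [hm, ← mul_assoc, ← mul_assoc, hjk, zero_mul, zero_mul]
    have vv : (x + x' + (1 - m - j)) * (x + x' + (1 - m - j)) = 1 := by
      simp only [add_mul, mul_add, sub_mul, mul_sub, one_mul, mul_one, xx, xx', x'x, x'x', xm, xj,
        mx, jx, x'm, x'j, mx', jx', mm, mj, jm, hj]
      abel
    have mv : m * (x + x' + (1 - m - j)) = (x + x' + (1 - m - j)) * j := by
      simp only [add_mul, mul_add, sub_mul, mul_sub, one_mul, mul_one, xj, mx, x'j, mx', mm, mj, hj]
      abel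
    refine ⟨u * (x + x' + (1 - m - j)), (x + x' + (1 - m - j)) * u', ?_, ?_, ?_⟩
    · rw [mul_assoc u, ← mul_assoc _ _ u', vv, one_mul, huu]
    · rw [mul_assoc _ u', ← mul_assoc u', huu', one_mul, vv]
    · rw [← mul_assoc, hui, mul_assoc, mv, mul_assoc]

end localIdempotent

/-! ### Finite algebras over complete local rings -/

section complete

variable {O : Type*} [CommRing O]

theorem isAdicComplete_of_finite [IsNoetherianRing O] (I : Ideal O) [IsAdicComplete I O]
    (M : Type*) [AddCommGroup M] [Module O M] [Module.Finite O M] : IsAdicComplete I M := by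
  have h1 : IsHausdorff I M := IsHausdorff.of_le_jacobson _ _ (IsAdicComplete.le_jacobson_bot I)
  have h2 : IsPrecomplete I M := by
    rw [← AdicCompletion.of_surjective_iff]
    let e := (TensorProduct.lid O M).symm.trans
      (TensorProduct.congr (LinearEquiv.ofBijective _
        (AdicCompletion.of_bijective_iff.2 ‹IsAdicComplete I O›)) (LinearEquiv.refl O M))
    have h3 : ⇑(AdicCompletion.of I M) = (AdicCompletion.ofTensorProduct I M) ∘ e := by
      funext m
      have h4 : e m = AdicCompletion.of I O 1 ⊗ₜ[O] m := by simp [e]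
      have h5 : AdicCompletion.of I O 1 = 1 := rfl
      rw [Function.comp_apply, h4, AdicCompletion.ofTensorProduct_tmul, h5, one_smul]
    rw [h3]
    exact (AdicCompletion.ofTensorProduct_surjective_of_finite I M).comp e.surjective
  exact { h1, h2 with }

variable [IsLocalRing O] [IsNoetherianRing O] [IsAdicComplete (IsLocalRing.maximalIdeal O) O]

/-- The Fitting idempotent `e` of an element `a` of a commutative finite algebra over a complete
local ring: `a` is invertible modulo `1 - e`, and topologically nilpotent modulo `e`. It is lifted
from the artinian residue algebra, by Hensel's lemma for `X ^ 2 - X`. -/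
theorem exists_fitting_idempotent {R : Type*} [CommRing R] [Algebra O R]
    [Module.Finite O R] (a : R) :
    ∃ e : R, e * e = e ∧ (∃ b, IsUnit (a * b + (1 - e))) ∧ IsUnit (1 - a * (1 - e)) := by
  set m := IsLocalRing.maximalIdeal O with hm
  set I := m.map (algebraMap O R) with hI
  have : IsAdicComplete m R := isAdicComplete_of_finite m R
  have : IsAdicComplete I R := (IsAdicComplete.map_algebraMap_iff _ _).2 this
  have hloc : IsLocalHom (Ideal.Quotient.mk I) :=
    isLocalHom_of_le_jacobson_bot I (IsAdicComplete.le_jacobson_bot I)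
  have : IsArtinianRing (O ⧸ m) := by
    let := Ideal.Quotient.field m
    infer_instance
  have : IsArtinianRing (R ⧸ I) := IsArtinianRing.of_finite (O ⧸ m) (R ⧸ I)
  obtain ⟨n, y, hy⟩ := IsArtinian.exists_pow_succ_smul_dvd (Ideal.Quotient.mk I a) (1 : R ⧸ I)
  set x := Ideal.Quotient.mk I a with hx
  have h1 : ∀ k, x ^ (n + 1) = x ^ (n + 1 + k) * y ^ k := by
    intro k
    induction k with
    | zero => simp
    | succ k ih =>
      have h2 : x ^ (n + 1) * y = x ^ n := by simpa using hy
      calc x ^ (n + 1) = x ^ (n + 1 + k) * y ^ k := ih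
        _ = x ^ n * x * x ^ k * y ^ k := by ring
        _ = _ := by rw [← h2]; ring
  set e₁ := x ^ (n + 1) * y ^ (n + 1) with he₁
  have he₁' : e₁ * e₁ = e₁ := by
    calc e₁ * e₁ = (x ^ (n + 1 + (n + 1)) * y ^ (n + 1)) * y ^ (n + 1) := by rw [he₁]; ring
      _ = e₁ := by rw [← h1]
  have hxe : x ^ (n + 1) * (1 - e₁) = 0 := by
    calc x ^ (n + 1) * (1 - e₁) = x ^ (n + 1) - x ^ (n + 1 + (n + 1)) * y ^ (n + 1) := by
          rw [he₁]; ring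
      _ = 0 := by rw [← h1, sub_self]
  obtain ⟨b, hb⟩ := Ideal.Quotient.mk_surjective (x ^ n * y ^ (n + 1))
  obtain ⟨e₀, he₀⟩ := Ideal.Quotient.mk_surjective e₁
  obtain ⟨e, he, hee⟩ := HenselianRing.is_henselian (I := I)
    (Polynomial.X ^ 2 - Polynomial.X) (Polynomial.monic_X_pow_sub
      (Polynomial.degree_X_le.trans_lt (by norm_num))) e₀
    (by
      rw [← Ideal.Quotient.eq_zero_iff_mem]
      simp [he₀, pow_two, he₁'])
    (by
      refine IsUnit.of_mul_eq_one (2 * e₁ - 1) ?_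
      simp only [Polynomial.derivative_sub, Polynomial.derivative_X_pow, Polynomial.derivative_X]
      have h2 : Ideal.Quotient.mk I 2 = 2 := map_ofNat _ 2
      simp [he₀, h2]
      linear_combination 4 * he₁')
  have hee' : Ideal.Quotient.mk I e = e₁ := by
    rw [← he₀]
    exact (Ideal.Quotient.mk_eq_mk_iff_sub_mem _ _).2 hee
  refine ⟨e, ?_, ⟨b, ?_⟩, ?_⟩
  · simpa [pow_two, sub_eq_zero] using he
  · refine isUnit_of_map_unit (Ideal.Quotient.mk I) _ ?_
    have : Ideal.Quotient.mk I (a * b + (1 - e)) = 1 := by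
      rw [map_add, map_mul, map_sub, hb, hee', he₁, map_one]
      ring
    rw [this]
    exact isUnit_one
  · refine isUnit_of_map_unit (Ideal.Quotient.mk I) _ ?_
    rw [map_sub, map_mul, map_sub, hee', map_one]
    refine IsNilpotent.isUnit_one_sub ⟨n + 1, ?_⟩
    rw [mul_pow, pow_succ (1 - e₁), mul_comm _ (1 - e₁), ← mul_assoc]
    change x ^ (n + 1) * (1 - e₁) * _ = 0
    rw [hxe, zero_mul]

/-- A primitive idempotent of a finite algebra over a complete local ring is local: the Fitting
idempotent of an element `a` of the corner ring is trivial, so that `a` or `i - a` is invertible. -/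
theorem isLocalIdempotent_of_primitive {R : Type*} [Ring R] [Algebra O R] [Module.Finite O R]
    {i : R} (hi : i * i = i) (h0 : i ≠ 0)
    (hprim : ∀ j, j * j = j → i * j = j → j * i = j → j = 0 ∨ j = i) :
    IsLocalIdempotent i := by
  refine ⟨hi, h0, fun a ha ha' => ?_⟩
  let f : Polynomial O →ₐ[O] R := Polynomial.aeval a
  let Φ : (Polynomial O ⧸ RingHom.ker f) →ₐ[O] R := Ideal.kerLiftAlg f
  have hΦ : Function.Injective Φ := Ideal.kerLiftAlg_injective f
  have : Module.Finite O (Polynomial O ⧸ RingHom.ker f) :=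
    Module.Finite.of_injective Φ.toLinearMap hΦ
  have hcomm : ∀ s, i * Φ s = Φ s * i := by
    intro s
    obtain ⟨g, rfl⟩ := Ideal.Quotient.mk_surjective s
    have e1 : Φ (Ideal.Quotient.mk _ g) = f g := Ideal.kerLiftAlg_mk f g
    rw [e1]
    induction g using Polynomial.induction_on' with
    | add p q hp hq =>
      rw [map_add, mul_add, add_mul, hp (Ideal.kerLiftAlg_mk f p), hq (Ideal.kerLiftAlg_mk f q)]
    | monomial n r =>
      have hc : Commute i (a ^ n) := Commute.pow_right (show i * a = a * i by rw [ha, ha']) n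
      simp only [f, Polynomial.aeval_monomial]
      rw [← mul_assoc, ← Algebra.commutes, mul_assoc, hc.eq, mul_assoc]
  have hX : Φ (Ideal.Quotient.mk _ Polynomial.X) = a := by
    refine (Ideal.kerLiftAlg_mk f _).trans ?_
    simp [f]
  obtain ⟨e, he, ⟨b, hb⟩, hu⟩ :=
    exists_fitting_idempotent (O := O) (Ideal.Quotient.mk (RingHom.ker f) Polynomial.X)
  have he' : Φ e * Φ e = Φ e := by rw [← map_mul, he]
  have corner : ∀ s, i * (i * Φ s) = i * Φ s ∧ (i * Φ s) * i = i * Φ s := fun s =>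
    ⟨by rw [← mul_assoc, hi], by rw [mul_assoc, ← hcomm, ← mul_assoc, hi]⟩
  have key : ∀ s t, i * Φ s * (i * Φ t) = i * Φ (s * t) := fun s t => by
    rw [map_mul, ← mul_assoc, (corner s).2, mul_assoc]
  rcases hprim (i * Φ e) (by rw [key, he]) (corner e).1 (corner e).2 with h1 | h1
  · right
    obtain ⟨⟨u, v, huv, hvu⟩, rfl⟩ := hu
    have e1 : i - a = i * Φ (1 - Ideal.Quotient.mk (RingHom.ker f) Polynomial.X * (1 - e)) := by
      rw [map_sub, map_mul, hX, map_sub, map_one]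
      calc i - a = i - i * a + a * 0 := by rw [ha]; simp
        _ = i - i * a + a * (i * Φ e) := by rw [h1]
        _ = i - i * a + (a * i) * Φ e := by rw [← mul_assoc]
        _ = i - i * a + (i * a) * Φ e := by rw [ha', ha]
        _ = _ := by noncomm_ring
    refine ⟨i * Φ v, (corner v).1, (corner v).2, ?_, ?_⟩
    · rw [e1, key, huv, map_one, mul_one]
    · rw [e1, key, hvu, map_one, mul_one]
  · left
    obtain ⟨⟨u, v, huv, hvu⟩, hu'⟩ := hb
    simp only at hu'
    have e1 : i * Φ u = a * Φ b := by
      rw [hu', map_add, map_mul, hX, map_sub, map_one, mul_add, mul_sub, h1]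
      rw [← mul_assoc, ha]; simp
    have e2 : a * (i * Φ (b * v)) = i := by
      calc a * (i * Φ (b * v)) = a * i * Φ b * Φ v := by rw [map_mul]; noncomm_ring
        _ = i * Φ u * Φ v := by rw [ha', e1]
        _ = i * Φ (u * v) := by rw [map_mul]; noncomm_ring
        _ = i := by rw [huv, map_one, mul_one]
    refine ⟨i * Φ (b * v), (corner _).1, (corner _).2, e2, ?_⟩
    calc i * Φ (b * v) * a = i * Φ (b * v) * (i * Φ (Ideal.Quotient.mk _ Polynomial.X)) := by
          rw [hX, ha]
      _ = i * Φ (Ideal.Quotient.mk _ Polynomial.X) * (i * Φ (b * v)) := by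
          rw [key, key, mul_comm]
      _ = i := by rw [hX, ha, e2]

end complete

/-- By Nakayama's lemma, the maximal ideal of `O` acts by non-units on corner rings. -/
theorem not_cornerUnit_smul {O : Type*} [CommRing O] [IsLocalRing O] [IsNoetherianRing O]
    {R : Type*} [Ring R] [Algebra O R] [Module.Finite O R]
    {i : R} (hi : i * i = i) (h0 : i ≠ 0) {r : O} (hr : r ∈ IsLocalRing.maximalIdeal O) :
    ¬ CornerUnit i (r • i) := by
  rintro ⟨b, hb, -, h1, -⟩
  have h2 : LinearMap.range (LinearMap.mulLeft O i) = ⊥ := by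
    refine Submodule.eq_bot_of_le_smul_of_le_jacobson_bot (IsLocalRing.maximalIdeal O) _
      (IsNoetherian.noetherian _) ?_ (IsLocalRing.maximalIdeal_le_jacobson _)
    rintro _ ⟨x, rfl⟩
    have h3 : i * x = r • (i * (b * x)) := by
      rw [← mul_assoc, hb]
      nth_rewrite 1 [← h1]
      rw [smul_mul_assoc, hb, smul_mul_assoc]
    rw [LinearMap.mulLeft_apply, h3]
    exact Submodule.smul_mem_smul hr ⟨_, rfl⟩
  refine h0 ?_
  have h3 : i ∈ LinearMap.range (LinearMap.mulLeft O i) := ⟨i, hi⟩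
  rwa [h2] at h3

/-- The block to which a local idempotent `j` belongs exists: it is a central idempotent `b`, with
`bj = j`, which is minimal for this property. -/
theorem exists_isBlockOf {T : Type*} [Ring T] [IsNoetherianRing T] {j : T}
    (hj : IsLocalIdempotent j) : ∃ b, IsBlockOf b j := by
  let S : Set (Ideal T) := {I | ∃ b : T, (∀ r, b * r = r * b) ∧ b * b = b ∧ b * j = j ∧
    I = Ideal.span {1 - b}}
  obtain ⟨I, ⟨b, hb, hbb, hbj, rfl⟩, hmax⟩ := set_has_maximal_iff_noetherian.2
    (inferInstanceAs (IsNoetherian T T)) S ⟨_, 1, by simp, by simp, by simp, rfl⟩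
  have hmin : ∀ c : T, (∀ r, c * r = r * c) → c * c = c → b * c = c → c * j = j → c = b := by
    intro c hc hcc hbc hcj
    by_contra hne
    refine hmax _ ⟨c, hc, hcc, hcj, rfl⟩ (lt_of_le_of_ne ?_ ?_)
    · rw [Ideal.span_le, Set.singleton_subset_iff]
      refine Ideal.mem_span_singleton'.2 ⟨1 - b, ?_⟩
      rw [mul_sub, sub_mul, sub_mul, hbc]; simp
    · intro heq
      have h1 : 1 - c ∈ Ideal.span {1 - b} := by
        rw [heq]; exact Ideal.subset_span rfl
      obtain ⟨t, ht⟩ := Ideal.mem_span_singleton'.1 h1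
      have h2 : (1 - c) * b = 0 := by
        rw [← ht, mul_assoc, sub_mul, hbb, one_mul, sub_self, mul_zero]
      rw [sub_mul, one_mul, ← hb, hbc, sub_eq_zero] at h2
      exact hne h2.symm
  refine ⟨b, hb, hbb, fun h => hj.ne_zero (by rw [← hbj, h, zero_mul]), fun c hc hcc hbc => ?_, hbj⟩
  rcases hj.eq_zero_or_eq (a := c * j) (by rw [hc, ← mul_assoc, hj.idem])
    (by rw [mul_assoc, hj.idem]) (by rw [mul_assoc, ← mul_assoc j, ← hc, mul_assoc, hj.idem,
      ← mul_assoc, hcc]) with h | h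
  · left
    have := hmin (b - c) (fun r => by rw [sub_mul, mul_sub, hb, hc])
      (by rw [sub_mul, mul_sub, mul_sub, hbb, hcc, hbc, hc b, hbc]; simp)
      (by rw [mul_sub, hbb, hbc]) (by rw [sub_mul, h, hbj, sub_zero])
    simpa using this
  · exact Or.inr (hmin c hc hcc hbc h)

/-! ### Homogeneous elements which intertwine the action of `P` -/

namespace GradedInterior.Point

variable {O L Γ A : Type*} [CommRing O] [Group L] [Group Γ] {d : L →* Γ} [Ring A] [Algebra O A]
  {𝔄 : GradedInterior O d A} (γ : 𝔄.Point)

/-- For `φ = (ψ, x)` in `Aut(L) × Γ`, the submodule of the elements `y` of `iAi` of degree `x` such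
that `ψ(u) y = y u` for all `u ∈ L`. For `φ = 1`, this is `iB^Li`. -/
def intertwiner (φ : MulAut L × Γ) : Submodule O A where
  carrier := {y | γ.i * y = y ∧ y * γ.i = y ∧ y ∈ 𝔄.comp φ.2 ∧
    ∀ u, (𝔄.str (φ.1 u) : A) * y = y * (𝔄.str u : A)}
  add_mem' := by
    rintro a b ⟨h1, h2, h3, h4⟩ ⟨k1, k2, k3, k4⟩
    exact ⟨by rw [mul_add, h1, k1], by rw [add_mul, h2, k2], add_mem h3 k3,
      fun u => by rw [mul_add, add_mul, h4, k4]⟩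
  zero_mem' := ⟨by simp, by simp, zero_mem _, by simp⟩
  smul_mem' := by
    rintro r a ⟨h1, h2, h3, h4⟩
    exact ⟨by rw [mul_smul_comm, h1], by rw [smul_mul_assoc, h2], Submodule.smul_mem _ r h3,
      fun u => by rw [mul_smul_comm, smul_mul_assoc, h4]⟩

variable {γ}

theorem mem_intertwiner {φ : MulAut L × Γ} {y : A} : y ∈ γ.intertwiner φ ↔
    γ.i * y = y ∧ y * γ.i = y ∧ y ∈ 𝔄.comp φ.2 ∧
      ∀ u, (𝔄.str (φ.1 u) : A) * y = y * (𝔄.str u : A) := Iff.rfl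

theorem i_mul {φ : MulAut L × Γ} {y : A} (hy : y ∈ γ.intertwiner φ) : γ.i * y = y := hy.1

theorem mul_i {φ : MulAut L × Γ} {y : A} (hy : y ∈ γ.intertwiner φ) : y * γ.i = y := hy.2.1

theorem str_mul {φ : MulAut L × Γ} {y : A} (hy : y ∈ γ.intertwiner φ) (u : L) :
    (𝔄.str (φ.1 u) : A) * y = y * (𝔄.str u : A) := hy.2.2.2 u

theorem mul_mem_intertwiner {φ ψ : MulAut L × Γ} {a b : A} (ha : a ∈ γ.intertwiner φ)
    (hb : b ∈ γ.intertwiner ψ) : a * b ∈ γ.intertwiner (φ * ψ) := by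
  refine ⟨by rw [← mul_assoc, i_mul ha], by rw [mul_assoc, mul_i hb],
    𝔄.graded.mul_mem ha.2.2.1 hb.2.2.1, fun u => ?_⟩
  change (𝔄.str (φ.1 (ψ.1 u)) : A) * _ = _
  rw [← mul_assoc, str_mul ha, mul_assoc, str_mul hb, mul_assoc]

theorem mem_intertwiner_one {a : A} :
    a ∈ γ.intertwiner 1 ↔ a ∈ 𝔄.fixed ∧ γ.i * a = a ∧ a * γ.i = a :=
  ⟨fun h => ⟨GradedInterior.mem_fixed.2 ⟨h.2.2.1, h.2.2.2⟩, h.1, h.2.1⟩,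
    fun h => ⟨h.2.1, h.2.2, (GradedInterior.mem_fixed.1 h.1).1, (GradedInterior.mem_fixed.1 h.1).2⟩⟩

theorem i_mem_intertwiner : γ.i ∈ γ.intertwiner 1 :=
  mem_intertwiner_one.2 ⟨γ.mem, γ.idem, γ.idem⟩

variable (γ) in
/-- `a`, an element of `γ.intertwiner φ`, has an inverse in `γ.intertwiner φ⁻¹`. -/
def IsInvertible (φ : MulAut L × Γ) (a : A) : Prop :=
  ∃ b ∈ γ.intertwiner φ⁻¹, a * b = γ.i ∧ b * a = γ.i

theorem cornerUnit_iff {a : 𝔄.fixed} : CornerUnit γ.elt a ↔ γ.IsInvertible 1 (a : A) := by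
  constructor
  · rintro ⟨b, h1, h2, h3, h4⟩
    refine ⟨b, ?_, congrArg Subtype.val h3, congrArg Subtype.val h4⟩
    rw [inv_one]
    exact mem_intertwiner_one.2 ⟨b.2, congrArg Subtype.val h1, congrArg Subtype.val h2⟩
  · rintro ⟨b, hb, h3, h4⟩
    rw [inv_one] at hb
    obtain ⟨h0, h1, h2⟩ := mem_intertwiner_one.1 hb
    exact ⟨⟨b, h0⟩, Subtype.ext h1, Subtype.ext h2, Subtype.ext h3, Subtype.ext h4⟩

section isLocal

variable (hγ : IsLocalIdempotent γ.elt) {φ ψ : MulAut L × Γ} {a b : A}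
include hγ

theorem isInvertible_of_mul_eq (ha : a ∈ γ.intertwiner φ) (hb : b ∈ γ.intertwiner φ⁻¹)
    (hab : a * b = γ.i) : γ.IsInvertible φ a := by
  have h1 : b * a ∈ γ.intertwiner 1 := by simpa using mul_mem_intertwiner hb ha
  obtain ⟨h2, h3, h4⟩ := mem_intertwiner_one.1 h1
  rcases hγ.eq_zero_or_eq (a := (⟨b * a, h2⟩ : 𝔄.fixed)) (Subtype.ext h3) (Subtype.ext h4)
    (Subtype.ext (by
    change b * a * (b * a) = b * a
    calc b * a * (b * a) = b * (a * b) * a := by noncomm_ring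
      _ = b * a := by rw [hab, mul_i hb])) with h5 | h5
  · exfalso
    have h6 : b * a = 0 := congrArg Subtype.val h5
    apply γ.ne_zero
    calc γ.i = (a * b) * (a * b) := by rw [hab, γ.idem]
      _ = a * (b * a) * b := by noncomm_ring
      _ = 0 := by rw [h6, mul_zero, zero_mul]
  · exact ⟨b, hb, hab, congrArg Subtype.val h5⟩

theorem isInvertible_of_mul_left (ha : a ∈ γ.intertwiner φ) (hb : b ∈ γ.intertwiner ψ)
    (h : γ.IsInvertible (φ * ψ) (a * b)) : γ.IsInvertible φ a := by
  obtain ⟨c, hc, h1, -⟩ := h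
  refine isInvertible_of_mul_eq hγ ha (b := b * c) ?_ (by rw [← mul_assoc, h1])
  have := mul_mem_intertwiner hb hc
  rwa [mul_inv_rev, mul_inv_cancel_left] at this

theorem isInvertible_of_mul_right (ha : a ∈ γ.intertwiner φ) (hb : b ∈ γ.intertwiner ψ)
    (h : γ.IsInvertible (φ * ψ) (a * b)) : γ.IsInvertible ψ b := by
  obtain ⟨c, hc, -, h1⟩ := h
  have h2 : c * a ∈ γ.intertwiner ψ⁻¹ := by
    have := mul_mem_intertwiner hc ha
    rwa [mul_inv_rev, inv_mul_cancel_right] at this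
  have h3 : c * a * b = γ.i := by rw [mul_assoc, h1]
  obtain ⟨e, he, h4, h5⟩ := isInvertible_of_mul_eq hγ h2 (b := b) (by rwa [inv_inv]) h3
  rw [inv_inv] at he
  have h6 : e = b := by
    calc e = e * (c * a) * b := by rw [mul_assoc, h3, mul_i he]
      _ = b := by rw [h5, i_mul hb]
  exact ⟨c * a, h2, h6 ▸ h5, h3⟩

theorem isInvertible_of_add (ha : a ∈ γ.intertwiner φ) (hb : b ∈ γ.intertwiner φ)
    (h : γ.IsInvertible φ (a + b)) : γ.IsInvertible φ a ∨ γ.IsInvertible φ b := by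
  obtain ⟨c, hc, h1, -⟩ := h
  have hac : a * c ∈ γ.intertwiner 1 := by simpa using mul_mem_intertwiner ha hc
  have hbc : b * c ∈ γ.intertwiner 1 := by simpa using mul_mem_intertwiner hb hc
  obtain ⟨h2, h3, h4⟩ := mem_intertwiner_one.1 hac
  obtain ⟨k2, k3, k4⟩ := mem_intertwiner_one.1 hbc
  have h5 : (⟨a * c, h2⟩ + ⟨b * c, k2⟩ : 𝔄.fixed) = γ.elt := Subtype.ext (by
    change a * c + b * c = γ.i
    rw [← add_mul, h1])
  have key : ∀ x ∈ γ.intertwiner φ, ∀ h : x * c ∈ 𝔄.fixed, CornerUnit γ.elt ⟨x * c, h⟩ →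
      γ.IsInvertible φ x := by
    intro x hx h hu
    obtain ⟨e, he, h6, -⟩ := cornerUnit_iff.1 hu
    refine isInvertible_of_mul_eq hγ hx (b := c * e) ?_ (by rw [← mul_assoc]; exact h6)
    have := mul_mem_intertwiner hc he
    simpa using this
  rcases hγ.unit_of_add (a := (⟨a * c, h2⟩ : 𝔄.fixed)) (b := (⟨b * c, k2⟩ : 𝔄.fixed))
    (Subtype.ext h3) (Subtype.ext h4)
    (Subtype.ext k3) (Subtype.ext k4) (by rw [h5]; exact hγ.unit_self) with h6 | h6
  · exact Or.inl (key a ha _ h6)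
  · exact Or.inr (key b hb _ h6)

omit hγ in
theorem not_isInvertible_zero : ¬ γ.IsInvertible φ 0 := by
  rintro ⟨b, -, h1, -⟩
  exact γ.ne_zero (by rw [← h1, zero_mul])

theorem exists_isInvertible_of_sum {ι : Type*} (s : Finset ι) (f : ι → A)
    (hf : ∀ x ∈ s, f x ∈ γ.intertwiner φ) (h : γ.IsInvertible φ (∑ x ∈ s, f x)) :
    ∃ x ∈ s, γ.IsInvertible φ (f x) := by
  classical
  induction s using Finset.induction_on with
  | empty => exact absurd h (by simpa using not_isInvertible_zero)
  | insert x s hx ih =>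
    rw [Finset.sum_insert hx] at h
    rcases isInvertible_of_add hγ (hf x (by simp))
      (Submodule.sum_mem _ fun y hy => hf y (by simp [hy])) h with h1 | h1
    · exact ⟨x, by simp, h1⟩
    · obtain ⟨y, hy, h2⟩ := ih (fun y hy => hf y (by simp [hy])) h1
      exact ⟨y, by simp [hy], h2⟩

end isLocal

theorem mem_leftIdeal_iff {m : A} : m ∈ Ideal.span {γ.i} ↔ m * γ.i = m := by
  constructor
  · intro h
    obtain ⟨a, rfl⟩ := Ideal.mem_span_singleton'.1 h
    rw [mul_assoc, γ.idem]
  · intro h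
    exact Ideal.mem_span_singleton'.2 ⟨m, h⟩

/-- `(ψ, x)` is a fusion if and only if there is an invertible element of degree `x` which
intertwines `ψ`: the isomorphism `Ai ≃ (Ai)(x⁻¹)_ψ` is the right multiplication by its inverse. -/
theorem mem_fusionGroup_iff {φ : MulAut L × Γ} : φ ∈ fusionGroup γ ↔
    (∀ u : L, d (φ.1 u) = φ.2 * d u * φ.2⁻¹) ∧ ∃ z ∈ γ.intertwiner φ, γ.IsInvertible φ z := by
  refine and_congr_right fun hd => ⟨?_, ?_⟩
  · rintro ⟨f, hf⟩
    let ι : LeftIdealOf γ.i := ⟨γ.i, Ideal.subset_span rfl⟩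
    have hsmul : ∀ (m : LeftIdealOf γ.i), (m : A) • ι = m := fun m =>
      Subtype.ext (mem_leftIdeal_iff.1 m.2)
    have hmul : ∀ m : LeftIdealOf γ.i, (f m : A) = m * (f ι : A) := fun m => by
      have := f.map_smul (m : A) ι
      rw [hsmul] at this
      exact congrArg Subtype.val this
    have hmul' : ∀ m : LeftIdealOf γ.i, (f.symm m : A) = m * (f.symm ι : A) := fun m => by
      have := f.symm.map_smul (m : A) ι
      rw [hsmul] at this
      exact congrArg Subtype.val this
    have h1 : (f.symm ι : A) * (f ι : A) = γ.i := by rw [← hmul, f.apply_symm_apply]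
    have h2 : (f ι : A) * (f.symm ι : A) = γ.i := by rw [← hmul', f.symm_apply_apply]
    have hι : (ι : A) ∈ 𝔄.comp 1 := (GradedInterior.mem_fixed.1 γ.mem).1
    have hcomm := (GradedInterior.mem_fixed.1 γ.mem).2
    have hmem : ∀ u, γ.i * (𝔄.str u : A) ∈ Ideal.span {γ.i} := fun u => by
      rw [mem_leftIdeal_iff, mul_assoc, hcomm, ← mul_assoc, γ.idem]
    have hstr : ∀ u, (𝔄.str u : A) * (f ι : A) = (f ι : A) * (𝔄.str (φ.1 u) : A) := fun u => by
      rw [← hf.map_str u ι ⟨_, hmem u⟩ rfl, hmul ⟨_, hmem u⟩]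
      change _ = γ.i * (𝔄.str u : A) * (f ι : A)
      rw [← hcomm, mul_assoc]
      exact congrArg _ (hmul ι)
    have hw : (f ι : A) ∈ γ.intertwiner φ⁻¹ := by
      refine ⟨(hmul ι).symm, mem_leftIdeal_iff.1 (f ι).2, ?_, fun u => ?_⟩
      · simpa using (hf.map_comp 1 ι).1 hι
      · have := hstr (φ.1⁻¹ u)
        simpa using this
    refine ⟨(f.symm ι : A), ?_, (f ι : A), hw, h1, h2⟩
    refine ⟨(hmul' ι).symm, mem_leftIdeal_iff.1 (f.symm ι).2, ?_, fun u => ?_⟩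
    · rw [hf.map_comp, f.apply_symm_apply, mul_inv_cancel]
      exact hι
    · calc (𝔄.str (φ.1 u) : A) * (f.symm ι : A)
          = ((𝔄.str (φ.1 u) : A) * γ.i) * (f.symm ι : A) := by
            rw [mul_assoc]; exact congrArg _ (hmul' ι)
        _ = (f.symm ι : A) * ((f ι : A) * (𝔄.str (φ.1 u) : A)) * (f.symm ι : A) := by
            rw [hcomm]; simp only [← mul_assoc, h1]
        _ = (f.symm ι : A) * ((𝔄.str u : A) * ((f ι : A) * (f.symm ι : A))) := by
            rw [← hstr, mul_assoc, mul_assoc]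
        _ = (f.symm ι : A) * γ.i * (𝔄.str u : A) := by rw [h2, hcomm, mul_assoc]
        _ = _ := by rw [mem_leftIdeal_iff.1 (f.symm ι).2]
  · rintro ⟨z, hz, w, hw, h1, h2⟩
    have hmem : ∀ (m : A) (y ψ) (hy : y ∈ γ.intertwiner ψ), m * y ∈ Ideal.span {γ.i} :=
      fun m y ψ hy => by rw [mem_leftIdeal_iff, mul_assoc, mul_i hy]
    let f : LeftIdealOf γ.i ≃ₗ[A] LeftIdealOf γ.i :=
      { toFun := fun m => ⟨m * w, hmem m w _ hw⟩
        invFun := fun m => ⟨m * z, hmem m z _ hz⟩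
        map_add' := fun m m' => Subtype.ext (add_mul _ _ _)
        map_smul' := fun a m => Subtype.ext (mul_assoc _ _ _)
        left_inv := fun m => Subtype.ext (by
          change (m : A) * w * z = m
          rw [mul_assoc, h2, mem_leftIdeal_iff.1 m.2])
        right_inv := fun m => Subtype.ext (by
          change (m : A) * z * w = m
          rw [mul_assoc, h1, mem_leftIdeal_iff.1 m.2]) }
    refine ⟨f, fun y m => ⟨fun h => 𝔄.graded.mul_mem h hw.2.2.1, fun h => ?_⟩,
      fun u m m' h => ?_⟩
    · have h3 : (m : A) * w * z ∈ 𝔄.comp (y * φ.2⁻¹ * φ.2) := 𝔄.graded.mul_mem h hz.2.2.1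
      rwa [mul_assoc (m : A), h2, mem_leftIdeal_iff.1 m.2, inv_mul_cancel_right] at h3
    · change (m' : A) * w = m * w * _
      have h3 := str_mul hw (φ.1 u)
      have h4 : φ⁻¹.1 (φ.1 u) = u := by simp
      rw [h4] at h3
      rw [h, mul_assoc, h3, mul_assoc]

section finite

variable [IsLocalRing O] [IsNoetherianRing O] [Module.Finite O A]

instance (S : Subalgebra O A) : Module.Finite O S :=
  inferInstanceAs (Module.Finite O (Subalgebra.toSubmodule S))

variable (γ) in
theorem isLocalIdempotent [IsAdicComplete (IsLocalRing.maximalIdeal O) O] :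
    IsLocalIdempotent γ.elt := by
  refine isLocalIdempotent_of_primitive (O := O) (Subtype.ext γ.idem)
    (fun h => γ.ne_zero (congrArg Subtype.val h)) fun j hj h1 h2 => ?_
  rcases γ.primitive j j.2 (congrArg Subtype.val hj) (congrArg Subtype.val h1)
    (congrArg Subtype.val h2) with h | h
  · exact Or.inl (Subtype.ext h)
  · exact Or.inr (Subtype.ext h)

theorem not_isInvertible_smul {r : O} (hr : r ∈ IsLocalRing.maximalIdeal O) :
    ¬ γ.IsInvertible 1 (r • γ.i) := by
  intro h
  refine not_cornerUnit_smul (O := O) (i := γ.elt) (Subtype.ext γ.idem)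
    (fun h => γ.ne_zero (congrArg Subtype.val h)) hr ?_
  exact cornerUnit_iff.2 h

end finite

end GradedInterior.Point

namespace GradedEmbedding

open GradedInterior.Point

variable {O L Γ A A' : Type*} [CommRing O] [Group L] [Group Γ] {d : L →* Γ}
  [Ring A] [Algebra O A] [Ring A'] [Algebra O A']
  {𝔅 : GradedInterior O d A'} {𝔄 : GradedInterior O d A} (ε : GradedEmbedding 𝔅 𝔄)
  {γ' : 𝔅.Point} {γ : 𝔄.Point} (hi : ε.f γ'.i = γ.i)

theorem pullback_i (γ : 𝔄.Point) (h : ε.f 1 * γ.i = γ.i) (h' : γ.i * ε.f 1 = γ.i) :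
    ε.f (ε.pullback γ h h').i = γ.i :=
  (ε.range γ.i h h').choose_spec

theorem f_one_mul (a : A') : ε.f 1 * ε.f a = ε.f a := by rw [← map_mul, one_mul]

theorem mul_f_one (a : A') : ε.f a * ε.f 1 = ε.f a := by rw [← map_mul, mul_one]

variable {ε}
include hi

theorem map_mem_intertwiner_iff {φ : MulAut L × Γ} {a : A'} :
    ε.f a ∈ γ.intertwiner φ ↔ a ∈ γ'.intertwiner φ := by
  constructor
  · rintro ⟨h1, h2, h3, h4⟩
    refine ⟨ε.injective ?_, ε.injective ?_, ε.mem_comp_of_map h3, fun u => ε.injective ?_⟩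
    · rw [map_mul, hi, h1]
    · rw [map_mul, hi, h2]
    · rw [ε.map_str_mul, ε.map_mul_str, h4]
  · rintro ⟨h1, h2, h3, h4⟩
    refine ⟨?_, ?_, ε.map_comp _ _ h3, fun u => ?_⟩
    · rw [← hi, ← map_mul, h1]
    · rw [← hi, ← map_mul, h2]
    · rw [← ε.map_str_mul, ← ε.map_mul_str, h4]

theorem exists_map_eq {a : A} (h1 : γ.i * a = a) (h2 : a * γ.i = a) : ∃ a', ε.f a' = a := by
  refine ε.range a ?_ ?_
  · rw [← h1, ← mul_assoc, ← hi, ε.f_one_mul]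
  · rw [← h2, mul_assoc, ← hi, ε.mul_f_one]

theorem isInvertible_map_iff {φ : MulAut L × Γ} {a : A'} :
    γ.IsInvertible φ (ε.f a) ↔ γ'.IsInvertible φ a := by
  constructor
  · rintro ⟨b, hb, h1, h2⟩
    obtain ⟨b, rfl⟩ := exists_map_eq hi (i_mul hb) (mul_i hb)
    refine ⟨b, (map_mem_intertwiner_iff hi).1 hb, ε.injective ?_, ε.injective ?_⟩
    · rw [map_mul, hi, h1]
    · rw [map_mul, hi, h2]
  · rintro ⟨b, hb, h1, h2⟩
    refine ⟨ε.f b, (map_mem_intertwiner_iff hi).2 hb, ?_, ?_⟩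
    · rw [← map_mul, h1, hi]
    · rw [← map_mul, h2, hi]

theorem fusionGroup_eq : fusionGroup γ = fusionGroup γ' := by
  ext φ
  rw [mem_fusionGroup_iff, mem_fusionGroup_iff]
  refine and_congr_right fun _ => ⟨?_, ?_⟩
  · rintro ⟨z, hz, h⟩
    obtain ⟨z, rfl⟩ := exists_map_eq hi (i_mul hz) (mul_i hz)
    exact ⟨z, (map_mem_intertwiner_iff hi).1 hz, (isInvertible_map_iff hi).1 h⟩
  · rintro ⟨z, hz, h⟩
    exact ⟨ε.f z, (map_mem_intertwiner_iff hi).2 hz, (isInvertible_map_iff hi).2 h⟩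

end GradedEmbedding

/-! ### The bimodule `Ai ⊗ C` and its endomorphisms -/

section fusionModule

open GradedInterior.Point

variable {O P Γ A : Type*} [CommRing O] [Group P] [Group Γ] {d : P →* Γ} [Ring A] [Algebra O A]
  {𝔄 : GradedInterior O d A} (γ : 𝔄.Point)

/-- The right multiplication by an element of `A` that maps `Ai` to itself. -/
def leftIdealMulRight (y : A) (hy : γ.i * y = y * γ.i) :
    LeftIdealOf γ.i →ₗ[A] LeftIdealOf γ.i where
  toFun m := ⟨m * y, mem_leftIdeal_iff.2 (by
    rw [mul_assoc, ← hy, ← mul_assoc, mem_leftIdeal_iff.1 m.2])⟩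
  map_add' m m' := Subtype.ext (add_mul _ _ _)
  map_smul' a m := Subtype.ext (mul_assoc _ _ _)

theorem i_mul_str (u : P) : γ.i * (𝔄.str u : A) = (𝔄.str u : A) * γ.i :=
  ((GradedInterior.mem_fixed.1 γ.mem).2 u).symm

/-- The map `Ai ⊗ C → ⨁_φ Ai`, `m ⊗ uφ ↦ mu` in degree `φ`, as a family of linear maps. -/
noncomputable def fusionCoeffAux :
    FusionCrossed γ →ₗ[O] (LeftIdealOf γ.i →ₗ[A] (fusionGroup γ →₀ LeftIdealOf γ.i)) :=
  (Finsupp.linearCombination O fun g : P ⋊[fusionAction γ] fusionGroup γ =>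
    (Finsupp.lsingle g.right : _ →ₗ[A] _) ∘ₗ
      leftIdealMulRight γ (𝔄.str g.left : A) (i_mul_str γ g.left)) ∘ₗ
    (MonoidAlgebra.coeffLinearEquiv O).toLinearMap

theorem fusionCoeffAux_single (g : P ⋊[fusionAction γ] fusionGroup γ) (r : O)
    (m : LeftIdealOf γ.i) :
    fusionCoeffAux γ (MonoidAlgebra.single g r) m =
      r • Finsupp.single g.right
        (leftIdealMulRight γ (𝔄.str g.left : A) (i_mul_str γ g.left) m) := by
  have h := Finsupp.linearCombination_single O r g
    (v := fun g : P ⋊[fusionAction γ] fusionGroup γ =>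
    (Finsupp.lsingle g.right : _ →ₗ[A] fusionGroup γ →₀ LeftIdealOf γ.i) ∘ₗ
      leftIdealMulRight γ (𝔄.str g.left : A) (i_mul_str γ g.left))
  exact congrArg (fun f => f m) h

/-- The map `Ai ⊗_O C → ⨁_φ Ai`, `m ⊗ uφ ↦ mu` in degree `φ`. -/
noncomputable def fusionCoeffTensor :
    LeftIdealOf γ.i ⊗[O] FusionCrossed γ →ₗ[A] (fusionGroup γ →₀ LeftIdealOf γ.i) :=
  TensorProduct.AlgebraTensorModule.lift
    { toFun := fun m =>
        { toFun := fun c => fusionCoeffAux γ c m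
          map_add' := fun c c' => by rw [map_add, LinearMap.add_apply]
          map_smul' := fun r c => by rw [map_smul, LinearMap.smul_apply, RingHom.id_apply] }
      map_add' := fun m m' => LinearMap.ext fun c => map_add (fusionCoeffAux γ c) m m'
      map_smul' := fun a m => LinearMap.ext fun c => map_smul (fusionCoeffAux γ c) a m }

theorem fusionCoeffTensor_tmul (m : LeftIdealOf γ.i) (c : FusionCrossed γ) :
    fusionCoeffTensor γ (m ⊗ₜ c) = fusionCoeffAux γ c m := rfl

/-- The map `Ai ⊗_{OP} C → ⨁_φ Ai`, `m ⊗ uφ ↦ mu` in degree `φ`. -/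
noncomputable def fusionCoeff : FusionModule γ →ₗ[A] (fusionGroup γ →₀ LeftIdealOf γ.i) :=
  Submodule.liftQ _ (fusionCoeffTensor γ) (by
    rw [fusionRel, Submodule.span_le]
    rintro _ ⟨u, m, m', c, h, rfl⟩
    change fusionCoeffTensor γ _ = 0
    rw [map_sub, fusionCoeffTensor_tmul, fusionCoeffTensor_tmul, sub_eq_zero]
    induction c using MonoidAlgebra.induction_linear with
    | zero => simp
    | add f g hf hg =>
      rw [mul_add, map_add, map_add, LinearMap.add_apply, LinearMap.add_apply, hf, hg]
    | single g r =>
      rw [MonoidAlgebra.single_mul_single, fusionCoeffAux_single, fusionCoeffAux_single, one_mul]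
      congr 2
      · simp
      · apply Subtype.ext
        change (m' : A) * _ = m * _
        rw [h, mul_assoc]
        simp)

theorem fusionCoeff_mk (m : LeftIdealOf γ.i) (g : P ⋊[fusionAction γ] fusionGroup γ) (r : O) :
    fusionCoeff γ (fusionMk γ m (MonoidAlgebra.single g r)) =
      r • Finsupp.single g.right (leftIdealMulRight γ (𝔄.str g.left : A) (i_mul_str γ g.left) m) :=
  fusionCoeffAux_single γ g r m

theorem fusionMk_add_left (m m' : LeftIdealOf γ.i) (c : FusionCrossed γ) :
    fusionMk γ (m + m') c = fusionMk γ m c + fusionMk γ m' c := by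
  simp only [fusionMk, TensorProduct.add_tmul, Submodule.Quotient.mk_add]

theorem fusionMk_add_right (m : LeftIdealOf γ.i) (c c' : FusionCrossed γ) :
    fusionMk γ m (c + c') = fusionMk γ m c + fusionMk γ m c' := by
  simp only [fusionMk, TensorProduct.tmul_add, Submodule.Quotient.mk_add]

theorem fusionMk_smul_left (a : A) (m : LeftIdealOf γ.i) (c : FusionCrossed γ) :
    fusionMk γ (a • m) c = a • fusionMk γ m c := rfl

theorem fusionMk_smul_right (r : O) (m : LeftIdealOf γ.i) (c : FusionCrossed γ) :
    fusionMk γ m (r • c) = r • fusionMk γ m c := by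
  simp only [fusionMk, TensorProduct.tmul_smul, Submodule.Quotient.mk_smul]

theorem fusionMk_str {u : P} {m m' : LeftIdealOf γ.i} (h : (m' : A) = m * (𝔄.str u : A))
    (c : FusionCrossed γ) : fusionMk γ m' c
      = fusionMk γ m (MonoidAlgebra.single (SemidirectProduct.inl u) 1 * c) := by
  refine (Submodule.Quotient.eq _).2 (Submodule.subset_span ⟨u, m, m', c, h, rfl⟩)

theorem fusionMk_single (m : LeftIdealOf γ.i) (g : P ⋊[fusionAction γ] fusionGroup γ) (r : O) :
    fusionMk γ m (MonoidAlgebra.single g r) =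
      r • fusionMk γ (leftIdealMulRight γ (𝔄.str g.left : A) (i_mul_str γ g.left) m)
        (MonoidAlgebra.single (SemidirectProduct.inr g.right) 1) := by
  rw [fusionMk_str γ (u := g.left) (m := m) (m' := leftIdealMulRight γ (𝔄.str g.left : A)
    (i_mul_str γ g.left) m) rfl, MonoidAlgebra.single_mul_single, one_mul,
    SemidirectProduct.inl_left_mul_inr_right, ← fusionMk_smul_right, MonoidAlgebra.smul_single,
    smul_eq_mul, mul_one]

theorem fusionRight_mk (m : LeftIdealOf γ.i) (c c' : FusionCrossed γ) :
    fusionRight γ c (fusionMk γ m c') = fusionMk γ m (c' * c) := rfl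

/-- The map `⨁_φ Ai → Ai ⊗_{OP} C`, which sends `m` in degree `φ` to `m ⊗ φ`. -/
noncomputable def fusionSum : (fusionGroup γ →₀ LeftIdealOf γ.i) →ₗ[A] FusionModule γ :=
  Finsupp.lsum ℕ fun φ =>
    { toFun := fun m => fusionMk γ m (MonoidAlgebra.single (SemidirectProduct.inr φ) 1)
      map_add' := fun m m' => fusionMk_add_left γ m m' _
      map_smul' := fun a m => fusionMk_smul_left γ a m _ }

theorem fusionSum_single (φ : fusionGroup γ) (m : LeftIdealOf γ.i) :
    fusionSum γ (Finsupp.single φ m) =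
      fusionMk γ m (MonoidAlgebra.single (SemidirectProduct.inr φ) 1) := by
  rw [fusionSum, Finsupp.lsum_single]
  rfl

@[elab_as_elim]
theorem fusionModule_induction {p : FusionModule γ → Prop} (t : FusionModule γ) (h0 : p 0)
    (hadd : ∀ s t, p s → p t → p (s + t))
    (hmk : ∀ (m : LeftIdealOf γ.i) (φ : fusionGroup γ),
      p (fusionMk γ m (MonoidAlgebra.single (SemidirectProduct.inr φ) 1))) : p t := by
  obtain ⟨t, rfl⟩ := Submodule.Quotient.mk_surjective _ t
  induction t using TensorProduct.induction_on with
  | zero => simpa using h0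
  | add s t hs ht => simpa using hadd _ _ hs ht
  | tmul m c =>
    change p (fusionMk γ m c)
    induction c using MonoidAlgebra.induction_linear with
    | zero => simpa [fusionMk] using h0
    | add f g hf hg =>
      rw [fusionMk_add_right]
      exact hadd _ _ hf hg
    | single g r =>
      rw [fusionMk_single, ← algebraMap_smul A r, ← fusionMk_smul_left]
      exact hmk _ _

theorem fusionSum_coeff (t : FusionModule γ) : fusionSum γ (fusionCoeff γ t) = t := by
  induction t using fusionModule_induction with
  | h0 => simp
  | hadd s t hs ht => rw [map_add, map_add, hs, ht]
  | hmk m φ =>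
    rw [fusionCoeff_mk, one_smul, fusionSum_single]
    congr 1
    apply Subtype.ext
    change (m : A) * _ = m
    simp

theorem fusionCoeff_injective : Function.Injective (fusionCoeff γ) :=
  Function.LeftInverse.injective (fusionSum_coeff γ)

/-- The generator `i ⊗ 1` of `Ai ⊗_{OP} C`. -/
noncomputable def fusionGen : FusionModule γ := fusionMk γ ⟨γ.i, Ideal.subset_span rfl⟩ 1

theorem fusionMk_eq (m : LeftIdealOf γ.i) (c : FusionCrossed γ) :
    fusionMk γ m c = (m : A) • fusionRight γ c (fusionGen γ) := by
  rw [fusionGen, fusionRight_mk, ← fusionMk_smul_left, one_mul]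
  congr 1
  exact Subtype.ext (mem_leftIdeal_iff.1 m.2).symm

/-- A bimodule endomorphism is determined by the image of the generator. -/
theorem FAlg.ext_gen {h h' : FAlg γ} (H : h.toEnd (fusionGen γ) = h'.toEnd (fusionGen γ)) :
    h = h' := by
  apply MulOpposite.unop_injective
  apply Subtype.ext
  refine LinearMap.ext fun t => ?_
  change h.toEnd t = h'.toEnd t
  induction t using fusionModule_induction with
  | h0 => simp
  | hadd s t hs ht => rw [map_add, map_add, hs, ht]
  | hmk m φ =>
    have h1 : ∀ h : FAlg γ, ∀ c t, h.toEnd (fusionRight γ c t) = fusionRight γ c (h.toEnd t) :=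
      fun h => (MulOpposite.unop (α := fusionEnd γ) h).2.1
    rw [fusionMk_eq, map_smul, map_smul, h1, h1, H]

theorem fusionCoeff_mem_comp {y : Γ} {t : FusionModule γ} (ht : t ∈ fusionGradΓ γ y)
    (φ : fusionGroup γ) : (fusionCoeff γ t φ : A) ∈ 𝔄.comp (y * (φ.1.2)⁻¹) := by
  induction ht using Submodule.span_induction with
  | mem t ht =>
    obtain ⟨z, m, u, ψ, hm, hy, rfl⟩ := ht
    rw [fusionCoeff_mk, one_smul]
    by_cases h : ψ = φ
    · subst h
      simp only [Finsupp.single_eq_same]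
      rw [← hy, ← mul_assoc, mul_inv_cancel_right]
      exact 𝔄.graded.mul_mem hm (𝔄.str_mem u)
    · rw [Finsupp.single_eq_of_ne (Ne.symm h)]
      exact zero_mem _
  | zero => rw [map_zero]; exact zero_mem _
  | add s t _ _ hs ht => rw [map_add]; exact add_mem hs ht
  | smul r t _ ht =>
    rw [← algebraMap_smul A r, map_smul, algebraMap_smul A r]
    exact Submodule.smul_mem _ r ht

theorem fusionCoeff_eq_zero_of_mem {ψ : fusionGroup γ} {t : FusionModule γ}
    (ht : t ∈ fusionGradF γ ψ) {φ : fusionGroup γ} (hφ : φ ≠ ψ) : fusionCoeff γ t φ = 0 := by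
  induction ht using Submodule.span_induction with
  | mem t ht =>
    obtain ⟨m, u, rfl⟩ := ht
    rw [fusionCoeff_mk, one_smul, Finsupp.single_eq_of_ne hφ]
  | zero => rw [map_zero]; rfl
  | add s t _ _ hs ht => rw [map_add, Finsupp.add_apply, hs, ht, add_zero]
  | smul r t _ ht =>
    rw [← algebraMap_smul A r, map_smul, Finsupp.smul_apply, ht, smul_zero]

end fusionModule

/-! ### The homogeneous components of `ℱ` -/

section fusionAlgebra

open GradedInterior.Point

variable {O P Γ A : Type*} [CommRing O] [Group P] [Group Γ] {d : P →* Γ} [Ring A] [Algebra O A]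
  {𝔄 : GradedInterior O d A} {γ : 𝔄.Point}

theorem fusionAction_apply (φ : fusionGroup γ) : fusionAction γ φ = φ.1.1 := rfl

namespace FAlg

theorem toEnd_mul (h h' : FAlg γ) (t : FusionModule γ) : (h * h').toEnd t = h'.toEnd (h.toEnd t) :=
  rfl

theorem toEnd_add (h h' : FAlg γ) (t : FusionModule γ) :
    (h + h').toEnd t = h.toEnd t + h'.toEnd t := rfl

theorem toEnd_smul (r : O) (h : FAlg γ) (t : FusionModule γ) : (r • h).toEnd t = r • h.toEnd t :=
  rfl

theorem toEnd_zero (t : FusionModule γ) : (0 : FAlg γ).toEnd t = 0 := rfl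

theorem toEnd_one (t : FusionModule γ) : (1 : FAlg γ).toEnd t = t := rfl

theorem toEnd_right (h : FAlg γ) (c : FusionCrossed γ) (t : FusionModule γ) :
    h.toEnd (fusionRight γ c t) = fusionRight γ c (h.toEnd t) :=
  (MulOpposite.unop (α := fusionEnd γ) h).2.1 c t

theorem toEnd_mem (h : FAlg γ) {y : Γ} {t : FusionModule γ} (ht : t ∈ fusionGradΓ γ y) :
    h.toEnd t ∈ fusionGradΓ γ y :=
  (MulOpposite.unop (α := fusionEnd γ) h).2.2 y t ht

theorem toEnd_mk (h : FAlg γ) (m : LeftIdealOf γ.i) (c : FusionCrossed γ) :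
    h.toEnd (fusionMk γ m c) = (m : A) • fusionRight γ c (h.toEnd (fusionGen γ)) := by
  rw [fusionMk_eq, map_smul, toEnd_right]

end FAlg

theorem fusionMk_one_str (u : P) (m : LeftIdealOf γ.i) :
    fusionMk γ m (MonoidAlgebra.single (SemidirectProduct.inl u) 1) =
      fusionMk γ (leftIdealMulRight γ (𝔄.str u : A) (i_mul_str γ u) m) 1 := by
  rw [fusionMk_str γ (u := u) (m := m)
    (m' := leftIdealMulRight γ (𝔄.str u : A) (i_mul_str γ u) m) rfl, mul_one]

theorem fusionCoeff_right (t : FusionModule γ) (u : P) (χ φ : fusionGroup γ) :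
    (fusionCoeff γ (fusionRight γ (MonoidAlgebra.single ⟨u, χ⟩ 1) t) φ : A) =
      (fusionCoeff γ t (φ * χ⁻¹) : A) * (𝔄.str ((φ * χ⁻¹).1.1 u) : A) := by
  induction t using fusionModule_induction with
  | h0 => simp
  | hadd s t hs ht =>
    simp only [map_add, Finsupp.add_apply, Submodule.coe_add, hs, ht, add_mul]
  | hmk m ψ =>
    rw [fusionRight_mk, MonoidAlgebra.single_mul_single, fusionCoeff_mk, fusionCoeff_mk, one_smul,
      mul_one, one_smul]
    by_cases h : ψ = φ * χ⁻¹
    · subst h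
      simp [leftIdealMulRight, fusionAction_apply, mul_assoc]
    · have h' : ψ * χ ≠ φ := fun h' => h (by rw [← h', mul_inv_cancel_right])
      simp [Finsupp.single_eq_of_ne (Ne.symm h), Finsupp.single_eq_of_ne (Ne.symm h')]

variable (γ) in
/-- The endomorphism `m ⊗ c ↦ my ⊗ φ⁻¹c` of `Ai ⊗_{OP} C`, for an element `y` that intertwines
`φ`. -/
noncomputable def fusionMulEnd (φ : fusionGroup γ) (y : γ.intertwiner φ.1) :
    FusionModule γ →ₗ[A] FusionModule γ :=
  Submodule.mapQ _ _
    (TensorProduct.AlgebraTensorModule.map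
      (leftIdealMulRight γ y ((i_mul y.2).trans (mul_i y.2).symm))
      (LinearMap.mulLeft O (MonoidAlgebra.single (SemidirectProduct.inr φ⁻¹) 1)))
    (by
      rw [fusionRel, Submodule.span_le]
      rintro _ ⟨u, m, m', c, h, rfl⟩
      refine Submodule.subset_span ⟨(φ⁻¹).1.1 u,
        leftIdealMulRight γ y ((i_mul y.2).trans (mul_i y.2).symm) m,
        leftIdealMulRight γ y ((i_mul y.2).trans (mul_i y.2).symm) m',
        MonoidAlgebra.single (SemidirectProduct.inr φ⁻¹) 1 * c, ?_, ?_⟩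
      · change (m' : A) * y = m * y * _
        have h1 := str_mul y.2 ((φ⁻¹).1.1 u)
        have h2 : φ.1.1 ((φ⁻¹).1.1 u) = u := by simp
        rw [h2] at h1
        rw [h, mul_assoc, h1, mul_assoc]
      · have h3 : (SemidirectProduct.inr φ⁻¹ * SemidirectProduct.inl u :
            P ⋊[fusionAction γ] fusionGroup γ) =
            SemidirectProduct.inl ((φ⁻¹).1.1 u) * SemidirectProduct.inr φ⁻¹ := by
          ext <;> simp [fusionAction_apply]
        rw [map_sub, TensorProduct.AlgebraTensorModule.map_tmul,
          TensorProduct.AlgebraTensorModule.map_tmul, LinearMap.mulLeft_apply,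
          LinearMap.mulLeft_apply, ← mul_assoc, ← mul_assoc, MonoidAlgebra.single_mul_single,
          MonoidAlgebra.single_mul_single, h3])

theorem fusionMulEnd_mk (φ : fusionGroup γ) (y : γ.intertwiner φ.1) (m : LeftIdealOf γ.i)
    (c : FusionCrossed γ) : fusionMulEnd γ φ y (fusionMk γ m c) =
      fusionMk γ (leftIdealMulRight γ y ((i_mul y.2).trans (mul_i y.2).symm) m)
        (MonoidAlgebra.single (SemidirectProduct.inr φ⁻¹) 1 * c) := rfl

theorem fusionMulEnd_mem (φ : fusionGroup γ) (y : γ.intertwiner φ.1) :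
    fusionMulEnd γ φ y ∈ fusionEnd γ := by
  refine ⟨fun c t => ?_, fun z t ht => ?_⟩
  · induction t using fusionModule_induction with
    | h0 => simp
    | hadd s t hs ht => simp only [map_add, hs, ht]
    | hmk m ψ => rw [fusionRight_mk, fusionMulEnd_mk, fusionMulEnd_mk, fusionRight_mk, mul_assoc]
  · induction ht using Submodule.span_induction with
    | mem t ht =>
      obtain ⟨x, m, u, ψ, hm, hz, rfl⟩ := ht
      rw [fusionMulEnd_mk, MonoidAlgebra.single_mul_single, mul_one]
      refine Submodule.subset_span ⟨x * φ.1.2,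
        leftIdealMulRight γ y ((i_mul y.2).trans (mul_i y.2).symm) m, (φ⁻¹).1.1 u, φ⁻¹ * ψ,
        𝔄.graded.mul_mem hm y.2.2.2.1, ?_, ?_⟩
      · have h1 := (φ⁻¹).2.1 u
        rw [h1, ← hz]
        simp [mul_assoc]
      · congr 2
        ext <;> simp [fusionAction_apply]
    | zero => rw [map_zero]; exact zero_mem _
    | add s t _ _ hs ht => rw [map_add]; exact add_mem hs ht
    | smul r t _ ht =>
      rw [← algebraMap_smul A r, map_smul, algebraMap_smul A r]
      exact Submodule.smul_mem _ r ht

theorem fusionMulEnd_gen (φ : fusionGroup γ) (y : γ.intertwiner φ.1) :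
    fusionMulEnd γ φ y (fusionGen γ) =
      fusionMk γ ⟨y, mem_leftIdeal_iff.2 (mul_i y.2)⟩
        (MonoidAlgebra.single (SemidirectProduct.inr φ⁻¹) 1) := by
  rw [fusionGen, fusionMulEnd_mk, mul_one]
  congr 1
  exact Subtype.ext (i_mul y.2)

variable (γ) in
/-- The element of `ℱ` of degree `φ` given by the right multiplication by `y`. -/
noncomputable def fusionMul (φ : fusionGroup γ) : γ.intertwiner φ.1 →ₗ[O] FAlg γ where
  toFun y := MulOpposite.op (⟨fusionMulEnd γ φ y, fusionMulEnd_mem φ y⟩ : fusionEnd γ)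
  map_add' y y' := by
    refine FAlg.ext_gen γ ?_
    refine Eq.trans ?_ (FAlg.toEnd_add _ _ _).symm
    change fusionMulEnd γ φ _ _ = fusionMulEnd γ φ _ _ + fusionMulEnd γ φ _ _
    rw [fusionMulEnd_gen, fusionMulEnd_gen, fusionMulEnd_gen, ← fusionMk_add_left]
    rfl
  map_smul' r y := by
    refine FAlg.ext_gen γ ?_
    refine Eq.trans ?_ (FAlg.toEnd_smul r _ _).symm
    change fusionMulEnd γ φ _ _ = r • fusionMulEnd γ φ _ _
    rw [fusionMulEnd_gen, fusionMulEnd_gen]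
    refine Eq.trans ?_ (algebraMap_smul A r (fusionMk γ _ _))
    rw [← fusionMk_smul_left]
    congr 1
    exact Subtype.ext (by simp [Algebra.smul_def])

theorem fusionMul_toEnd (φ : fusionGroup γ) (y : γ.intertwiner φ.1) (t : FusionModule γ) :
    (fusionMul γ φ y).toEnd t = fusionMulEnd γ φ y t := rfl

namespace FAlg

/-- The coefficient of degree `φ` of an element of `ℱ`: if `i ⊗ 1 ↦ ∑ y_φ ⊗ φ⁻¹`, this is `y_φ`. -/
noncomputable def coeff (h : FAlg γ) (φ : fusionGroup γ) : A :=
  fusionCoeff γ (h.toEnd (fusionGen γ)) φ⁻¹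

theorem coeff_add (h h' : FAlg γ) (φ : fusionGroup γ) :
    (h + h').coeff φ = h.coeff φ + h'.coeff φ := by
  rw [coeff, toEnd_add, map_add]
  rfl

theorem coeff_zero (φ : fusionGroup γ) : (0 : FAlg γ).coeff φ = 0 := by
  rw [coeff, toEnd_zero, map_zero]
  rfl

theorem coeff_sum {ι : Type*} (s : Finset ι) (f : ι → FAlg γ) (φ : fusionGroup γ) :
    (∑ x ∈ s, f x).coeff φ = ∑ x ∈ s, (f x).coeff φ := by
  classical
  induction s using Finset.induction_on with
  | empty => simp [coeff_zero]
  | insert x s hx ih => rw [Finset.sum_insert hx, Finset.sum_insert hx, coeff_add, ih]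

theorem ext_coeff {h h' : FAlg γ} (H : ∀ φ, h.coeff φ = h'.coeff φ) : h = h' := by
  refine FAlg.ext_gen γ (fusionCoeff_injective γ (Finsupp.ext fun φ => Subtype.ext ?_))
  have := H φ⁻¹
  rwa [coeff, coeff, inv_inv] at this

theorem gen_mem : fusionGen γ ∈ fusionGradΓ γ 1 := by
  refine Submodule.subset_span ⟨1, ⟨γ.i, Ideal.subset_span rfl⟩, 1, 1,
    (GradedInterior.mem_fixed.1 γ.mem).1, by simp, rfl⟩

theorem coeff_mem (h : FAlg γ) (φ : fusionGroup γ) : h.coeff φ ∈ γ.intertwiner φ.1 := by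
  refine ⟨?_, mem_leftIdeal_iff.1 (Subtype.mem _), ?_, fun u => ?_⟩
  · have h1 : γ.i • fusionGen γ = fusionGen γ := by
      rw [fusionGen, ← fusionMk_smul_left]
      congr 1
      exact Subtype.ext γ.idem
    have h2 : γ.i • h.toEnd (fusionGen γ) = h.toEnd (fusionGen γ) := by rw [← map_smul, h1]
    have h3 := congrArg (fun t => (fusionCoeff γ t φ⁻¹ : A)) h2
    simpa [coeff] using h3
  · have h1 := fusionCoeff_mem_comp γ (h.toEnd_mem gen_mem) φ⁻¹
    simpa [coeff] using h1
  · have h1 : (𝔄.str (φ.1.1 u) : A) • fusionGen γ =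
        fusionRight γ (MonoidAlgebra.single ⟨φ.1.1 u, 1⟩ 1) (fusionGen γ) := by
      rw [fusionGen, fusionRight_mk, ← fusionMk_smul_left, one_mul]
      refine Eq.trans ?_ (fusionMk_one_str (φ.1.1 u) _).symm
      congr 1
      exact Subtype.ext (i_mul_str γ _).symm
    have h2 : (𝔄.str (φ.1.1 u) : A) • h.toEnd (fusionGen γ) =
        fusionRight γ (MonoidAlgebra.single ⟨φ.1.1 u, 1⟩ 1) (h.toEnd (fusionGen γ)) := by
      rw [← toEnd_right, ← h1, map_smul]
    have h3 := congrArg (fun t => (fusionCoeff γ t φ⁻¹ : A)) h2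
    simp only [map_smul, fusionCoeff_right] at h3
    simpa [coeff] using h3

theorem coeff_fusionMul_mul (ψ : fusionGroup γ) (y : γ.intertwiner ψ.1) (h : FAlg γ)
    (φ : fusionGroup γ) : (fusionMul γ ψ y * h).coeff φ = y * h.coeff (ψ⁻¹ * φ) := by
  rw [coeff, toEnd_mul, fusionMul_toEnd, fusionMulEnd_gen, toEnd_mk, map_smul, Finsupp.smul_apply]
  change (y : A) * _ = _
  have h1 := fusionCoeff_right (h.toEnd (fusionGen γ)) 1 ψ⁻¹ φ⁻¹
  rw [coeff]
  congr 1
  refine h1.trans ?_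
  simp [mul_inv_rev]

theorem coeff_one (φ : fusionGroup γ) [Decidable (φ = 1)] :
    (1 : FAlg γ).coeff φ = if φ = 1 then γ.i else 0 := by
  rw [coeff, toEnd_one, fusionGen, MonoidAlgebra.one_def, fusionCoeff_mk, one_smul]
  split_ifs with h
  · subst h
    simp [leftIdealMulRight]
  · have : (1 : P ⋊[fusionAction γ] fusionGroup γ).right ≠ φ⁻¹ :=
      fun h' => h (by simpa using h'.symm)
    rw [Finsupp.single_eq_of_ne (Ne.symm this)]
    rfl

theorem coeff_fusionMul (ψ : fusionGroup γ) (y : γ.intertwiner ψ.1) (φ : fusionGroup γ)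
    [Decidable (ψ = φ)] : (fusionMul γ ψ y).coeff φ = if ψ = φ then (y : A) else 0 := by
  classical
  have h := coeff_fusionMul_mul ψ y 1 φ
  rw [mul_one, coeff_one] at h
  rw [h]
  by_cases h' : ψ = φ
  · subst h'
    simp [mul_i y.2]
  · have : ψ⁻¹ * φ ≠ 1 := fun h'' => h' (inv_mul_eq_one.1 h'')
    simp [h', this]

/-- An element of `ℱ` is the sum of its homogeneous components. -/
theorem exists_sum_eq (h : FAlg γ) :
    ∃ s : Finset (fusionGroup γ), ∑ φ ∈ s, fusionMul γ φ ⟨h.coeff φ, h.coeff_mem φ⟩ = h := by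
  classical
  refine ⟨(fusionCoeff γ (h.toEnd (fusionGen γ))).support.map (Equiv.inv _).toEmbedding, ?_⟩
  refine ext_coeff fun φ => ?_
  simp only [coeff_sum, coeff_fusionMul, Finset.sum_ite_eq', ite_eq_left_iff]
  intro h1
  by_contra h2
  apply h1
  simp only [Finset.mem_map_equiv, Finsupp.mem_support_iff]
  intro h3
  exact h2 (congrArg Subtype.val h3).symm

theorem mem_fComp_iff {h : FAlg γ} {φ : fusionGroup γ} :
    h ∈ fComp γ φ ↔ h = fusionMul γ φ ⟨h.coeff φ, h.coeff_mem φ⟩ := by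
  classical
  constructor
  · intro hh
    refine ext_coeff fun ψ => ?_
    rw [coeff_fusionMul]
    split_ifs with h1
    · rw [h1]
    · have h2 : fusionGen γ ∈ fusionGradF γ 1 := Submodule.subset_span ⟨_, 1, rfl⟩
      have h3 := fusionCoeff_eq_zero_of_mem γ (hh 1 _ h2) (φ := ψ⁻¹)
        (fun h4 => h1 (by simpa using h4.symm))
      exact congrArg Subtype.val h3
  · intro hh
    rw [hh]
    intro ψ t ht
    rw [fusionMul_toEnd]
    induction ht using Submodule.span_induction with
    | mem t ht =>
      obtain ⟨m, u, rfl⟩ := ht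
      rw [fusionMulEnd_mk, MonoidAlgebra.single_mul_single, mul_one]
      refine Submodule.subset_span ⟨leftIdealMulRight γ (h.coeff φ)
        ((i_mul (h.coeff_mem φ)).trans (mul_i (h.coeff_mem φ)).symm) m, (φ⁻¹).1.1 u, ?_⟩
      congr 2
      ext <;> simp [fusionAction_apply]
    | zero => rw [map_zero]; exact zero_mem _
    | add s t _ _ hs ht => rw [map_add]; exact add_mem hs ht
    | smul r t _ ht =>
      rw [← algebraMap_smul A r, map_smul, algebraMap_smul A r]
      exact Submodule.smul_mem _ r ht

theorem fusionMul_mem_fComp (φ : fusionGroup γ) (y : γ.intertwiner φ.1) :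
    fusionMul γ φ y ∈ fComp γ φ := by
  classical
  rw [mem_fComp_iff]
  congr 1
  exact Subtype.ext ((coeff_fusionMul φ y φ).trans (if_pos rfl)).symm

theorem isFRightMulBy_iff {h : FAlg γ} {φ : fusionGroup γ} {y : A} :
    IsFRightMulBy γ h φ y ↔ ∃ hy : y ∈ γ.intertwiner φ.1, h = fusionMul γ φ ⟨y, hy⟩ := by
  classical
  constructor
  · rintro ⟨m₀, m, h0, hm, hh⟩
    have h1 : fusionMk γ m₀ 1 = fusionGen γ := by
      rw [fusionGen]
      congr 1
      exact Subtype.ext h0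
    rw [h1] at hh
    have h2 : ∀ ψ, h.coeff ψ = if φ = ψ then y else 0 := by
      intro ψ
      rw [coeff, hh, fusionCoeff_mk, one_smul]
      split_ifs with h3
      · subst h3
        simp [leftIdealMulRight, hm]
      · have : φ⁻¹ ≠ ψ⁻¹ := fun h4 => h3 (inv_injective h4)
        simp [Finsupp.single_eq_of_ne (Ne.symm this)]
    have hy : y ∈ γ.intertwiner φ.1 := by
      have := h.coeff_mem φ
      rwa [h2, if_pos rfl] at this
    exact ⟨hy, ext_coeff fun ψ => by rw [h2, coeff_fusionMul]⟩
  · rintro ⟨hy, rfl⟩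
    exact ⟨⟨γ.i, Ideal.subset_span rfl⟩, ⟨y, mem_leftIdeal_iff.2 (mul_i hy)⟩, rfl, rfl,
      fusionMulEnd_gen φ ⟨y, hy⟩⟩

end FAlg

end fusionAlgebra

/-! ### Residual algebras -/

section residualAlgebra

open GradedInterior.Point

variable {O P Γ A : Type*} [CommRing O] [Group P] [Group Γ] {d : P →* Γ} [Ring A] [Algebra O A]
  {𝔄 : GradedInterior O d A}

/-- The `E`-graded algebra `X` is the quotient, by the non-invertible homogeneous elements, of the
algebra of intertwiners of degrees in `E`, where `θ : E → Aut(P) × Γ`; its structure is given by the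
projections `π x` from the components of that algebra. -/
structure IsResidual (γ : 𝔄.Point) {E X : Type*} [Group E] [Ring X] [Algebra O X]
    (θ : E →* MulAut P × Γ) (π : ∀ x, γ.intertwiner (θ x) →ₗ[O] X) : Prop where
  one : ∀ a : γ.intertwiner (θ 1), (a : A) = γ.i → π 1 a = 1
  mul : ∀ x y (a : γ.intertwiner (θ x)) (b : γ.intertwiner (θ y)) (c : γ.intertwiner (θ (x * y))),
    (c : A) = a * b → π (x * y) c = π x a * π y b
  eq_zero_iff : ∀ x a, π x a = 0 ↔ ¬ γ.IsInvertible (θ x) a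
  iSup_range : ⨆ x, LinearMap.range (π x) = ⊤
  indep : ∀ (s : Finset E) (a : ∀ x, γ.intertwiner (θ x)), ∑ x ∈ s, π x (a x) = 0 →
    ∀ x ∈ s, π x (a x) = 0

namespace IsResidual

section grading

variable {γ : 𝔄.Point} {E X : Type*} [Group E] [Ring X] [Algebra O X] {θ : E →* MulAut P × Γ}
  {π : ∀ x, γ.intertwiner (θ x) →ₗ[O] X} (h : IsResidual γ θ π)
include h

theorem isInternal [DecidableEq E] : DirectSum.IsInternal fun x => LinearMap.range (π x) := by
  refine DirectSum.isInternal_submodule_of_iSupIndep_of_iSup_eq_top ?_ h.iSup_range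
  rw [iSupIndep_iff_finsetSum_eq_zero_imp_eq_zero]
  intro s v hv hs x hx
  have hv' : ∀ x, ∃ a, x ∈ s → π x a = v x := fun x => by
    by_cases hx : x ∈ s
    · obtain ⟨a, ha⟩ := hv x hx
      exact ⟨a, fun _ => ha⟩
    · exact ⟨0, fun h => absurd h hx⟩
  choose a ha using hv'
  rw [← ha x hx]
  refine h.indep s a ?_ x hx
  rw [← hs]
  exact Finset.sum_congr rfl fun x hx => ha x hx

theorem isGradedBy {comp : E → Submodule O X} (hc : ∀ x, LinearMap.range (π x) = comp x) :
    IsGradedBy comp := by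
  obtain rfl : comp = fun x => LinearMap.range (π x) := funext fun x => (hc x).symm
  refine ⟨?_, ?_, ?_⟩
  · have hi : γ.i ∈ γ.intertwiner (θ 1) := by rw [map_one]; exact i_mem_intertwiner
    exact ⟨⟨γ.i, hi⟩, h.one _ rfl⟩
  · rintro x y _ _ ⟨a, rfl⟩ ⟨b, rfl⟩
    have hab : (a : A) * b ∈ γ.intertwiner (θ (x * y)) := by
      rw [map_mul]; exact mul_mem_intertwiner a.2 b.2
    exact ⟨⟨_, hab⟩, h.mul x y a b _ rfl⟩
  · let := Classical.decEq E
    exact h.isInternal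

theorem algebraMap_eq_zero [IsLocalRing O] [IsNoetherianRing O] [Module.Finite O A] {r : O}
    (hr : r ∈ IsLocalRing.maximalIdeal O) : algebraMap O X r = 0 := by
  have hi : γ.i ∈ γ.intertwiner (θ 1) := by rw [map_one]; exact i_mem_intertwiner
  have h1 : π 1 ⟨γ.i, hi⟩ = 1 := h.one _ rfl
  rw [Algebra.algebraMap_eq_smul_one, ← h1, ← map_smul, h.eq_zero_iff]
  have h2 := not_isInvertible_smul (γ := γ) hr
  rwa [← map_one θ] at h2

@[elab_as_elim]
theorem induction {p : X → Prop} (ξ : X) (hπ : ∀ x a, p (π x a))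
    (hadd : ∀ ξ ξ', p ξ → p ξ' → p (ξ + ξ')) : p ξ := by
  have h1 : ξ ∈ ⨆ x, LinearMap.range (π x) := by rw [h.iSup_range]; trivial
  induction h1 using Submodule.iSup_induction' with
  | mem x ξ hξ => obtain ⟨a, rfl⟩ := hξ; exact hπ x a
  | zero => simpa using hπ 1 0
  | add ξ ξ' _ _ h1 h2 => exact hadd _ _ h1 h2

theorem exists_sum_eq (ξ : X) :
    ∃ (s : Finset E) (a : ∀ x, γ.intertwiner (θ x)), ξ = ∑ x ∈ s, π x (a x) := by
  classical
  have h1 : ξ ∈ ⨆ x, LinearMap.range (π x) := by rw [h.iSup_range]; trivial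
  obtain ⟨f, hf⟩ := (Submodule.mem_iSup_iff_exists_dfinsupp' _ _).1 h1
  have h2 : ∀ x, ∃ a, π x a = f x := fun x => (f x).2
  choose a ha using h2
  refine ⟨f.support, a, ?_⟩
  rw [← hf]
  simp [DFinsupp.sum, ha]

end grading

section functoriality

variable {A' : Type*} [Ring A'] [Algebra O A'] {𝔅 : GradedInterior O d A'}
  {ε : GradedEmbedding 𝔅 𝔄} {γ' : 𝔅.Point} {γ : 𝔄.Point} (hi : ε.f γ'.i = γ.i)
  {E E' X X' : Type*} [Group E] [Group E'] [Ring X] [Algebra O X] [Ring X'] [Algebra O X']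
  {θ : E →* MulAut P × Γ} {θ' : E' →* MulAut P × Γ} {π : ∀ x, γ.intertwiner (θ x) →ₗ[O] X}
  {π' : ∀ x, γ'.intertwiner (θ' x) →ₗ[O] X'}

/-- The image of an intertwiner under an embedding. -/
theorem map_mem {σ : E' →* E} (hσ : ∀ x, θ (σ x) = θ' x) {x : E'} (a : γ'.intertwiner (θ' x))
    (hi : ε.f γ'.i = γ.i) : ε.f a ∈ γ.intertwiner (θ (σ x)) := by
  rw [hσ]
  exact (GradedEmbedding.map_mem_intertwiner_iff hi).2 a.2

include hi in
/-- An embedding and a homomorphism of groups of degrees induce a homomorphism of residual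
algebras. -/
theorem exists_algHom (h' : IsResidual γ' θ' π') (h : IsResidual γ θ π) (σ : E' →* E)
    (hσ : ∀ x, θ (σ x) = θ' x) :
    ∃ Φ : X' →ₐ[O] X, ∀ x a, Φ (π' x a) = π (σ x) ⟨ε.f a, map_mem hσ a hi⟩ := by
  classical
  -- the map on the component of degree `x`
  let g : ∀ x, γ'.intertwiner (θ' x) →ₗ[O] X := fun x => (π (σ x)).comp
    ({ toFun := fun a => ⟨ε.f a, map_mem hσ a hi⟩
       map_add' := fun a b => Subtype.ext (map_add ε.f _ _)
       map_smul' := fun r a => Subtype.ext (by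
         change ε.f (r • (a : A')) = r • ε.f a
         rw [map_smul]) } : γ'.intertwiner (θ' x) →ₗ[O] γ.intertwiner (θ (σ x)))
  have hker : ∀ x, LinearMap.ker (π' x) ≤ LinearMap.ker (g x) := by
    intro x a ha
    rw [LinearMap.mem_ker, h'.eq_zero_iff] at ha
    rw [LinearMap.mem_ker]
    change π (σ x) ⟨ε.f a, _⟩ = 0
    rw [h.eq_zero_iff]
    change ¬ γ.IsInvertible (θ (σ x)) (ε.f a)
    rw [hσ, GradedEmbedding.isInvertible_map_iff hi]
    exact ha
  let k : ∀ x, LinearMap.range (π' x) →ₗ[O] X := fun x =>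
    ((LinearMap.ker (π' x)).liftQ (g x) (hker x)).comp (π' x).quotKerEquivRange.symm.toLinearMap
  have hk : ∀ x a, k x ⟨π' x a, a, rfl⟩ = π (σ x) ⟨ε.f a, map_mem hσ a hi⟩ := by
    intro x a
    have h1 : (π' x).quotKerEquivRange.symm ⟨π' x a, a, rfl⟩ = Submodule.Quotient.mk a := by
      rw [LinearEquiv.symm_apply_eq]
      rfl
    change (LinearMap.ker (π' x)).liftQ (g x) (hker x) ((π' x).quotKerEquivRange.symm _) = _
    rw [h1]
    rfl
  let e := LinearEquiv.ofBijective (DirectSum.coeLinearMap fun x => LinearMap.range (π' x))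
    h'.isInternal
  let Φ : X' →ₗ[O] X := (DirectSum.toModule O E' X k).comp e.symm.toLinearMap
  have hΦ : ∀ x a, Φ (π' x a) = π (σ x) ⟨ε.f a, map_mem hσ a hi⟩ := by
    intro x a
    have h1 : e.symm (π' x a) = DirectSum.lof O E' (fun x => LinearMap.range (π' x)) x
        ⟨π' x a, a, rfl⟩ := by
      rw [LinearEquiv.symm_apply_eq]
      exact (DirectSum.coeLinearMap_lof (fun x => LinearMap.range (π' x))
        x ⟨π' x a, a, rfl⟩).symm
    change DirectSum.toModule O E' X k (e.symm _) = _
    rw [h1, DirectSum.toModule_lof, hk]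
  have hi' : γ'.i ∈ γ'.intertwiner (θ' 1) := by rw [map_one]; exact i_mem_intertwiner
  refine ⟨AlgHom.ofLinearMap Φ ?_ ?_, hΦ⟩
  · have h0 : ∀ z (hz : z = 1) (a : γ.intertwiner (θ z)), (a : A) = γ.i → π z a = 1 := by
      rintro _ rfl a ha
      exact h.one a ha
    rw [← h'.one ⟨γ'.i, hi'⟩ rfl, hΦ]
    exact h0 _ (map_one σ) _ hi
  · intro ξ ξ'
    induction ξ using h'.induction with
    | hadd ξ₁ ξ₂ h1 h2 => rw [add_mul, map_add, map_add, add_mul, h1, h2]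
    | hπ x a =>
      induction ξ' using h'.induction with
      | hadd ξ₁ ξ₂ h1 h2 => rw [mul_add, map_add, map_add, mul_add, h1, h2]
      | hπ y b =>
        have hab : (a : A') * b ∈ γ'.intertwiner (θ' (x * y)) := by
          rw [map_mul]; exact mul_mem_intertwiner a.2 b.2
        have h0 : ∀ z (hz : z = σ x * σ y) (c : γ.intertwiner (θ z)), (c : A) = ε.f a * ε.f b →
            π z c = π (σ x) ⟨ε.f a, map_mem hσ a hi⟩ * π (σ y) ⟨ε.f b, map_mem hσ b hi⟩ := by
          rintro _ rfl c hc
          exact h.mul _ _ _ _ _ hc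
        rw [← h'.mul x y a b ⟨_, hab⟩ rfl, hΦ, hΦ, hΦ]
        exact h0 _ (map_mul σ x y) _ (map_mul ε.f _ _)

variable {σ : E' →* E} (hσ : ∀ x, θ (σ x) = θ' x) (h' : IsResidual γ' θ' π')
  (h : IsResidual γ θ π) {Φ : X' →ₐ[O] X}
  (hΦ : ∀ x a, Φ (π' x a) = π (σ x) ⟨ε.f a, map_mem hσ a hi⟩)
include hΦ

theorem map_range (x : E') :
    (LinearMap.range (π' x)).map Φ.toLinearMap = LinearMap.range (π (σ x)) := by
  ext ξ
  constructor
  · rintro ⟨_, ⟨a, rfl⟩, rfl⟩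
    exact ⟨_, (hΦ x a).symm⟩
  · rintro ⟨⟨b, hb⟩, rfl⟩
    obtain ⟨a, rfl⟩ := GradedEmbedding.exists_map_eq hi (i_mul hb) (mul_i hb)
    have ha : a ∈ γ'.intertwiner (θ' x) := by
      rw [hσ] at hb
      exact (GradedEmbedding.map_mem_intertwiner_iff hi).1 hb
    exact ⟨_, ⟨⟨a, ha⟩, rfl⟩, hΦ x ⟨a, ha⟩⟩

include h' h

theorem injective (hinj : Function.Injective σ) : Function.Injective Φ := by
  classical
  rw [injective_iff_map_eq_zero]
  intro ξ hξ
  obtain ⟨s, a, rfl⟩ := h'.exists_sum_eq ξ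
  refine Finset.sum_eq_zero fun x hx => ?_
  rw [map_sum] at hξ
  simp only [hΦ] at hξ
  -- the images have distinct degrees
  let b : ∀ y, γ.intertwiner (θ y) := fun y =>
    if hy : ∃ x, σ x = y then hy.choose_spec ▸ ⟨ε.f (a hy.choose), map_mem hσ _ hi⟩ else 0
  have hb : ∀ x, b (σ x) = ⟨ε.f (a x), map_mem hσ _ hi⟩ := by
    intro x
    have hy : ∃ x', σ x' = σ x := ⟨x, rfl⟩
    have key : ∀ (x' : E') (e : σ x' = σ x), (e ▸ (⟨ε.f (a x'), map_mem hσ _ hi⟩ :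
        γ.intertwiner (θ (σ x'))) : γ.intertwiner (θ (σ x))) =
          ⟨ε.f (a x), map_mem hσ _ hi⟩ := by
      intro x' e
      obtain rfl := hinj e
      rfl
    simp only [b, dif_pos hy]
    exact key _ hy.choose_spec
  have h1 := h.indep (s.map ⟨σ, hinj⟩) b (by
    rw [Finset.sum_map]
    rw [← hξ]
    exact Finset.sum_congr rfl fun x _ => by
      change π (σ x) (b (σ x)) = _
      rw [hb]) (σ x) (Finset.mem_map_of_mem ⟨σ, hinj⟩ hx)
  rw [hb, h.eq_zero_iff] at h1
  change ¬ γ.IsInvertible (θ (σ x)) (ε.f (a x)) at h1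
  rw [hσ, GradedEmbedding.isInvertible_map_iff hi] at h1
  exact (h'.eq_zero_iff _ _).2 h1

omit h' in
theorem surjective (hsurj : Function.Surjective σ) : Function.Surjective Φ := by
  intro ξ
  induction ξ using h.induction with
  | hadd ξ₁ ξ₂ h1 h2 =>
    obtain ⟨ζ₁, rfl⟩ := h1
    obtain ⟨ζ₂, rfl⟩ := h2
    exact ⟨ζ₁ + ζ₂, map_add _ _ _⟩
  | hπ y b =>
    obtain ⟨x, rfl⟩ := hsurj y
    have h1 : π (σ x) b ∈ (LinearMap.range (π' x)).map Φ.toLinearMap := by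
      rw [map_range hi hσ hΦ]
      exact ⟨b, rfl⟩
    obtain ⟨ζ, -, h2⟩ := h1
    exact ⟨ζ, h2⟩

end functoriality

end IsResidual

end residualAlgebra

/-! ### The residual algebra of `ℱ` -/

section residualFusion

open GradedInterior.Point

variable {O P Γ A : Type*} [CommRing O] [Group P] [Group Γ] {d : P →* Γ} [Ring A] [Algebra O A]
  {𝔄 : GradedInterior O d A} {γ : 𝔄.Point}

namespace FAlg

theorem exists_coeff_mul_eq_sum (h h' : FAlg γ) (φ : fusionGroup γ) :
    ∃ s : Finset (fusionGroup γ),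
      (h * h').coeff φ = ∑ ψ ∈ s, h.coeff ψ * h'.coeff (ψ⁻¹ * φ) := by
  obtain ⟨s, hs⟩ := h.exists_sum_eq
  refine ⟨s, ?_⟩
  conv_lhs => rw [← hs]
  rw [Finset.sum_mul, coeff_sum]
  exact Finset.sum_congr rfl fun ψ _ => coeff_fusionMul_mul ψ _ h' φ

/-- A homogeneous element of `ℱ` given by an invertible element is invertible. -/
theorem exists_mul_fusionMul_eq_one {φ : fusionGroup γ} (y : γ.intertwiner φ.1)
    (h : γ.IsInvertible φ.1 y) : ∃ h' : FAlg γ, h' * fusionMul γ φ y = 1 := by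
  classical
  obtain ⟨b, hb, -, h2⟩ := h
  refine ⟨fusionMul γ φ⁻¹ ⟨b, hb⟩, ext_coeff fun ψ => ?_⟩
  rw [coeff_fusionMul_mul, coeff_fusionMul, coeff_one, inv_inv]
  by_cases h3 : ψ = 1
  · subst h3
    simp [h2]
  · simp [h3]

theorem fusionMul_coeff_eq_zero_or (h : FAlg γ) (φ ψ : fusionGroup γ) :
    (fusionMul γ φ ⟨h.coeff φ, h.coeff_mem φ⟩).coeff ψ = h.coeff ψ ∨
      (fusionMul γ φ ⟨h.coeff φ, h.coeff_mem φ⟩).coeff ψ = 0 := by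
  classical
  rw [coeff_fusionMul]
  split_ifs with h1
  · subst h1
    exact Or.inl rfl
  · exact Or.inr rfl

variable (hγ : IsLocalIdempotent γ.elt)
include hγ

theorem not_isInvertible_coeff_mul_of_right (h : FAlg γ) {h' : FAlg γ}
    (H : ∀ φ : fusionGroup γ, ¬ γ.IsInvertible φ.1 (h'.coeff φ)) (φ : fusionGroup γ) :
    ¬ γ.IsInvertible φ.1 ((h * h').coeff φ) := by
  intro hu
  obtain ⟨s, hs⟩ := exists_coeff_mul_eq_sum h h' φ
  have key : ∀ ψ : fusionGroup γ, φ.1 = ψ.1 * (ψ⁻¹ * φ : fusionGroup γ).1 := fun ψ => by simp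
  rw [hs] at hu
  obtain ⟨ψ, -, h1⟩ := exists_isInvertible_of_sum hγ s _ (fun ψ _ => by
    rw [key ψ]; exact mul_mem_intertwiner (h.coeff_mem ψ) (h'.coeff_mem _)) hu
  rw [key ψ] at h1
  exact H _ (isInvertible_of_mul_right hγ (h.coeff_mem ψ) (h'.coeff_mem _) h1)

theorem not_isInvertible_coeff_mul_of_left {h : FAlg γ} (h' : FAlg γ)
    (H : ∀ φ : fusionGroup γ, ¬ γ.IsInvertible φ.1 (h.coeff φ)) (φ : fusionGroup γ) :
    ¬ γ.IsInvertible φ.1 ((h * h').coeff φ) := by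
  intro hu
  obtain ⟨s, hs⟩ := exists_coeff_mul_eq_sum h h' φ
  have key : ∀ ψ : fusionGroup γ, φ.1 = ψ.1 * (ψ⁻¹ * φ : fusionGroup γ).1 := fun ψ => by simp
  rw [hs] at hu
  obtain ⟨ψ, -, h1⟩ := exists_isInvertible_of_sum hγ s _ (fun ψ _ => by
    rw [key ψ]; exact mul_mem_intertwiner (h.coeff_mem ψ) (h'.coeff_mem _)) hu
  rw [key ψ] at h1
  exact H _ (isInvertible_of_mul_left hγ (h.coeff_mem ψ) (h'.coeff_mem _) h1)

/-- The elements of `ℱ` without invertible coefficients, as a left ideal. -/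
def nonunitIdeal : Ideal (FAlg γ) where
  carrier := {h | ∀ φ : fusionGroup γ, ¬ γ.IsInvertible φ.1 (h.coeff φ)}
  add_mem' {h h'} H H' φ hu := by
    rw [coeff_add] at hu
    rcases isInvertible_of_add hγ (h.coeff_mem φ) (h'.coeff_mem φ) hu with h1 | h1
    · exact H φ h1
    · exact H' φ h1
  zero_mem' φ := by rw [coeff_zero]; exact not_isInvertible_zero
  smul_mem' h h' H := not_isInvertible_coeff_mul_of_right hγ h H

theorem mem_nonunitIdeal {h : FAlg γ} : h ∈ nonunitIdeal hγ ↔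
    ∀ φ : fusionGroup γ, ¬ γ.IsInvertible φ.1 (h.coeff φ) := Iff.rfl

theorem nonunitIdeal_ne_top : nonunitIdeal hγ ≠ ⊤ := by
  classical
  intro h
  have h1 : (1 : FAlg γ) ∈ nonunitIdeal hγ := by rw [h]; trivial
  refine (mem_nonunitIdeal hγ).1 h1 1 ?_
  rw [coeff_one, if_pos rfl]
  exact ⟨γ.i, by rw [OneMemClass.coe_one, inv_one]; exact i_mem_intertwiner, γ.idem, γ.idem⟩

theorem isGradedLeftIdeal_nonunitIdeal : IsGradedLeftIdeal (fComp γ) (nonunitIdeal hγ) := by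
  intro h hh
  obtain ⟨s, hs⟩ := h.exists_sum_eq
  rw [← hs]
  refine Ideal.sum_mem _ fun φ _ => Ideal.subset_span ⟨fun ψ hu => ?_, φ, fusionMul_mem_fComp φ _⟩
  rcases h.fusionMul_coeff_eq_zero_or φ ψ with h1 | h1
  · rw [h1] at hu
    exact hh ψ hu
  · rw [h1] at hu
    exact not_isInvertible_zero hu

theorem le_nonunitIdeal {I : Ideal (FAlg γ)} (hI : IsGradedLeftIdeal (fComp γ) I) (hI' : I ≠ ⊤) :
    I ≤ nonunitIdeal hγ := by
  refine hI.trans (Ideal.span_le.2 ?_)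
  rintro h ⟨hh, φ, hφ⟩
  rw [mem_fComp_iff] at hφ
  have h1 : ¬ γ.IsInvertible φ.1 (h.coeff φ) := by
    intro hu
    obtain ⟨h', h1⟩ := exists_mul_fusionMul_eq_one ⟨h.coeff φ, h.coeff_mem φ⟩ hu
    rw [← hφ] at h1
    exact hI' ((Ideal.eq_top_iff_one I).2 (h1 ▸ I.mul_mem_left h' hh))
  intro ψ hu
  classical
  rw [hφ, coeff_fusionMul] at hu
  split_ifs at hu with h2
  · subst h2
    exact h1 hu
  · exact not_isInvertible_zero hu

/-- Since `iB^Pi` is local, the graded radical of `ℱ` is its only maximal graded left ideal, which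
consists of the elements without invertible coefficients. -/
theorem mem_gradedJacobson_iff {h : FAlg γ} : h ∈ gradedJacobson (fComp γ) ↔
    ∀ φ : fusionGroup γ, ¬ γ.IsInvertible φ.1 (h.coeff φ) := by
  have hmax : IsMaxGradedLeftIdeal (fComp γ) (nonunitIdeal hγ) :=
    ⟨⟨isGradedLeftIdeal_nonunitIdeal hγ, nonunitIdeal_ne_top hγ⟩,
      fun J hJ _ => le_nonunitIdeal hγ hJ.1 hJ.2⟩
  have hdef : h ∈ gradedJacobson (fComp γ) ↔
      ∀ I : Ideal (FAlg γ), IsMaxGradedLeftIdeal (fComp γ) I → ∀ s, h * s ∈ I := by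
    rw [gradedJacobson, TwoSidedIdeal.mem_mk']
    rfl
  rw [hdef]
  constructor
  · intro H
    have := H _ hmax 1
    rwa [mul_one] at this
  · intro H I hI s
    have h1 : I = nonunitIdeal hγ :=
      le_antisymm (le_nonunitIdeal hγ hI.1.1 hI.1.2)
        (hI.2 hmax.1 (le_nonunitIdeal hγ hI.1.1 hI.1.2))
    rw [h1]
    exact not_isInvertible_coeff_mul_of_left hγ s H

end FAlg

variable (γ) in
/-- The projections onto the residual algebra of `ℱ` from the components of `ℱ`. -/
noncomputable def fusionProj (φ : fusionGroup γ) :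
    γ.intertwiner ((fusionGroup γ).subtype φ) →ₗ[O] FBar γ :=
  (toFBar γ).toLinearMap.comp (fusionMul γ φ)

theorem range_fusionProj (φ : fusionGroup γ) :
    LinearMap.range (fusionProj γ φ) = fBarComp γ φ := by
  ext ξ
  constructor
  · rintro ⟨y, rfl⟩
    exact ⟨_, FAlg.fusionMul_mem_fComp φ y, rfl⟩
  · rintro ⟨h, hh, rfl⟩
    exact ⟨_, congrArg (toFBar γ) (FAlg.mem_fComp_iff.1 hh).symm⟩

theorem toFBar_eq_zero_iff (hγ : IsLocalIdempotent γ.elt) {h : FAlg γ} : toFBar γ h = 0 ↔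
    ∀ φ : fusionGroup γ, ¬ γ.IsInvertible φ.1 (h.coeff φ) := by
  rw [← FAlg.mem_gradedJacobson_iff hγ]
  exact Ideal.Quotient.eq_zero_iff_mem.trans TwoSidedIdeal.mem_asIdeal

theorem isResidual_fusionProj (hγ : IsLocalIdempotent γ.elt) :
    IsResidual γ (fusionGroup γ).subtype (fusionProj γ) := by
  classical
  have hzero : ∀ φ (y : γ.intertwiner φ.1),
      toFBar γ (fusionMul γ φ y) = 0 ↔ ¬ γ.IsInvertible φ.1 y := by
    intro φ y
    rw [toFBar_eq_zero_iff hγ]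
    constructor
    · intro H
      have := H φ
      rwa [FAlg.coeff_fusionMul, if_pos rfl] at this
    · intro H ψ
      rw [FAlg.coeff_fusionMul]
      split_ifs with h1
      · subst h1; exact H
      · exact not_isInvertible_zero
  have hone : ∀ a : γ.intertwiner (1 : fusionGroup γ).1, (a : A) = γ.i →
      toFBar γ (fusionMul γ 1 a) = 1 := by
    intro a ha
    rw [← map_one (toFBar γ)]
    congr 1
    refine FAlg.ext_coeff fun φ => ?_
    rw [FAlg.coeff_fusionMul, FAlg.coeff_one]
    simp only [ha, eq_comm]
  have hmul : ∀ (φ ψ : fusionGroup γ) (a : γ.intertwiner φ.1) (b : γ.intertwiner ψ.1)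
      (c : γ.intertwiner (φ * ψ).1), (c : A) = a * b →
      toFBar γ (fusionMul γ (φ * ψ) c)
        = toFBar γ (fusionMul γ φ a) * toFBar γ (fusionMul γ ψ b) := by
    intro φ ψ a b c hc
    rw [← map_mul]
    congr 1
    refine FAlg.ext_coeff fun χ => ?_
    rw [FAlg.coeff_fusionMul_mul, FAlg.coeff_fusionMul, FAlg.coeff_fusionMul]
    have h1 : ψ = φ⁻¹ * χ ↔ φ * ψ = χ := eq_inv_mul_iff_mul_eq
    simp only [h1]
    split_ifs
    · exact hc
    · simp
  have hindep : ∀ (s : Finset (fusionGroup γ)) (a : ∀ φ : fusionGroup γ, γ.intertwiner φ.1),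
      ∑ φ ∈ s, toFBar γ (fusionMul γ φ (a φ)) = 0 →
      ∀ φ ∈ s, toFBar γ (fusionMul γ φ (a φ)) = 0 := by
    intro s a hs φ hφ
    rw [← map_sum, toFBar_eq_zero_iff hγ] at hs
    refine (hzero φ (a φ)).2 ?_
    have := hs φ
    rw [FAlg.coeff_sum] at this
    simpa [FAlg.coeff_fusionMul, hφ] using this
  refine ⟨hone, hmul, hzero, ?_, hindep⟩
  rw [eq_top_iff]
  rintro ξ -
  obtain ⟨h, rfl⟩ := Ideal.Quotient.mk_surjective ξ
  obtain ⟨s, hs⟩ := h.exists_sum_eq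
  change toFBar γ h ∈ _
  rw [← hs, map_sum]
  exact Submodule.sum_mem _ fun φ _ => Submodule.mem_iSup_of_mem φ ⟨_, rfl⟩

end residualFusion

/-! ### Endomorphisms of induced modules -/

section cliffordMul

variable {O Γ S S₁ T : Type*} [CommRing O] [Group Γ] [Ring S] [Algebra O S] [Ring S₁] [Ring T]
  (ι : S₁ →+* S) (q : S₁ →+* T) (i : S₁)

theorem toQuot_eq_zero_iff {s : S} : toQuot ι q s = 0 ↔ s ∈ kerIdeal ι q :=
  Ideal.Quotient.eq_zero_iff_mem.trans TwoSidedIdeal.mem_asIdeal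

theorem toQuot_smul (r : O) (s : S) : toQuot ι q (r • s) = r • toQuot ι q s := rfl

theorem toQuot_of_ker {s : S₁} (hs : q s = 0) : toQuot ι q (ι s) = 0 :=
  (toQuot_eq_zero_iff ι q).2 (TwoSidedIdeal.subset_span ⟨s, hs, rfl⟩)

theorem inducedMk_eq_smul (s : S) :
    inducedMk ι q i s (headGen q i) = toQuot ι q s • inducedMk ι q i 1 (headGen q i) := by
  change _ = Submodule.Quotient.mk ((toQuot ι q s * toQuot ι q 1) ⊗ₜ[ℤ] headGen q i)
  rw [map_one, mul_one]
  rfl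

theorem inducedMk_smul (s : S) (t : S₁) (v : HeadModule q i) :
    inducedMk ι q i s (q t • v) = inducedMk ι q i (s * ι t) v := by
  refine Eq.symm ((Submodule.Quotient.eq _).2 (Submodule.subset_span ⟨toQuot ι q s, t, v, ?_⟩))
  rw [map_mul]

variable {q} (hq : Function.Surjective q)
include hq

theorem exists_smul_headGen (v : HeadModule q i) : ∃ t, v = q t • headGen q i := by
  obtain ⟨t, ht⟩ := Ideal.mem_span_singleton'.1 v.2
  obtain ⟨t, rfl⟩ := hq t
  exact ⟨t, Subtype.ext ht.symm⟩

theorem exists_eq_smul_gen (m : InducedModule ι q i) :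
    ∃ s, m = toQuot ι q s • inducedMk ι q i 1 (headGen q i) := by
  obtain ⟨m, rfl⟩ := Submodule.Quotient.mk_surjective _ m
  induction m using TensorProduct.induction_on with
  | zero => exact ⟨0, by rw [map_zero, zero_smul]; rfl⟩
  | add m m' h h' =>
    obtain ⟨s, hs⟩ := h
    obtain ⟨s', hs'⟩ := h'
    exact ⟨s + s', by rw [Submodule.Quotient.mk_add, hs, hs', map_add, add_smul]⟩
  | tmul r v =>
    obtain ⟨s, rfl⟩ := Ideal.Quotient.mk_surjective r
    obtain ⟨t, rfl⟩ := exists_smul_headGen i hq v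
    refine ⟨s * ι t, ?_⟩
    rw [← inducedMk_eq_smul, ← inducedMk_smul]
    rfl

/-- The homomorphism `T → R` induced by `ι`. -/
noncomputable def quotLift : T →+* QuotAlgebra ι q :=
  q.liftOfSurjective hq ⟨(toQuot ι q).comp ι, fun _ hs => toQuot_of_ker ι q hs⟩

theorem quotLift_apply (s : S₁) : quotLift ι hq (q s) = toQuot ι q (ι s) :=
  RingHom.liftOfRightInverse_comp_apply q _ (Function.rightInverse_surjInv hq)
    ⟨(toQuot ι q).comp ι, fun _ hs => toQuot_of_ker ι q hs⟩ s

/-- The map `R ⊗_T V → R`, `r ⊗ v ↦ rv`, which identifies `R ⊗_T V` with `Rq(i)`. -/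
noncomputable def inducedToQuot : InducedModule ι q i →ₗ[QuotAlgebra ι q] QuotAlgebra ι q :=
  Submodule.liftQ _ (TensorProduct.AlgebraTensorModule.lift
    { toFun := fun r =>
        { toFun := fun v => r * quotLift ι hq v
          map_add' := fun v w => by rw [Submodule.coe_add, map_add, mul_add]
          map_smul' := fun n v => by
            rw [Submodule.coe_smul_of_tower, map_zsmul, mul_smul_comm, eq_intCast, Int.cast_id] }
      map_add' := fun r r' => LinearMap.ext fun v => add_mul _ _ _
      map_smul' := fun a r => LinearMap.ext fun v => mul_assoc _ _ _ }) (by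
    rw [inducedRel, Submodule.span_le]
    rintro _ ⟨r, s, v, rfl⟩
    change TensorProduct.AlgebraTensorModule.lift _ _ = 0
    rw [map_sub, TensorProduct.AlgebraTensorModule.lift_tmul,
      TensorProduct.AlgebraTensorModule.lift_tmul, sub_eq_zero]
    change r * toQuot ι q (ι s) * quotLift ι hq v = r * quotLift ι hq (q s * v)
    rw [map_mul, quotLift_apply, mul_assoc])

theorem inducedToQuot_gen :
    inducedToQuot ι i hq (inducedMk ι q i 1 (headGen q i)) = toQuot ι q (ι i) := by
  change toQuot ι q 1 * quotLift ι hq (q i) = _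
  rw [map_one, one_mul, quotLift_apply]

variable (hi : i * i = i)
include hi

omit hq in
theorem toQuot_smul_gen : toQuot ι q (ι i) • inducedMk ι q i 1 (headGen q i)
    = inducedMk ι q i 1 (headGen q i) := by
  have h : q i • headGen q i = headGen q i := Subtype.ext (by
    change q i * q i = q i
    rw [← map_mul, hi])
  rw [← inducedMk_eq_smul]
  conv_rhs => rw [← h, inducedMk_smul, one_mul]

theorem smul_gen_eq_zero_iff (s : S) :
    toQuot ι q s • inducedMk ι q i 1 (headGen q i) = 0 ↔ s * ι i ∈ kerIdeal ι q := by
  rw [← toQuot_eq_zero_iff, map_mul]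
  constructor
  · intro h
    have h1 := congrArg (inducedToQuot ι i hq) h
    rwa [map_smul, inducedToQuot_gen, map_zero, smul_eq_mul] at h1
  · intro h
    rw [← toQuot_smul_gen ι i hi, smul_smul, h, zero_smul]

end cliffordMul

namespace CliffordEnd

variable {O Γ S S₁ T : Type*} [CommRing O] [Group Γ] [Ring S] [Algebra O S] [Ring S₁] [Ring T]
  {ι : S₁ →+* S} {q : S₁ →+* T} {i : S₁} (hq : Function.Surjective q) (hi : i * i = i)

theorem toEnd_mul (φ ψ : CliffordEnd ι q i) : (φ * ψ).toEnd = ψ.toEnd * φ.toEnd := rfl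

include hq in
theorem ext_gen {φ ψ : CliffordEnd ι q i} (h : φ.toEnd (inducedMk ι q i 1 (headGen q i))
    = ψ.toEnd (inducedMk ι q i 1 (headGen q i))) : φ = ψ := by
  refine MulOpposite.unop_injective (LinearMap.ext fun m => ?_)
  obtain ⟨s, rfl⟩ := exists_eq_smul_gen ι i hq m
  change φ.toEnd _ = ψ.toEnd _
  rw [map_smul, map_smul, h]

variable (O ι i) in
/-- The endomorphism of `R ⊗_T V ≃ Rq(i)` given by the right multiplication by `isi`. -/
noncomputable def mulRight : S →ₗ[O] CliffordEnd ι q i where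
  toFun s := MulOpposite.op ((LinearMap.toSpanSingleton _ _
    (toQuot ι q s • inducedMk ι q i 1 (headGen q i))).comp (inducedToQuot ι i hq))
  map_add' s t := MulOpposite.unop_injective (LinearMap.ext fun m => by
    let g := inducedMk ι q i 1 (headGen q i)
    let r := inducedToQuot ι i hq m
    change r • toQuot ι q (s + t) • g = r • toQuot ι q s • g + r • toQuot ι q t • g
    rw [map_add, add_smul, smul_add])
  map_smul' c s := MulOpposite.unop_injective (LinearMap.ext fun m => by
    let g := inducedMk ι q i 1 (headGen q i)
    let r := inducedToQuot ι i hq m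
    change r • toQuot ι q (c • s) • g = c • r • toQuot ι q s • g
    rw [toQuot_smul, smul_assoc, smul_comm])

theorem mulRight_gen (s : S) :
    (mulRight O ι i hq s).toEnd (inducedMk ι q i 1 (headGen q i))
      = toQuot ι q (ι i * s) • inducedMk ι q i 1 (headGen q i) := by
  change inducedToQuot ι i hq (inducedMk ι q i 1 (headGen q i)) •
    toQuot ι q s • inducedMk ι q i 1 (headGen q i) = _
  rw [inducedToQuot_gen, smul_smul, map_mul]

theorem isRightMulBy_iff {φ : CliffordEnd ι q i} {s : S} (hs : ι i * s = s) :
    IsRightMulBy ι q i φ s ↔ φ = mulRight O ι i hq s := by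
  rw [IsRightMulBy, inducedMk_eq_smul ι q i s]
  constructor
  · intro h
    exact ext_gen hq (by rw [mulRight_gen, hs, h])
  · rintro rfl
    rw [mulRight_gen, hs]

include hi

theorem eq_mulRight_of_gen {φ : CliffordEnd ι q i} {s : S}
    (h : φ.toEnd (inducedMk ι q i 1 (headGen q i)) = inducedMk ι q i s (headGen q i)) :
    φ = mulRight O ι i hq s := by
  refine ext_gen hq ?_
  rw [mulRight_gen, map_mul, mul_smul, ← inducedMk_eq_smul, ← h, ← map_smul,
    toQuot_smul_gen ι i hi]

theorem mulRight_eq_zero_iff {s : S} :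
    mulRight O ι i hq s = 0 ↔ ι i * s * ι i ∈ kerIdeal ι q := by
  rw [← smul_gen_eq_zero_iff ι i hq hi, ← mulRight_gen (O := O) hq]
  constructor
  · intro h
    rw [h]
    rfl
  · intro h
    refine ext_gen hq ?_
    rw [h]
    rfl

omit hi in
theorem mulRight_mul (s t : S) :
    mulRight O ι i hq s * mulRight O ι i hq t = mulRight O ι i hq (s * ι i * t) := by
  refine ext_gen hq ?_
  rw [toEnd_mul, Module.End.mul_apply, mulRight_gen, map_smul, mulRight_gen, mulRight_gen,
    smul_smul, ← map_mul]
  simp only [mul_assoc]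

theorem mulRight_one : mulRight O ι i hq 1 = 1 := by
  refine ext_gen hq ?_
  rw [mulRight_gen, mul_one, toQuot_smul_gen ι i hi]
  rfl

section grading

variable {comp : Γ → Submodule O S} (hι : ∀ s, ι s ∈ comp 1)
  (hmul : ∀ x y a b, a ∈ comp x → b ∈ comp y → a * b ∈ comp (x * y))
include hι hmul

omit hi in
include hq in
theorem mem_inducedComp_iff {x : Γ} {m : InducedModule ι q i} :
    m ∈ inducedComp comp ι q i x ↔ ∃ s ∈ comp x, m = inducedMk ι q i s (headGen q i) := by
  constructor
  · intro h
    induction h using Submodule.span_induction with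
    | mem m hm =>
      obtain ⟨s, hs, v, rfl⟩ := hm
      obtain ⟨t, rfl⟩ := exists_smul_headGen i hq v
      have h1 := hmul _ _ _ _ hs (hι t)
      rw [mul_one] at h1
      exact ⟨_, h1, inducedMk_smul ι q i _ _ _⟩
    | zero => exact ⟨0, zero_mem _, by rw [inducedMk_eq_smul, map_zero, zero_smul]⟩
    | add m m' _ _ h h' =>
      obtain ⟨s, hs, rfl⟩ := h
      obtain ⟨s', hs', rfl⟩ := h'
      refine ⟨s + s', add_mem hs hs', ?_⟩
      rw [inducedMk_eq_smul _ _ _ s, inducedMk_eq_smul _ _ _ s', inducedMk_eq_smul _ _ _ (s + s'),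
        map_add, add_smul]
    | smul r m _ h =>
      obtain ⟨s, hs, rfl⟩ := h
      refine ⟨r • s, Submodule.smul_mem _ r hs, ?_⟩
      rw [inducedMk_eq_smul _ _ _ s, inducedMk_eq_smul _ _ _ (r • s), toQuot_smul, smul_assoc]
  · rintro ⟨s, hs, rfl⟩
    exact Submodule.subset_span ⟨s, hs, _, rfl⟩

theorem map_mulRight (x : Γ) :
    (comp x).map (mulRight O ι i hq) = cliffordComp comp ι q i x := by
  ext φ
  constructor
  · rintro ⟨s, hs, rfl⟩ y m hm
    obtain ⟨t, ht, rfl⟩ := (mem_inducedComp_iff hq hι hmul).1 hm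
    refine (mem_inducedComp_iff hq hι hmul).2 ⟨t * (ι i * s), hmul _ _ _ _ ht ?_, ?_⟩
    · have h1 := hmul _ _ _ _ (hι i) hs
      rwa [one_mul] at h1
    · rw [inducedMk_eq_smul _ _ _ t, map_smul, mulRight_gen, smul_smul, ← map_mul,
        ← inducedMk_eq_smul]
  · intro hφ
    have h1 : inducedMk ι q i 1 (headGen q i) ∈ inducedComp comp ι q i 1 :=
      (mem_inducedComp_iff hq hι hmul).2 ⟨1, by simpa using hι 1, rfl⟩
    obtain ⟨s, hs, h2⟩ := (mem_inducedComp_iff hq hι hmul).1 (hφ 1 _ h1)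
    rw [one_mul] at hs
    exact ⟨s, hs, (eq_mulRight_of_gen hq hi h2).symm⟩

end grading

end CliffordEnd

/-! ### Crossed products and intertwiners -/

section crossed

open GradedInterior.Point

variable {G O A A' T : Type*} [Group G] [CommRing O] [Ring A] [Algebra O A]
  [Ring A'] [Algebra O A'] [Ring T] {H : Subgroup G} [H.Normal]
  {𝔄 : GradedInterior O (QuotientGroup.mk' H) A} {P : Subgroup G}
  {𝔅 : GradedInterior O ((QuotientGroup.mk' H).comp P.subtype) A'}
  (ε : GradedEmbedding 𝔅 (𝔄.res P)) (N : Subgroup (Subgroup.normalizer (P : Set G)))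
  {γ : 𝔅.Point} {q : 𝔅.fixed →+* T}

variable (H P) in
/-- The homomorphism `g ↦ (c_g, ḡ)` from `N_G(P)` to `Aut(P) × G/H`. -/
def conjDegree : Subgroup.normalizer (P : Set G) →* MulAut P × (G ⧸ H) :=
  P.normalizerMonoidHom.prod ((QuotientGroup.mk' H).comp (Subgroup.subtype _))

theorem conjDegree_fst (g : Subgroup.normalizer (P : Set G)) (u : P) :
    (((conjDegree H P g).1 u : P) : G) = g * u * (g : G)⁻¹ := rfl

theorem conjDegree_snd (g : Subgroup.normalizer (P : Set G)) :
    (conjDegree H P g).2 = QuotientGroup.mk' H (g : G) := rfl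

theorem conjDegree_eq_one_iff {g : Subgroup.normalizer (P : Set G)} :
    conjDegree H P g = 1 ↔ g ∈ centralizerIn H P := by
  rw [centralizerIn, Subgroup.mem_subgroupOf, Subgroup.mem_inf, Prod.ext_iff, and_comm]
  refine and_congr (QuotientGroup.eq_one_iff _) ?_
  rw [← Subgroup.mem_subgroupOf, ← Subgroup.normalizerMonoidHom_ker]
  rfl

variable (H P) in
/-- The homomorphism from `E = N / C_H(P)` to `Aut(P) × G/H` induced by `g ↦ (c_g, ḡ)`. -/
def eDegree : EGroup H P N →* MulAut P × (G ⧸ H) :=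
  QuotientGroup.lift _ ((conjDegree H P).comp N.subtype) fun _ hg =>
    conjDegree_eq_one_iff.2 (Subgroup.mem_subgroupOf.1 hg)

theorem eDegree_toE (g : N) : eDegree H P N (toE H P N g) = conjDegree H P g := rfl

theorem eDegree_injective : Function.Injective (eDegree H P N) := by
  rw [injective_iff_map_eq_one]
  intro x hx
  obtain ⟨g, rfl⟩ := toE_surjective H P N x
  rw [eDegree_toE, conjDegree_eq_one_iff] at hx
  exact (QuotientGroup.eq_one_iff g).2 (Subgroup.mem_subgroupOf.2 hx)

/-- In the corner of `i`, the elements of `e(B^Pg)e` are the intertwiners for `(c_g, ḡ)`. -/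
theorem mem_fineComp_iff (g : Subgroup.normalizer (P : Set G)) {y : A'} (h1 : γ.i * y = y)
    (h2 : y * γ.i = y) : y ∈ fineComp ε (g : G) ↔ y ∈ γ.intertwiner (conjDegree H P g) := by
  have hg1 : (𝔄.str (g : G) : A) * (𝔄.str (g : G)⁻¹ : A) = 1 := by simp
  have hg2 : (𝔄.str (g : G)⁻¹ : A) * (𝔄.str (g : G) : A) = 1 := by simp
  have hconj : ∀ u : P, (𝔄.str (((conjDegree H P g).1 u : P) : G) : A)
      = (𝔄.str (g : G) : A) * (𝔄.str u : A) * (𝔄.str (g : G)⁻¹ : A) := fun u => by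
    rw [conjDegree_fst]
    simp
  rw [mem_fineComp, GradedInterior.mem_fixed, mem_intertwiner]
  constructor
  · rintro ⟨h3, h4⟩
    refine ⟨h1, h2, ε.mem_comp_of_map ?_, fun u => ε.injective ?_⟩
    · have h5 : ε.f y * (𝔄.str (g : G)⁻¹ : A) * (𝔄.str (g : G) : A)
          ∈ 𝔄.comp (1 * QuotientGroup.mk' H (g : G)) := 𝔄.graded.mul_mem h3 (𝔄.str_mem g)
      rwa [mul_assoc, hg2, mul_one, one_mul] at h5
    · rw [ε.map_str_mul, ε.map_mul_str]
      have h5 : (𝔄.str (((conjDegree H P g).1 u : P) : G) : A) *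
          (ε.f y * (𝔄.str (g : G)⁻¹ : A)) = ε.f y * (𝔄.str (g : G)⁻¹ : A) *
            (𝔄.str (((conjDegree H P g).1 u : P) : G) : A) := h4 ((conjDegree H P g).1 u)
      change (𝔄.str (((conjDegree H P g).1 u : P) : G) : A) * ε.f y = ε.f y * (𝔄.str u : A)
      calc _ = (𝔄.str (((conjDegree H P g).1 u : P) : G) : A) *
            (ε.f y * (𝔄.str (g : G)⁻¹ : A)) * (𝔄.str (g : G) : A) := by
            rw [mul_assoc, mul_assoc (ε.f y), hg2, mul_one]
        _ = ε.f y * ((𝔄.str (g : G)⁻¹ : A) * (𝔄.str (g : G) : A)) * (𝔄.str u : A) *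
            ((𝔄.str (g : G)⁻¹ : A) * (𝔄.str (g : G) : A)) := by
            rw [h5, hconj]
            simp only [mul_assoc]
        _ = _ := by rw [hg2, mul_one, mul_one]
  · rintro ⟨-, -, h3, h4⟩
    refine ⟨?_, fun u => ?_⟩
    · have h5 : ε.f y * (𝔄.str (g : G)⁻¹ : A) ∈ 𝔄.comp _ :=
        𝔄.graded.mul_mem (ε.map_comp _ _ h3) (𝔄.str_mem (g : G)⁻¹)
      rwa [conjDegree_snd, ← map_mul, mul_inv_cancel, map_one] at h5
    · obtain ⟨v, rfl⟩ := (conjDegree H P g).1.surjective u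
      have h5 := congrArg ε.f (h4 v)
      rw [ε.map_str_mul, ε.map_mul_str] at h5
      have h6 : (𝔄.str (((conjDegree H P g).1 v : P) : G) : A) * ε.f y
        = ε.f y * (𝔄.str v : A) := h5
      change (𝔄.str (((conjDegree H P g).1 v : P) : G) : A) * (ε.f y * (𝔄.str (g : G)⁻¹ : A))
        = ε.f y * (𝔄.str (g : G)⁻¹ : A) * (𝔄.str (((conjDegree H P g).1 v : P) : G) : A)
      calc _ = ε.f y * (𝔄.str v : A) * (𝔄.str (g : G)⁻¹ : A) := by rw [← mul_assoc, h6]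
        _ = ε.f y * ((𝔄.str (g : G)⁻¹ : A) * (𝔄.str (g : G) : A)) * (𝔄.str v : A) *
            (𝔄.str (g : G)⁻¹ : A) := by rw [hg2, mul_one]
        _ = _ := by rw [hconj]; simp only [mul_assoc]

theorem mem_crossedComp_iff (x : EGroup H P N) {y : A'} (h1 : γ.i * y = y) (h2 : y * γ.i = y) :
    y ∈ crossedComp ε N x ↔ y ∈ γ.intertwiner (eDegree H P N x) := by
  rw [mem_crossedComp]
  constructor
  · intro h
    obtain ⟨g, rfl⟩ := toE_surjective H P N x
    exact (mem_fineComp_iff ε _ h1 h2).1 (h g rfl)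
  · rintro h g rfl
    exact (mem_fineComp_iff ε _ h1 h2).2 h

theorem intertwiner_le_crossedComp (x : EGroup H P N) :
    γ.intertwiner (eDegree H P N x) ≤ crossedComp ε N x :=
  fun _ hy => (mem_crossedComp_iff ε N x (i_mul hy) (mul_i hy)).2 hy

theorem crossedComp_mul {x y : EGroup H P N} {a b : A'} (ha : a ∈ crossedComp ε N x)
    (hb : b ∈ crossedComp ε N y) : a * b ∈ crossedComp ε N (x * y) := by
  refine (mem_crossedComp ε N).2 fun g hg => ?_
  obtain ⟨h, rfl⟩ := toE_surjective H P N x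
  have h1 := (mem_crossedComp ε N).1 ha h rfl
  have h2 := (mem_crossedComp ε N).1 hb (h⁻¹ * g) (by
    rw [map_mul, hg, map_inv]
    exact inv_mul_cancel_left _ _)
  have h3 := fineComp_mul ε (h : Subgroup.normalizer (P : Set G)).2 h1 h2
  simpa using h3

theorem crossedComp_one {a : A'} : a ∈ crossedComp ε N 1 ↔ a ∈ 𝔅.fixed := by
  refine ⟨fun h => ?_, crossedComp_of_fixed ε N⟩
  have h1 := (mem_crossedComp ε N).1 h 1 (map_one _)
  rw [mem_fineComp] at h1
  exact ε.mem_fixed_of_map (by simpa using h1)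

theorem corner_mem_intertwiner {x : EGroup H P N} {a : A'} (ha : a ∈ crossedComp ε N x) :
    γ.i * a * γ.i ∈ γ.intertwiner (eDegree H P N x) := by
  have hi := crossedComp_of_fixed ε N γ.mem
  refine (mem_crossedComp_iff ε N x ?_ ?_).1 ?_
  · rw [← mul_assoc, ← mul_assoc, γ.idem]
  · rw [mul_assoc, γ.idem]
  · have := crossedComp_mul ε N (crossedComp_mul ε N hi ha) hi
    rwa [one_mul, mul_one] at this

/-- An element of `e(B^Pg)e`, as an element of degree `x` of the crossed product. -/
noncomputable def crossedSingle (x : EGroup H P N) :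
    crossedComp ε N x →ₗ[O] crossedProduct ε N where
  toFun a := ⟨MonoidAlgebra.single x (a : A'), fun y => by
    classical
    rw [MonoidAlgebra.coeff_single, Finsupp.single_apply]
    split_ifs with h
    · exact h ▸ a.2
    · exact zero_mem _⟩
  map_add' a b := Subtype.ext (MonoidAlgebra.single_add _ _ _)
  map_smul' r a := Subtype.ext (MonoidAlgebra.smul_single _ _ _).symm

theorem coe_crossedSingle (x : EGroup H P N) (a : crossedComp ε N x) :
    (crossedSingle ε N x a : MonoidAlgebra A' (EGroup H P N)) = MonoidAlgebra.single x (a : A') :=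
  rfl

theorem crossedSingle_mul {x y : EGroup H P N} (a : crossedComp ε N x) (b : crossedComp ε N y) :
    crossedSingle ε N x a * crossedSingle ε N y b
      = crossedSingle ε N (x * y) ⟨a * b, crossedComp_mul ε N a.2 b.2⟩ :=
  Subtype.ext (MonoidAlgebra.single_mul_single _ _ _ _)

theorem crossedOne_mul_crossedSingle (c : 𝔅.fixed) {x : EGroup H P N} (a : crossedComp ε N x)
    (b : crossedComp ε N x) (h : (b : A') = c * a) :
    crossedOne ε N c * crossedSingle ε N x a = crossedSingle ε N x b :=
  Subtype.ext (by
    refine (MonoidAlgebra.single_mul_single _ _ _ _).trans ?_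
    rw [one_mul, ← h]
    rfl)

theorem crossedSingle_mul_crossedOne (c : 𝔅.fixed) {x : EGroup H P N} (a : crossedComp ε N x)
    (b : crossedComp ε N x) (h : (b : A') = a * c) :
    crossedSingle ε N x a * crossedOne ε N c = crossedSingle ε N x b :=
  Subtype.ext (by
    refine (MonoidAlgebra.single_mul_single _ _ _ _).trans ?_
    rw [mul_one, ← h]
    rfl)

theorem crossedProduct_eq_sum (s : crossedProduct ε N) :
    s = ∑ x ∈ (s : MonoidAlgebra A' (EGroup H P N)).coeff.support,
      crossedSingle ε N x ⟨(s : MonoidAlgebra A' (EGroup H P N)).coeff x, s.2 x⟩ := by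
  apply Subtype.ext
  rw [AddSubmonoidClass.coe_finsetSum]
  exact (MonoidAlgebra.sum_coeff_single _).symm

@[elab_as_elim]
theorem crossedProduct_induction {p : crossedProduct ε N → Prop} (s : crossedProduct ε N)
    (h0 : p 0) (hs : ∀ x a, p (crossedSingle ε N x a)) (hadd : ∀ s t, p s → p t → p (s + t)) :
    p s := by
  rw [crossedProduct_eq_sum ε N s]
  exact Finset.sum_induction _ p hadd h0 fun x _ => hs x _

section kernel

variable (γ)

/-- No multiple `asᵧb` of a component of `s` by homogeneous elements `a` and `b` becomes invertible
in the corner of `i`. Since the sums of non-invertible intertwiners of the same degree are not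
invertible, these `s` form a two-sided ideal, which contains the ideal generated by `ker q`. -/
def IsNegligible (s : crossedProduct ε N) : Prop :=
  ∀ x y z, ∀ a ∈ crossedComp ε N x, ∀ b ∈ crossedComp ε N z,
    ¬ γ.IsInvertible (eDegree H P N (x * y * z))
      (γ.i * (a * (s : MonoidAlgebra A' (EGroup H P N)).coeff y * b) * γ.i)

variable {γ} (hγ : IsLocalIdempotent γ.elt)
include hγ

theorem IsNegligible.add {s t : crossedProduct ε N} (hs : IsNegligible ε N γ s)
    (ht : IsNegligible ε N γ t) : IsNegligible ε N γ (s + t) := by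
  intro x y z a ha b hb h
  have h1 : γ.i * (a * ((s + t : crossedProduct ε N) : MonoidAlgebra A' (EGroup H P N)).coeff y * b)
        * γ.i
      = γ.i * (a * (s : MonoidAlgebra A' (EGroup H P N)).coeff y * b) * γ.i
        + γ.i * (a * (t : MonoidAlgebra A' (EGroup H P N)).coeff y * b) * γ.i := by
    rw [Subalgebra.coe_add, MonoidAlgebra.coeff_add, Finsupp.add_apply]
    noncomm_ring
  rw [h1] at h
  have hmem : ∀ r : crossedProduct ε N,
      a * (r : MonoidAlgebra A' (EGroup H P N)).coeff y * b ∈ crossedComp ε N (x * y * z) :=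
    fun r => crossedComp_mul ε N (crossedComp_mul ε N ha (r.2 y)) hb
  rcases isInvertible_of_add hγ (corner_mem_intertwiner ε N (hmem s))
    (corner_mem_intertwiner ε N (hmem t)) h with h2 | h2
  · exact hs x y z a ha b hb h2
  · exact ht x y z a ha b hb h2

omit hγ in
theorem IsNegligible.zero : IsNegligible ε N γ 0 := by
  intro x y z a _ b _ h
  refine not_isInvertible_zero (γ := γ) (φ := eDegree H P N (x * y * z)) ?_
  simpa using h

theorem IsNegligible.mul_left (t : crossedProduct ε N) {s : crossedProduct ε N}
    (hs : IsNegligible ε N γ s) : IsNegligible ε N γ (t * s) := by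
  induction t using crossedProduct_induction with
  | h0 => rw [zero_mul]; exact IsNegligible.zero ε N
  | hadd t t' h h' => rw [add_mul]; exact h.add ε N hγ h'
  | hs u t =>
    intro x y z a ha b hb h
    refine hs (x * u) (u⁻¹ * y) z (a * t) (crossedComp_mul ε N ha t.2) b hb ?_
    rw [Subalgebra.coe_mul, coe_crossedSingle, MonoidAlgebra.coeff_single_mul_apply,
      ← mul_assoc a] at h
    rwa [show x * u * (u⁻¹ * y) * z = x * y * z by group]

theorem IsNegligible.mul_right {s : crossedProduct ε N} (t : crossedProduct ε N)
    (hs : IsNegligible ε N γ s) : IsNegligible ε N γ (s * t) := by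
  induction t using crossedProduct_induction with
  | h0 => rw [mul_zero]; exact IsNegligible.zero ε N
  | hadd t t' h h' => rw [mul_add]; exact h.add ε N hγ h'
  | hs u t =>
    intro x y z a ha b hb h
    refine hs x (y * u⁻¹) (u * z) a ha (t * b) (crossedComp_mul ε N t.2 hb) ?_
    rw [Subalgebra.coe_mul, coe_crossedSingle, MonoidAlgebra.coeff_mul_single_apply,
      ← mul_assoc a, mul_assoc _ (t : A')] at h
    rwa [show x * (y * u⁻¹) * (u * z) = x * y * z by group]

variable (hN : N ≤ embeddedPointNormalizer ε γ)
  (hqi : ∀ a : 𝔅.fixed, γ.elt * a = a → a * γ.elt = a → (q a = 0 ↔ ¬ CornerUnit γ.elt a))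
include hN

omit hγ in
/-- There are invertible intertwiners in all degrees belonging to `N`. -/
theorem exists_isInvertible (x : EGroup H P N) :
    ∃ u ∈ γ.intertwiner (eDegree H P N x), ∃ v ∈ γ.intertwiner (eDegree H P N x)⁻¹,
      u * v = γ.i ∧ v * u = γ.i := by
  obtain ⟨g, rfl⟩ := toE_surjective H P N x
  obtain ⟨u, hu, v, hv, h1, h2, h3, h4⟩ := hN g.2
  have h5 : u * γ.i = u := by rw [← h2, ← mul_assoc, h1, h3]
  have h6 : v * γ.i = v := by rw [← h1, ← mul_assoc, h2, h4]
  rw [← map_inv, ← map_inv, eDegree_toE, eDegree_toE]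
  exact ⟨u, (mem_fineComp_iff ε _ h3 h5).1 hu, v,
    (mem_fineComp_iff ε (g⁻¹ : Subgroup.normalizer (P : Set G)) h4 h6).1 hv, h1, h2⟩

include hqi

omit hγ in
/-- If `i(acb)i` were invertible, with homogeneous `a` and `b`, the multiplication by invertible
intertwiners would yield a factorization of `i` in `B'^P` that contains `c`, hence `q(i) = 0`. -/
theorem isNegligible_crossedOne {c : 𝔅.fixed} (hc : q c = 0) :
    IsNegligible ε N γ (crossedOne ε N c) := by
  classical
  rintro x y z a ha b hb ⟨w, hw, h1, -⟩
  by_cases hy : y = 1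
  swap
  · refine γ.ne_zero ?_
    rw [← h1]
    change γ.i * (a * (MonoidAlgebra.single (1 : EGroup H P N) (c : A')).coeff y * b) * γ.i * w = 0
    rw [MonoidAlgebra.coeff_single, Finsupp.single_apply, if_neg (Ne.symm hy)]
    simp
  · subst hy
    obtain ⟨u, hu, v, hv, -, huv⟩ := exists_isInvertible ε N hN x
    have h2 : γ.i * (a * c * b) * γ.i * w = γ.i := by
      refine Eq.trans ?_ h1
      change _ = γ.i * (a * (MonoidAlgebra.single (1 : EGroup H P N) (c : A')).coeff 1 * b)
        * γ.i * w
      rw [MonoidAlgebra.coeff_single, Finsupp.single_apply, if_pos rfl]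
    rw [← map_inv] at hv hw
    have hva : v * a ∈ 𝔅.fixed := by
      have := crossedComp_mul ε N (intertwiner_le_crossedComp ε N _ hv) ha
      rw [inv_mul_cancel] at this
      exact (crossedComp_one ε N).1 this
    have hbw : b * (w * u) ∈ 𝔅.fixed := by
      have := crossedComp_mul ε N hb (crossedComp_mul ε N
        (intertwiner_le_crossedComp ε N _ hw) (intertwiner_le_crossedComp ε N _ hu))
      rw [show z * ((x * 1 * z)⁻¹ * x) = 1 by group] at this
      exact (crossedComp_one ε N).1 this
    have h3 : v * a * c * (b * (w * u)) = γ.i := by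
      calc v * a * c * (b * (w * u)) = (v * γ.i) * a * c * b * ((γ.i * w) * u) := by
            rw [mul_i hv, i_mul hw]
            simp only [mul_assoc]
        _ = v * (γ.i * (a * c * b) * γ.i * w) * u := by simp only [mul_assoc]
        _ = γ.i := by rw [h2, mul_i hv, huv]
    have h4 : (⟨v * a, hva⟩ * c * ⟨b * (w * u), hbw⟩ : 𝔅.fixed) = γ.elt := Subtype.ext h3
    have h5 : q γ.elt = 0 := by rw [← h4, map_mul, map_mul, hc, mul_zero, zero_mul]
    have h6 : γ.elt * γ.elt = γ.elt := Subtype.ext γ.idem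
    exact (hqi _ h6 h6).1 h5 ⟨γ.elt, h6, h6, h6, h6⟩

theorem isNegligible_of_mem_kerIdeal {s : crossedProduct ε N}
    (hs : s ∈ kerIdeal (crossedOne ε N) q) : IsNegligible ε N γ s := by
  let K : TwoSidedIdeal (crossedProduct ε N) := TwoSidedIdeal.mk' {s | IsNegligible ε N γ s}
    (IsNegligible.zero ε N) (fun h h' => h.add ε N hγ h')
    (fun {s} h => by
      have h1 : IsNegligible ε N γ (-1 * s) := IsNegligible.mul_left ε N hγ _ h
      have h2 : -1 * s = -s :=
        Subtype.ext (neg_one_mul (s : MonoidAlgebra A' (EGroup H P N)))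
      exact h2 ▸ h1)
    (fun {t s} h => IsNegligible.mul_left ε N hγ t h)
    (fun {s t} h => IsNegligible.mul_right ε N hγ t h)
  have hle : kerIdeal (crossedOne ε N) q ≤ K := by
    refine TwoSidedIdeal.span_le.2 ?_
    rintro _ ⟨c, hc, rfl⟩
    refine (TwoSidedIdeal.mem_mk' _ _ _ _ _ _ _).2 ?_
    exact isNegligible_crossedOne ε N hN hqi hc
  exact (TwoSidedIdeal.mem_mk' _ _ _ _ _ _ _).1 (hle hs)

theorem crossedSingle_mem_kerIdeal_iff {x : EGroup H P N}
    (a : γ.intertwiner (eDegree H P N x)) :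
    crossedSingle ε N x ⟨a, intertwiner_le_crossedComp ε N x a.2⟩ ∈ kerIdeal (crossedOne ε N) q ↔
      ¬ γ.IsInvertible (eDegree H P N x) a := by
  classical
  constructor
  · intro h hu
    have hi := crossedComp_of_fixed ε N γ.mem
    refine isNegligible_of_mem_kerIdeal ε N hγ hN hqi h 1 x 1 γ.i hi γ.i hi ?_
    rw [coe_crossedSingle, MonoidAlgebra.coeff_single, Finsupp.single_apply, if_pos rfl]
    simpa [i_mul a.2, mul_i a.2] using hu
  · intro h
    obtain ⟨u, hu, v, hv, -, h2⟩ := exists_isInvertible ε N hN x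
    have hav : (a : A') * v ∈ γ.intertwiner 1 := by
      have := mul_mem_intertwiner a.2 hv
      rwa [mul_inv_cancel] at this
    obtain ⟨h3, h4, h5⟩ := mem_intertwiner_one.1 hav
    have h6 : q ⟨a * v, h3⟩ = 0 := by
      refine (hqi ⟨a * v, h3⟩ (Subtype.ext h4) (Subtype.ext h5)).2 fun h6 => h ?_
      rw [cornerUnit_iff] at h6
      have h7 := mul_inv_cancel (eDegree H P N x)
      rw [← h7] at h6
      exact isInvertible_of_mul_left hγ a.2 hv h6
    rw [← crossedOne_mul_crossedSingle ε N ⟨a * v, h3⟩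
      ⟨u, intertwiner_le_crossedComp ε N x hu⟩ _ (by
        change (a : A') = a * v * u
        rw [mul_assoc, h2, mul_i a.2])]
    exact TwoSidedIdeal.mul_mem_right _ _ _ (TwoSidedIdeal.subset_span ⟨_, h6, rfl⟩)

end kernel

end crossed

/-! ### The residual algebras of crossed products -/

section residualCrossed

open GradedInterior.Point

variable {G O A A' T : Type*} [Group G] [CommRing O] [Ring A] [Algebra O A]
  [Ring A'] [Algebra O A'] [Ring T] {H : Subgroup G} [H.Normal]
  {𝔄 : GradedInterior O (QuotientGroup.mk' H) A} {P : Subgroup G}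
  {𝔅 : GradedInterior O ((QuotientGroup.mk' H).comp P.subtype) A'}
  (ε : GradedEmbedding 𝔅 (𝔄.res P)) (N : Subgroup (Subgroup.normalizer (P : Set G)))
  {γ : 𝔅.Point} {q : 𝔅.fixed →+* T} (hq : Function.Surjective q)

/-- The endomorphism of `(T * E) ⊗_T V` given by the right multiplication by an intertwiner. -/
noncomputable def crossedProj (x : EGroup H P N) :
    γ.intertwiner (eDegree H P N x) →ₗ[O] EndCrossed ε N γ q :=
  (CliffordEnd.mulRight O (crossedOne ε N) γ.elt hq).comp
    ((crossedSingle ε N x).comp (Submodule.inclusion (intertwiner_le_crossedComp ε N x)))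

theorem crossedProj_apply (x : EGroup H P N) (a : γ.intertwiner (eDegree H P N x)) :
    crossedProj ε N hq x a = CliffordEnd.mulRight O (crossedOne ε N) γ.elt hq
      (crossedSingle ε N x ⟨a, intertwiner_le_crossedComp ε N x a.2⟩) := rfl

theorem elt_mul_elt : γ.elt * γ.elt = γ.elt := Subtype.ext γ.idem

theorem mulRight_crossedSingle (x : EGroup H P N) (a : crossedComp ε N x) :
    CliffordEnd.mulRight O (crossedOne ε N) γ.elt hq (crossedSingle ε N x a)
      = crossedProj ε N hq x ⟨γ.i * a * γ.i, corner_mem_intertwiner ε N a.2⟩ := by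
  have hi := crossedComp_of_fixed ε N γ.mem
  have h1 : γ.i * (a : A') ∈ crossedComp ε N x := by
    have := crossedComp_mul ε N hi a.2
    rwa [one_mul] at this
  have h2 : crossedSingle ε N x ⟨γ.i * a * γ.i, intertwiner_le_crossedComp ε N x
      (corner_mem_intertwiner ε N a.2)⟩
      = 1 * crossedOne ε N γ.elt * crossedSingle ε N x a * crossedOne ε N γ.elt * 1 := by
    rw [one_mul, mul_one, crossedOne_mul_crossedSingle ε N γ.elt a ⟨_, h1⟩ rfl]
    exact (crossedSingle_mul_crossedOne ε N γ.elt ⟨_, h1⟩ _ rfl).symm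
  rw [crossedProj_apply, h2, ← CliffordEnd.mulRight_mul, ← CliffordEnd.mulRight_mul,
    CliffordEnd.mulRight_one hq elt_mul_elt, one_mul, mul_one]

theorem range_crossedProj (x : EGroup H P N) :
    LinearMap.range (crossedProj ε N hq x) = endCrossedComp ε N γ q x := by
  have hι : ∀ s, crossedOne ε N s ∈ externalComp (crossedProduct ε N) 1 := fun s => ⟨s, rfl⟩
  have hmul : ∀ x y a b, a ∈ externalComp (crossedProduct ε N) x →
      b ∈ externalComp (crossedProduct ε N) y →
      a * b ∈ externalComp (crossedProduct ε N) (x * y) := by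
    rintro x y a b ⟨a', ha⟩ ⟨b', hb⟩
    exact ⟨a' * b', by rw [Subalgebra.coe_mul, ha, hb, MonoidAlgebra.single_mul_single]⟩
  rw [endCrossedComp, ← CliffordEnd.map_mulRight hq elt_mul_elt hι hmul]
  ext φ
  constructor
  · rintro ⟨a, rfl⟩
    exact ⟨_, ⟨a, rfl⟩, rfl⟩
  · classical
    rintro ⟨s, ⟨a, ha⟩, rfl⟩
    have h1 : a ∈ crossedComp ε N x := by
      have := s.2 x
      rwa [ha, MonoidAlgebra.coeff_single, Finsupp.single_apply, if_pos rfl] at this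
    obtain rfl : s = crossedSingle ε N x ⟨a, h1⟩ := Subtype.ext ha
    exact ⟨_, (mulRight_crossedSingle ε N hq x _).symm⟩

/-- For homogeneous elements of the corner of `i`, to be induced by a right multiplication means to
be the projection of an intertwiner. -/
theorem isEndRightMulBy_iff {φ : EndCrossed ε N γ q} {x : EGroup H P N} {y : A'}
    (h1 : γ.i * y = y) (h2 : y * γ.i = y) : IsEndRightMulBy ε N γ q φ x y ↔
      ∃ hy : y ∈ γ.intertwiner (eDegree H P N x), φ = crossedProj ε N hq x ⟨y, hy⟩ := by
  classical
  have key : ∀ hy : y ∈ crossedComp ε N x, crossedOne ε N γ.elt * crossedSingle ε N x ⟨y, hy⟩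
      = crossedSingle ε N x ⟨y, hy⟩ :=
    fun hy => crossedOne_mul_crossedSingle ε N _ _ _ h1.symm
  constructor
  · rintro ⟨s, hs, h⟩
    have hy : y ∈ crossedComp ε N x := by
      have := s.2 x
      rwa [hs, MonoidAlgebra.coeff_single, Finsupp.single_apply, if_pos rfl] at this
    obtain rfl : s = crossedSingle ε N x ⟨y, hy⟩ := Subtype.ext hs
    exact ⟨(mem_crossedComp_iff ε N x h1 h2).1 hy,
      (CliffordEnd.isRightMulBy_iff (O := O) hq (key hy)).1 h⟩
  · rintro ⟨hy, rfl⟩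
    exact ⟨_, rfl, (CliffordEnd.isRightMulBy_iff (O := O) hq
      (key (intertwiner_le_crossedComp ε N x hy))).2 rfl⟩

/-- If all elements of `N` stabilize the point, and the kernel of `q` meets the local ring `iB'^Pi`
in its maximal ideal, then `End((T * E) ⊗_T V)ᵒᵖ` is residual. -/
theorem isResidual_crossedProj (hγ : IsLocalIdempotent γ.elt)
    (hN : N ≤ embeddedPointNormalizer ε γ)
    (hqi : ∀ a : 𝔅.fixed, γ.elt * a = a → a * γ.elt = a → (q a = 0 ↔ ¬ CornerUnit γ.elt a)) :
    IsResidual γ (eDegree H P N) (crossedProj (O := O) ε N hq) := by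
  classical
  have hcorner : ∀ x (a : γ.intertwiner (eDegree H P N x)),
      crossedOne ε N γ.elt * crossedSingle ε N x ⟨a, intertwiner_le_crossedComp ε N x a.2⟩ *
        crossedOne ε N γ.elt
      = crossedSingle ε N x ⟨a, intertwiner_le_crossedComp ε N x a.2⟩ := fun x a => by
    let a' : crossedComp ε N x := ⟨a, intertwiner_le_crossedComp ε N x a.2⟩
    rw [crossedOne_mul_crossedSingle ε N γ.elt a' a' (i_mul a.2).symm,
      crossedSingle_mul_crossedOne ε N γ.elt a' a' (mul_i a.2).symm]
  have hzero : ∀ x (a : γ.intertwiner (eDegree H P N x)),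
      crossedProj ε N hq x a = 0 ↔ ¬ γ.IsInvertible (eDegree H P N x) a := fun x a => by
    rw [crossedProj_apply, CliffordEnd.mulRight_eq_zero_iff hq elt_mul_elt, hcorner,
      crossedSingle_mem_kerIdeal_iff ε N hγ hN hqi]
  refine ⟨fun a ha => ?_, fun x y a b c hc => ?_, hzero, ?_, fun s a hs x hx => ?_⟩
  · have h1 : crossedSingle ε N 1 ⟨a, intertwiner_le_crossedComp ε N 1 a.2⟩
        = 1 * crossedOne ε N γ.elt * 1 := by
      rw [one_mul, mul_one]
      exact Subtype.ext (by rw [coe_crossedSingle, ha]; rfl)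
    rw [crossedProj_apply, h1, ← CliffordEnd.mulRight_mul,
      CliffordEnd.mulRight_one hq elt_mul_elt, one_mul]
  · let a' : crossedComp ε N x := ⟨a, intertwiner_le_crossedComp ε N x a.2⟩
    rw [crossedProj_apply, crossedProj_apply, crossedProj_apply, CliffordEnd.mulRight_mul,
      crossedSingle_mul_crossedOne ε N γ.elt a' a' (mul_i a.2).symm, crossedSingle_mul]
    congr 3
  · rw [eq_top_iff]
    rintro φ -
    obtain ⟨s, hs⟩ := exists_eq_smul_gen (crossedOne ε N) γ.elt hq
      (φ.toEnd (inducedMk (crossedOne ε N) q γ.elt 1 (headGen q γ.elt)))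
    rw [← inducedMk_eq_smul] at hs
    rw [CliffordEnd.eq_mulRight_of_gen (O := O) hq elt_mul_elt hs, crossedProduct_eq_sum ε N s,
      map_sum]
    refine Submodule.sum_mem _ fun x _ => Submodule.mem_iSup_of_mem x ?_
    rw [mulRight_crossedSingle]
    exact ⟨_, rfl⟩
  · simp only [crossedProj_apply] at hs
    rw [← map_sum, CliffordEnd.mulRight_eq_zero_iff hq elt_mul_elt, Finset.mul_sum,
      Finset.sum_mul, Finset.sum_congr rfl fun x _ => hcorner x (a x)] at hs
    rw [hzero]
    intro hu
    have hi := crossedComp_of_fixed ε N γ.mem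
    refine isNegligible_of_mem_kerIdeal ε N hγ hN hqi hs 1 x 1 γ.i hi γ.i hi ?_
    have h1 : ((∑ x ∈ s, crossedSingle ε N x ⟨a x, intertwiner_le_crossedComp ε N x (a x).2⟩ :
        crossedProduct ε N) : MonoidAlgebra A' (EGroup H P N)).coeff x = a x := by
      rw [AddSubmonoidClass.coe_finsetSum, MonoidAlgebra.coeff_sum, Finsupp.finsetSum_apply]
      simp only [coe_crossedSingle, MonoidAlgebra.coeff_single, Finsupp.single_apply]
      rw [Finset.sum_ite_eq' s x, if_pos hx]
    rw [h1]
    simpa [i_mul (a x).2, mul_i (a x).2] using hu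

end residualCrossed

/-! ### The quotients of `B^P` defined by a point -/

section quotients

variable {O L Γ A : Type*} [CommRing O] [Group L] [Group Γ] {d : L →* Γ} [Ring A]
  [Algebra O A] {𝔄 : GradedInterior O d A} (γ : 𝔄.Point)

theorem toSimpleQuotient_surjective : Function.Surjective (toSimpleQuotient γ) :=
  Ideal.Quotient.mk_surjective

theorem toSimpleQuotient_eq_zero_iff {γ : 𝔄.Point} (hγ : IsLocalIdempotent γ.elt) {a : 𝔄.fixed}
    (h1 : γ.elt * a = a) (h2 : a * γ.elt = a) :
    toSimpleQuotient γ a = 0 ↔ ¬ CornerUnit γ.elt a := by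
  rw [← hγ.mem_pointIdeal_iff_not_unit h1 h2]
  exact Ideal.Quotient.eq_zero_iff_mem.trans TwoSidedIdeal.mem_asIdeal

variable [IsLocalRing O]

theorem brauerMap_surjective : Function.Surjective (brauerMap 𝔄) :=
  Ideal.Quotient.mk_surjective

theorem toLocalQuotient_surjective {b : BrauerQuotient 𝔄} (hb : γ.IsBlock b) :
    Function.Surjective (toLocalQuotient γ hb) := by
  intro t
  obtain ⟨⟨_, c, rfl⟩, rfl⟩ := Ideal.Quotient.mk_surjective t
  obtain ⟨a, rfl⟩ := brauerMap_surjective c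
  exact ⟨a, rfl⟩

variable {γ} (hγ : IsLocalIdempotent γ.elt)
include hγ

theorem isLocalIdempotent_brauerMap (h : γ.IsLocal) : IsLocalIdempotent (brauerMap 𝔄 γ.elt) :=
  hγ.map _ brauerMap_surjective h

theorem toLocalQuotient_eq_zero_iff (h : γ.IsLocal) {b : BrauerQuotient 𝔄} (hb : γ.IsBlock b)
    {a : 𝔄.fixed} (h1 : γ.elt * a = a) (h2 : a * γ.elt = a) :
    toLocalQuotient γ hb a = 0 ↔ ¬ CornerUnit γ.elt a := by
  have h3 : b * brauerMap 𝔄 a * b = brauerMap 𝔄 a := by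
    rw [mul_assoc, ← hb.central, ← mul_assoc, hb.idem.eq, ← h1, map_mul, ← mul_assoc, hb.mul_eq]
  rw [← hγ.unit_map_iff _ brauerMap_surjective h h1 h2,
    ← (isLocalIdempotent_brauerMap hγ h).mem_pointIdeal_iff_not_unit (by rw [← map_mul, h1])
      (by rw [← map_mul, h2])]
  refine (Ideal.Quotient.eq_zero_iff_mem.trans TwoSidedIdeal.mem_asIdeal).trans ?_
  refine (TwoSidedIdeal.mem_mk' _ _ _ _ _ _ _).trans ?_
  change b * brauerMap 𝔄 a * b ∈ pointIdeal (brauerMap 𝔄 γ.elt) ↔ _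
  rw [h3]

end quotients

/-! ### Isomorphisms between residual algebras -/

namespace IsResidual

variable {O P Γ A : Type*} [CommRing O] [Group P] [Group Γ] {d : P →* Γ} [Ring A] [Algebra O A]
  {𝔄 : GradedInterior O d A} {A' : Type*} [Ring A'] [Algebra O A'] {𝔅 : GradedInterior O d A'}
  {ε : GradedEmbedding 𝔅 𝔄} {γ' : 𝔅.Point} {γ : 𝔄.Point}
  {E E' X X' : Type*} [Group E] [Group E'] [Ring X] [Algebra O X] [Ring X'] [Algebra O X']
  {θ : E →* MulAut P × Γ} {θ' : E' →* MulAut P × Γ} {π : ∀ x, γ.intertwiner (θ x) →ₗ[O] X}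
  {π' : ∀ x, γ'.intertwiner (θ' x) →ₗ[O] X'}

/-- Residual algebras of the same point, with different groups of degrees. -/
theorem exists_injective_algHom {X' : Type*} [Ring X'] [Algebra O X']
    {θ' : E' →* MulAut P × Γ} {π' : ∀ x, γ.intertwiner (θ' x) →ₗ[O] X'}
    (h' : IsResidual γ θ' π') (h : IsResidual γ θ π) (σ : E' →* E) (hinj : Function.Injective σ)
    (hσ : ∀ x, θ (σ x) = θ' x) :
    ∃ Φ : X' →ₐ[O] X, Function.Injective Φ ∧
      (∀ x, (LinearMap.range (π' x)).map Φ.toLinearMap = LinearMap.range (π (σ x))) ∧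
      ∀ x y (hy : y ∈ γ.intertwiner (θ' x)) (hy' : y ∈ γ.intertwiner (θ (σ x))),
        Φ (π' x ⟨y, hy⟩) = π (σ x) ⟨y, hy'⟩ := by
  have hi : (GradedEmbedding.refl 𝔄).f γ.i = γ.i := rfl
  obtain ⟨Φ, hΦ⟩ := exists_algHom hi h' h σ hσ
  exact ⟨Φ, injective hi hσ h' h hΦ hinj, map_range hi hσ hΦ, fun x y hy hy' => hΦ x ⟨y, hy⟩⟩

/-- Residual algebras of two points which correspond to each other under an embedding. -/
theorem exists_algEquiv (hi : ε.f γ'.i = γ.i) (h' : IsResidual γ' θ' π') (h : IsResidual γ θ π)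
    (τ : E ≃* E') (hτ : ∀ x, θ' (τ x) = θ x) :
    ∃ Ψ : X ≃ₐ[O] X',
      (∀ x, (LinearMap.range (π x)).map Ψ.toLinearMap = LinearMap.range (π' (τ x))) ∧
      ∀ x y (hy : ε.f y ∈ γ.intertwiner (θ x)) (hy' : y ∈ γ'.intertwiner (θ' (τ x))),
        Ψ (π x ⟨ε.f y, hy⟩) = π' (τ x) ⟨y, hy'⟩ := by
  have hσ : ∀ x, θ (τ.symm.toMonoidHom x) = θ' x := fun x => by
    change θ (τ.symm x) = θ' x
    rw [← hτ, τ.apply_symm_apply]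
  obtain ⟨Φ, hΦ⟩ := exists_algHom hi h' h τ.symm.toMonoidHom hσ
  let Φ' := AlgEquiv.ofBijective Φ
    ⟨injective hi hσ h' h hΦ τ.symm.injective, surjective hi hσ h hΦ τ.symm.surjective⟩
  have key : ∀ x y (hy : ε.f y ∈ γ.intertwiner (θ x)) (hy' : y ∈ γ'.intertwiner (θ' (τ x))),
      Φ'.symm (π x ⟨ε.f y, hy⟩) = π' (τ x) ⟨y, hy'⟩ := by
    intro x y hy hy'
    rw [AlgEquiv.symm_apply_eq]
    have h0 : ∀ z (_ : x = z) (hz : ε.f y ∈ γ.intertwiner (θ z)),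
        π x ⟨ε.f y, hy⟩ = π z ⟨ε.f y, hz⟩ := by
      rintro _ rfl _
      rfl
    rw [h0 _ (τ.symm_apply_apply x).symm (map_mem hσ ⟨y, hy'⟩ hi)]
    exact (hΦ (τ x) ⟨y, hy'⟩).symm
  refine ⟨Φ'.symm, fun x => ?_, key⟩
  ext ξ
  constructor
  · rintro ⟨_, ⟨⟨a, ha⟩, rfl⟩, rfl⟩
    obtain ⟨y, rfl⟩ := GradedEmbedding.exists_map_eq hi (GradedInterior.Point.i_mul ha)
      (GradedInterior.Point.mul_i ha)
    have hy : y ∈ γ'.intertwiner (θ' (τ x)) := by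
      rw [hτ]
      exact (GradedEmbedding.map_mem_intertwiner_iff hi).1 ha
    exact ⟨⟨y, hy⟩, (key x y ha hy).symm⟩
  · rintro ⟨⟨y, hy⟩, rfl⟩
    have ha : ε.f y ∈ γ.intertwiner (θ x) := by
      rw [← hτ]
      exact (GradedEmbedding.map_mem_intertwiner_iff hi).2 hy
    exact ⟨_, ⟨⟨_, ha⟩, rfl⟩, key x y ha hy⟩

/-- Residual algebras of the same point with the same degrees are isomorphic. -/
theorem exists_algEquiv_self {X' : Type*} [Ring X'] [Algebra O X']
    {π' : ∀ x, γ.intertwiner (θ x) →ₗ[O] X'}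
    (h : IsResidual γ θ π) (h' : IsResidual γ θ π') :
    ∃ Ψ : X ≃ₐ[O] X',
      (∀ x, (LinearMap.range (π x)).map Ψ.toLinearMap = LinearMap.range (π' x)) ∧
      ∀ x a, Ψ (π x a) = π' x a := by
  have hi : (GradedEmbedding.refl 𝔄).f γ.i = γ.i := rfl
  obtain ⟨Ψ, h1, h2⟩ := exists_algEquiv hi h' h (MulEquiv.refl E) fun _ => rfl
  exact ⟨Ψ, h1, fun x a => h2 x a a.2 a.2⟩

end IsResidual

/-! ### Local points and embeddings -/

section localPoint

variable {O L Γ A A' : Type*} [CommRing O] [IsLocalRing O] [Group L] [Group Γ] {d : L →* Γ}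
  [Ring A] [Algebra O A] [Ring A'] [Algebra O A']
  {𝔅 : GradedInterior O d A'} {𝔄 : GradedInterior O d A} (ε : GradedEmbedding 𝔅 𝔄)

/-- An embedding maps relative traces to relative traces, hence the kernel of the Brauer map to the
kernel of the Brauer map. -/
theorem GradedEmbedding.map_mem_brauerIdeal {a : 𝔅.fixed} (ha : a ∈ brauerIdeal 𝔅) :
    (⟨ε.f a, ε.map_fixed a.2⟩ : 𝔄.fixed) ∈ brauerIdeal 𝔄 := by
  let F : 𝔅.fixed → 𝔄.fixed := fun a => ⟨ε.f a, ε.map_fixed a.2⟩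
  let K : TwoSidedIdeal 𝔅.fixed := TwoSidedIdeal.mk' {a | F a ∈ brauerIdeal 𝔄}
    (by
      have h : F 0 = 0 := Subtype.ext (map_zero ε.f)
      change F 0 ∈ brauerIdeal 𝔄
      rw [h]; exact zero_mem _)
    (fun {a b} ha hb => by
      have h : F (a + b) = F a + F b := Subtype.ext (map_add ε.f _ _)
      change F (a + b) ∈ brauerIdeal 𝔄
      rw [h]; exact add_mem ha hb)
    (fun {a} ha => by
      have h : F (-a) = -F a := Subtype.ext (map_neg ε.f _)
      change F (-a) ∈ brauerIdeal 𝔄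
      rw [h]; exact neg_mem ha)
    (fun {a b} hb => by
      have h : F (a * b) = F a * F b := Subtype.ext (map_mul ε.f _ _)
      change F (a * b) ∈ brauerIdeal 𝔄
      rw [h]; exact TwoSidedIdeal.mul_mem_left _ _ _ hb)
    (fun {a b} ha => by
      have h : F (a * b) = F a * F b := Subtype.ext (map_mul ε.f _ _)
      change F (a * b) ∈ brauerIdeal 𝔄
      rw [h]; exact TwoSidedIdeal.mul_mem_right _ _ _ ha)
  have hle : brauerIdeal 𝔅 ≤ K := by
    refine TwoSidedIdeal.span_le.2 ?_
    rintro t (⟨Q, hQ, b, hb, ht⟩ | ⟨r, hr, rfl⟩)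
    · refine (TwoSidedIdeal.mem_mk' _ _ _ _ _ _ _).2 ?_
      refine TwoSidedIdeal.subset_span (Or.inl ⟨Q, hQ, ε.f b,
        ⟨ε.map_comp _ _ hb.1, fun u hu => ?_⟩, ?_⟩)
      · rw [← ε.map_str_mul, hb.2 u hu, ε.map_mul_str]
      · change ε.f t = _
        rw [ht]
        refine ((ε.f : A' →+ A).map_finsum_of_injective ε.injective _).trans ?_
        refine finsum_congr fun x => ?_
        change ε.f _ = _
        rw [ε.map_mul_str, ε.map_str_mul]
    · refine (TwoSidedIdeal.mem_mk' _ _ _ _ _ _ _).2 ?_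
      have h : F (algebraMap O 𝔅.fixed r) = algebraMap O 𝔄.fixed r * F 1 := Subtype.ext (by
        change ε.f (algebraMap O A' r) = algebraMap O A r * ε.f 1
        rw [Algebra.algebraMap_eq_smul_one, map_smul, ← Algebra.smul_def])
      change F _ ∈ brauerIdeal 𝔄
      rw [h]
      exact TwoSidedIdeal.mul_mem_right _ _ _ (TwoSidedIdeal.subset_span (Or.inr ⟨r, hr, rfl⟩))
  have h1 : a ∈ K := hle ha
  rw [TwoSidedIdeal.mem_mk'] at h1
  exact h1

variable {ε} {γ : 𝔄.Point} {γ' : 𝔅.Point}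

theorem brauerMap_eq_zero_iff {a : 𝔄.fixed} : brauerMap 𝔄 a = 0 ↔ a ∈ brauerIdeal 𝔄 :=
  Ideal.Quotient.eq_zero_iff_mem.trans TwoSidedIdeal.mem_asIdeal

theorem GradedEmbedding.isLocal (hi : ε.f γ'.i = γ.i) (h : γ.IsLocal) : γ'.IsLocal := by
  intro h0
  refine h (brauerMap_eq_zero_iff.2 ?_)
  have h1 := ε.map_mem_brauerIdeal (brauerMap_eq_zero_iff.1 h0)
  have h2 : (⟨ε.f γ'.elt, ε.map_fixed γ'.elt.2⟩ : 𝔄.fixed) = γ.elt := Subtype.ext hi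
  rwa [h2] at h1

theorem exists_isBlock [IsNoetherianRing O] [Module.Finite O A] (hγ : IsLocalIdempotent γ.elt)
    (h : γ.IsLocal) : ∃ b, γ.IsBlock b := by
  have h1 : IsNoetherianRing 𝔄.fixed := isNoetherian_of_tower O inferInstance
  have h2 : IsNoetherianRing (BrauerQuotient 𝔄) :=
    isNoetherianRing_of_surjective _ _ (brauerMap 𝔄) brauerMap_surjective
  exact exists_isBlockOf (isLocalIdempotent_brauerMap hγ h)

end localPoint

/-! ### Stabilizers of points -/

section stabilizer

open GradedInterior.Point

variable {G O A A' : Type*} [Group G] [CommRing O] [Ring A] [Algebra O A]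
  [Ring A'] [Algebra O A'] {H : Subgroup G} [H.Normal]
  {𝔄 : GradedInterior O (QuotientGroup.mk' H) A} {P : Subgroup G}
  {𝔅 : GradedInterior O ((QuotientGroup.mk' H).comp P.subtype) A'}
  (ε : GradedEmbedding 𝔅 (𝔄.res P)) {γ : 𝔅.Point}

theorem mem_embeddedPointNormalizer_iff {g : Subgroup.normalizer (P : Set G)} :
    g ∈ embeddedPointNormalizer ε γ ↔
      ∃ z ∈ γ.intertwiner (conjDegree H P g), γ.IsInvertible (conjDegree H P g) z := by
  constructor
  · rintro ⟨u, hu, v, hv, h1, h2, h3, h4⟩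
    have h5 : u * γ.i = u := by rw [← h2, ← mul_assoc, h1, h3]
    have h6 : v * γ.i = v := by rw [← h1, ← mul_assoc, h2, h4]
    refine ⟨u, (mem_fineComp_iff ε _ h3 h5).1 hu, v, ?_, h1, h2⟩
    rw [← map_inv]
    exact (mem_fineComp_iff ε g⁻¹ h4 h6).1 hv
  · rintro ⟨u, hu, v, hv, h1, h2⟩
    refine ⟨u, (mem_fineComp_iff ε _ (i_mul hu) (mul_i hu)).2 hu, v, ?_, h1, h2, i_mul hu, i_mul hv⟩
    rw [← map_inv] at hv
    exact (mem_fineComp_iff ε g⁻¹ (i_mul hv) (mul_i hv)).2 hv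

theorem embeddedPointNormalizer_eq {γ' : 𝔅.Point} {γ : (𝔄.res P).Point} (hi : ε.f γ'.i = γ.i) :
    embeddedPointNormalizer (GradedEmbedding.refl (𝔄.res P)) γ = embeddedPointNormalizer ε γ' := by
  ext g
  rw [mem_embeddedPointNormalizer_iff, mem_embeddedPointNormalizer_iff]
  constructor
  · rintro ⟨z, hz, h⟩
    obtain ⟨z, rfl⟩ := GradedEmbedding.exists_map_eq hi (i_mul hz) (mul_i hz)
    exact ⟨z, (GradedEmbedding.map_mem_intertwiner_iff hi).1 hz,
      (GradedEmbedding.isInvertible_map_iff hi).1 h⟩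
  · rintro ⟨z, hz, h⟩
    exact ⟨ε.f z, (GradedEmbedding.map_mem_intertwiner_iff hi).2 hz,
      (GradedEmbedding.isInvertible_map_iff hi).2 h⟩

/-- If `g` fixes `e`, then the invertible intertwiners of degree `g` correspond to the equivalences
between the idempotents `i` and `ᵍi` of `B'^P`; since `i` is local, equivalent idempotents are
conjugate. -/
theorem mem_embeddedPointNormalizer_iff_conj (hγ : IsLocalIdempotent γ.elt)
    (g : Subgroup.normalizer (P : Set G))
    (hg : (𝔄.str (g : G) : A) * ε.f 1 * (𝔄.str (g : G)⁻¹ : A) = ε.f 1) :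
    g ∈ embeddedPointNormalizer ε γ ↔
      ∃ a ∈ 𝔅.fixed, ∃ a' ∈ 𝔅.fixed, a * a' = 1 ∧ a' * a = 1 ∧
        (𝔄.str (g : G) : A) * ε.f γ.i * (𝔄.str (g : G)⁻¹ : A) = ε.f (a * γ.i * a') := by
  have hg1 : (𝔄.str (g : G) : A) * (𝔄.str (g : G)⁻¹ : A) = 1 := by simp
  have hg2 : (𝔄.str (g : G)⁻¹ : A) * (𝔄.str (g : G) : A) = 1 := by simp
  have he1 : (𝔄.str (g : G) : A) * ε.f 1 = ε.f 1 * (𝔄.str (g : G) : A) := by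
    conv_rhs => rw [← hg, mul_assoc, hg2, mul_one]
  have he2 : ε.f 1 * (𝔄.str (g : G)⁻¹ : A) = (𝔄.str (g : G)⁻¹ : A) * ε.f 1 := by
    conv_rhs => rw [← hg, ← mul_assoc, ← mul_assoc, hg2, one_mul]
  constructor
  · rintro ⟨z, hz, z', hz', h1, h2, h3, h4⟩
    have h6 : z' * γ.i = z' := by rw [← h1, ← mul_assoc, h2, h4]
    rw [mem_fineComp] at hz hz'
    rw [inv_inv] at hz'
    have hw' := conj_mem_fixed 𝔄 P g.2 hz'
    have e1 : (𝔄.str (g : G) : A) * (ε.f z' * (𝔄.str (g : G) : A)) * (𝔄.str (g : G)⁻¹ : A)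
        = (𝔄.str (g : G) : A) * ε.f z' := by
      rw [mul_assoc, mul_assoc, hg1, mul_one]
    rw [e1] at hw'
    obtain ⟨w, hw0⟩ := ε.range (ε.f z * (𝔄.str (g : G)⁻¹ : A))
      (by rw [← mul_assoc, ε.f_one_mul]) (by rw [mul_assoc, ← he2, ← mul_assoc, ε.mul_f_one])
    obtain ⟨w', hw0'⟩ := ε.range ((𝔄.str (g : G) : A) * ε.f z')
      (by rw [← mul_assoc, ← he1, mul_assoc, ε.f_one_mul]) (by rw [mul_assoc, ε.mul_f_one])
    rw [← hw0] at hz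
    rw [← hw0'] at hw'
    let W : 𝔅.fixed := ⟨w, ε.mem_fixed_of_map hz⟩
    let W' : 𝔅.fixed := ⟨w', ε.mem_fixed_of_map hw'⟩
    have k1 : w * w' = γ.i := ε.injective (by
      rw [map_mul, hw0, hw0', ← h1, map_mul]
      calc _ = ε.f z * ((𝔄.str (g : G)⁻¹ : A) * (𝔄.str (g : G) : A)) * ε.f z' := by
            simp only [mul_assoc]
        _ = _ := by rw [hg2, mul_one])
    have k2 : γ.i * w = w := ε.injective (by rw [map_mul, hw0, ← mul_assoc, ← map_mul, h3])
    have k3 : w' * γ.i = w' := ε.injective (by rw [map_mul, hw0', mul_assoc, ← map_mul, h6])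
    have k4 : ε.f (w' * w) = (𝔄.str (g : G) : A) * ε.f γ.i * (𝔄.str (g : G)⁻¹ : A) := by
      rw [map_mul, hw0, hw0', ← h2, map_mul]
      simp only [mul_assoc]
    have hj : W' * W * (W' * W) = W' * W := Subtype.ext (by
      change w' * w * (w' * w) = w' * w
      calc _ = w' * (w * w') * w := by simp only [mul_assoc]
        _ = _ := by rw [k1, k3])
    obtain ⟨u, u', l1, l2, l3⟩ := exists_conj_of_equiv hγ hj (Subtype.ext k1 : W * W' = γ.elt) rfl
      (Subtype.ext k2) (Subtype.ext k3)
    refine ⟨u', u'.2, u, u.2, congrArg Subtype.val l2, congrArg Subtype.val l1, ?_⟩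
    rw [← k4]
    have l4 : u' * γ.elt * u = W' * W := by rw [mul_assoc, l3, ← mul_assoc, l2, one_mul]
    exact congrArg ε.f (congrArg Subtype.val l4).symm
  · rintro ⟨a, ha, a', ha', h1, h2, h3⟩
    have h4 : (𝔄.str (g : G) : A) * ε.f γ.i = ε.f (a * γ.i * a') * (𝔄.str (g : G) : A) := by
      rw [← h3, mul_assoc _ _ (𝔄.str (g : G) : A), hg2, mul_one]
    have h5 : ε.f γ.i * (𝔄.str (g : G)⁻¹ : A) = (𝔄.str (g : G)⁻¹ : A) * ε.f (a * γ.i * a') := by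
      rw [← h3, ← mul_assoc, ← mul_assoc, hg2, one_mul]
    obtain ⟨z, hz⟩ := ε.range (ε.f (γ.i * a') * (𝔄.str (g : G) : A))
      (by rw [← mul_assoc, ε.f_one_mul]) (by rw [mul_assoc, he1, ← mul_assoc, ε.mul_f_one])
    obtain ⟨z', hz'⟩ := ε.range ((𝔄.str (g : G)⁻¹ : A) * ε.f (a * γ.i))
      (by rw [← mul_assoc, he2, mul_assoc, ε.f_one_mul]) (by rw [mul_assoc, ε.mul_f_one])
    refine ⟨z, ?_, z', ?_, ε.injective ?_, ε.injective ?_, ε.injective ?_, ε.injective ?_⟩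
    · rw [mem_fineComp, hz, mul_assoc, hg1, mul_one]
      exact ε.map_fixed (mul_mem γ.mem ha')
    · rw [mem_fineComp, hz']
      exact conj_mem_fixed 𝔄 P (inv_mem g.2) (ε.map_fixed (mul_mem ha γ.mem))
    · rw [map_mul, hz, hz']
      calc _ = ε.f (γ.i * a') * ((𝔄.str (g : G) : A) * (𝔄.str (g : G)⁻¹ : A)) * ε.f (a * γ.i) := by
            simp only [mul_assoc]
        _ = ε.f (γ.i * (a' * a) * γ.i) := by
            rw [hg1, mul_one, ← map_mul]
            simp only [mul_assoc]
        _ = _ := by rw [h2, mul_one, γ.idem]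
    · rw [map_mul, hz, hz']
      calc _ = (𝔄.str (g : G)⁻¹ : A) * (ε.f (a * (γ.i * γ.i) * a') * (𝔄.str (g : G) : A)) := by
            simp only [mul_assoc, map_mul]
        _ = _ := by rw [γ.idem, ← h4, ← mul_assoc, hg2, one_mul]
    · rw [map_mul, hz, ← mul_assoc, ← map_mul, ← mul_assoc, γ.idem]
    · rw [map_mul, hz', ← mul_assoc, h5, mul_assoc, ← map_mul]
      congr 2
      calc a * γ.i * a' * (a * γ.i) = a * γ.i * (a' * a) * γ.i := by simp only [mul_assoc]
        _ = _ := by rw [h2, mul_one, mul_assoc, γ.idem]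

theorem pointNormalizer_eq {γ : (𝔄.res P).Point} (hγ : IsLocalIdempotent γ.elt) :
    pointNormalizer 𝔄 P γ = embeddedPointNormalizer (GradedEmbedding.refl (𝔄.res P)) γ := by
  ext g
  rw [mem_embeddedPointNormalizer_iff_conj _ hγ g (by
    change (𝔄.str (g : G) : A) * 1 * (𝔄.str (g : G)⁻¹ : A) = 1
    simp)]
  rfl

variable (H P) in
/-- The isomorphism `E ≃ E'` defined by the equality of `N` and `N'`. -/
theorem exists_eGroup_mulEquiv {N N' : Subgroup (Subgroup.normalizer (P : Set G))} (h : N = N') :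
    ∃ τ : EGroup H P N ≃* EGroup H P N',
      (∀ (g : N) (g' : N'), (g : G) = g' → τ (toE H P N g) = toE H P N' g') ∧
      ∀ x, eDegree H P N' (τ x) = eDegree H P N x := by
  subst h
  refine ⟨MulEquiv.refl _, fun g g' hg => ?_, fun x => rfl⟩
  obtain rfl : g = g' := Subtype.ext (Subtype.ext hg)
  rfl

theorem eDegree_mem_fusionGroup {N : Subgroup (Subgroup.normalizer (P : Set G))}
    (hN : N ≤ embeddedPointNormalizer ε γ) (x : EGroup H P N) :
    eDegree H P N x ∈ fusionGroup γ := by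
  rw [mem_fusionGroup_iff]
  constructor
  · obtain ⟨g, rfl⟩ := toE_surjective H P N x
    intro u
    rw [eDegree_toE, conjDegree_snd, ← map_inv]
    change QuotientGroup.mk' H
        (((conjDegree H P (g : Subgroup.normalizer (P : Set G))).1 u : P) : G)
      = _ * QuotientGroup.mk' H (u : G) * _
    rw [conjDegree_fst, map_mul, map_mul]
  · obtain ⟨u, hu, h⟩ := exists_isInvertible ε N hN x
    exact ⟨u, hu, h⟩

variable {N : Subgroup (Subgroup.normalizer (P : Set G))} (hN : N ≤ embeddedPointNormalizer ε γ)

/-- The homomorphism `E → F`. -/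
def eToFusion : EGroup H P N →* fusionGroup γ :=
  (eDegree H P N).codRestrict _ (eDegree_mem_fusionGroup ε hN)

theorem isConjugationHom_eToFusion : IsConjugationHom N (eToFusion ε hN) :=
  fun _ => ⟨fun _ => rfl, rfl⟩

theorem eToFusion_injective : Function.Injective (eToFusion ε hN) := fun _ _ h =>
  eDegree_injective N (congrArg Subtype.val h)

end stabilizer

/-! ### The commutative diagram -/

set_option maxHeartbeats 1000000 in
theorem propositionp {O : Type*} [CommRing O] [IsDomain O] [IsDiscreteValuationRing O]
    [IsAdicComplete (IsLocalRing.maximalIdeal O) O] (p : ℕ) [Fact p.Prime]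
    [CharP (IsLocalRing.ResidueField O) p]
    {G : Type*} [Group G] [Finite G] (H : Subgroup G) [H.Normal]
    {A A' : Type*} [Ring A] [Algebra O A] [Module.Finite O A] [Ring A'] [Algebra O A']
    (𝔄 : GradedInterior O (QuotientGroup.mk' H) A) (P : Subgroup G)
    (𝔅 : GradedInterior O ((QuotientGroup.mk' H).comp P.subtype) A')
    (ε : GradedEmbedding 𝔅 (𝔄.res P))
    (γ : (𝔄.res P).Point)
    (hinj : ∀ u v : P, (𝔄.str u : A) * γ.i = (𝔄.str v : A) * γ.i → u = v)
    (he : ε.f 1 * γ.i = γ.i) (he' : γ.i * ε.f 1 = γ.i) :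
    let γ' : 𝔅.Point := ε.pullback γ he he'
    let ε₀ : GradedEmbedding (𝔄.res P) (𝔄.res P) := GradedEmbedding.refl (𝔄.res P)
    let N := pointNormalizer 𝔄 P γ
    let N' := embeddedPointNormalizer ε γ'
    -- for the elements `g` fixing `e`, to belong to `N'` means to stabilize the point `γ'`
    (∀ g : Subgroup.normalizer (P : Set G),
      (𝔄.str g : A) * ε.f 1 * (𝔄.str (g : G)⁻¹ : A) = ε.f 1 →
      (g ∈ N' ↔ ∃ a ∈ 𝔅.fixed, ∃ a' ∈ 𝔅.fixed, a * a' = 1 ∧ a' * a = 1 ∧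
        (𝔄.str g : A) * γ.i * (𝔄.str (g : G)⁻¹ : A) = ε.f (a * γ'.i * a'))) ∧
    N = N' ∧
    -- the isomorphisms `E ≃ E'` and `F ≃ F'`, and the homomorphisms `E → F` and `E' → F'`
    ∃ (εE : EGroup H P N ≃* EGroup H P N') (εF : fusionGroup γ ≃* fusionGroup γ')
      (θ : EGroup H P N →* fusionGroup γ) (θ' : EGroup H P N' →* fusionGroup γ'),
      (∀ (g : N) (g' : N'), (g : G) = g' → εE (toE H P N g) = toE H P N' g') ∧
      (∀ φ : fusionGroup γ, (εF φ : MulAut P × (G ⧸ H)) = φ) ∧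
      IsConjugationHom N θ ∧ IsConjugationHom N' θ' ∧
      Function.Injective θ ∧ Function.Injective θ' ∧ (∀ x, θ' (εE x) = εF (θ x)) ∧
      -- the left hand square
      ∃ (κ : EBar ε₀ N γ →ₐ[O] FBar γ) (κ' : EBar ε N' γ' →ₐ[O] FBar γ')
        (α : EBar ε₀ N γ ≃ₐ[O] EBar ε N' γ') (δ : FBar γ ≃ₐ[O] FBar γ'),
        -- these are graded `k`-algebras
        (∀ r ∈ IsLocalRing.maximalIdeal O, algebraMap O (EBar ε₀ N γ) r = 0) ∧
        (∀ r ∈ IsLocalRing.maximalIdeal O, algebraMap O (FBar γ) r = 0) ∧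
        IsGradedBy (O := O) (A := EBar ε₀ N γ) (endCrossedComp ε₀ N γ (toSimpleQuotient γ)) ∧
        IsGradedBy (O := O) (A := FBar γ) (fBarComp γ) ∧
        -- the maps are injective and graded
        Function.Injective κ ∧ Function.Injective κ' ∧
        (∀ x, (endCrossedComp ε₀ N γ (toSimpleQuotient γ) x).map κ.toLinearMap
          = fBarComp γ (θ x)) ∧
        (∀ x, (endCrossedComp ε N' γ' (toSimpleQuotient γ') x).map κ'.toLinearMap
          = fBarComp γ' (θ' x)) ∧
        (∀ x, (endCrossedComp ε₀ N γ (toSimpleQuotient γ) x).map α.toLinearMap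
          = endCrossedComp ε N' γ' (toSimpleQuotient γ') (εE x)) ∧
        (∀ φ, (fBarComp γ φ).map δ.toLinearMap = fBarComp γ' (εF φ)) ∧
        -- they are the canonical ones
        (∀ (x : EGroup H P N) (y : A) (φ : EBar ε₀ N γ), γ.i * y = y → y * γ.i = y →
          IsEndRightMulBy ε₀ N γ (toSimpleQuotient γ) φ x y →
          ∃ h : FAlg γ, IsFRightMulBy γ h (θ x) y ∧ κ φ = toFBar γ h) ∧
        (∀ (x : EGroup H P N') (y : A') (φ : EBar ε N' γ'), γ'.i * y = y → y * γ'.i = y →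
          IsEndRightMulBy ε N' γ' (toSimpleQuotient γ') φ x y →
          ∃ h : FAlg γ', IsFRightMulBy γ' h (θ' x) y ∧ κ' φ = toFBar γ' h) ∧
        (∀ (x : EGroup H P N) (y : A') (φ : EBar ε₀ N γ), γ'.i * y = y → y * γ'.i = y →
          IsEndRightMulBy ε₀ N γ (toSimpleQuotient γ) φ x (ε.f y) →
          IsEndRightMulBy ε N' γ' (toSimpleQuotient γ') (α φ) (εE x) y) ∧
        (∀ (φ : fusionGroup γ) (y : A') (h : FAlg γ), γ'.i * y = y → y * γ'.i = y →
          IsFRightMulBy γ h φ (ε.f y) →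
          ∃ h' : FAlg γ', IsFRightMulBy γ' h' (εF φ) y ∧ δ (toFBar γ h) = toFBar γ' h') ∧
        -- the left hand square commutes
        (∀ φ, δ (κ φ) = κ' (α φ)) ∧
        -- the right hand square, when `γ` is local
        (γ.IsLocal →
          (∃ b, γ.IsBlock b) ∧ (∃ b', γ'.IsBlock b') ∧
          ∀ (b : BrauerQuotient (𝔄.res P)) (b' : BrauerQuotient 𝔅)
            (hb : γ.IsBlock b) (hb' : γ'.IsBlock b'),
          ∃ (β : EBar ε₀ N γ ≃ₐ[O] ELocal ε₀ N γ hb) (β' : EBar ε N' γ' ≃ₐ[O] ELocal ε N' γ' hb')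
            (η : ELocal ε₀ N γ hb ≃ₐ[O] ELocal ε N' γ' hb'),
            (∀ x, (endCrossedComp ε₀ N γ (toSimpleQuotient γ) x).map β.toLinearMap
              = endCrossedComp ε₀ N γ (toLocalQuotient γ hb) x) ∧
            (∀ x, (endCrossedComp ε N' γ' (toSimpleQuotient γ') x).map β'.toLinearMap
              = endCrossedComp ε N' γ' (toLocalQuotient γ' hb') x) ∧
            (∀ x, (endCrossedComp ε₀ N γ (toLocalQuotient γ hb) x).map η.toLinearMap
              = endCrossedComp ε N' γ' (toLocalQuotient γ' hb') (εE x)) ∧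
            (∀ (x : EGroup H P N) (y : A) (φ : EBar ε₀ N γ), γ.i * y = y → y * γ.i = y →
              IsEndRightMulBy ε₀ N γ (toSimpleQuotient γ) φ x y →
              IsEndRightMulBy ε₀ N γ (toLocalQuotient γ hb) (β φ) x y) ∧
            (∀ (x : EGroup H P N') (y : A') (φ : EBar ε N' γ'), γ'.i * y = y → y * γ'.i = y →
              IsEndRightMulBy ε N' γ' (toSimpleQuotient γ') φ x y →
              IsEndRightMulBy ε N' γ' (toLocalQuotient γ' hb') (β' φ) x y) ∧
            (∀ (x : EGroup H P N) (y : A') (φ : ELocal ε₀ N γ hb), γ'.i * y = y → y * γ'.i = y →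
              IsEndRightMulBy ε₀ N γ (toLocalQuotient γ hb) φ x (ε.f y) →
              IsEndRightMulBy ε N' γ' (toLocalQuotient γ' hb') (η φ) (εE x) y) ∧
            -- the right hand square commutes
            (∀ φ, η (β φ) = β' (α φ))) := by
  intro γ' ε₀ N N'
  have hi : ε.f γ'.i = γ.i := ε.pullback_i γ he he'
  have : Module.Finite O A' := Module.Finite.of_injective (ε.f : A' →ₗ[O] A) ε.injective
  have hγ : IsLocalIdempotent γ.elt := γ.isLocalIdempotent
  have hγ' : IsLocalIdempotent γ'.elt := γ'.isLocalIdempotent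
  have hN₀ : N = embeddedPointNormalizer ε₀ γ := pointNormalizer_eq hγ
  have hNN' : N = N' := hN₀.trans (embeddedPointNormalizer_eq ε hi)
  refine ⟨fun g hg => ?_, hNN', ?_⟩
  · rw [← hi]
    exact mem_embeddedPointNormalizer_iff_conj ε hγ' g hg
  obtain ⟨εE, hεE, hdeg⟩ := exists_eGroup_mulEquiv H P hNN'
  let εF : fusionGroup γ ≃* fusionGroup γ' :=
    MulEquiv.subgroupCongr (GradedEmbedding.fusionGroup_eq hi)
  have hεF : ∀ φ : fusionGroup γ, (εF φ : MulAut P × (G ⧸ H)) = φ := fun _ => rfl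
  let θ := eToFusion ε₀ hN₀.le
  let θ' := eToFusion ε (N := N') (γ := γ') le_rfl
  have hθ : ∀ x, θ' (εE x) = εF (θ x) := fun x => Subtype.ext (hdeg x)
  refine ⟨εE, εF, θ, θ', hεE, hεF, isConjugationHom_eToFusion _ _, isConjugationHom_eToFusion _ _,
    eToFusion_injective _ _, eToFusion_injective _ _, hθ, ?_⟩
  have hq := toSimpleQuotient_surjective γ
  have hq' := toSimpleQuotient_surjective γ'
  have hE := isResidual_crossedProj ε₀ N hq hγ hN₀.le
    fun a h1 h2 => toSimpleQuotient_eq_zero_iff hγ h1 h2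
  have hE' := isResidual_crossedProj ε N' hq' hγ' le_rfl
    fun a h1 h2 => toSimpleQuotient_eq_zero_iff hγ' h1 h2
  have hF := isResidual_fusionProj hγ
  have hF' := isResidual_fusionProj hγ'
  obtain ⟨κ, hκ1, hκ2, hκ⟩ := hE.exists_injective_algHom hF θ (eToFusion_injective _ _) fun _ => rfl
  obtain ⟨κ', hκ1', hκ2', hκ'⟩ :=
    hE'.exists_injective_algHom hF' θ' (eToFusion_injective _ _) fun _ => rfl
  obtain ⟨α, hα1, hα⟩ := IsResidual.exists_algEquiv hi hE' hE εE hdeg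
  obtain ⟨δ, hδ1, hδ⟩ := IsResidual.exists_algEquiv hi hF' hF εF hεF
  -- all the intertwiners of `γ` come from `A'`
  have hpre : ∀ {φ} {a : A}, a ∈ γ.intertwiner φ → ∃ y, ε.f y = a ∧ y ∈ γ'.intertwiner φ := by
    intro φ a ha
    obtain ⟨y, rfl⟩ := GradedEmbedding.exists_map_eq hi (GradedInterior.Point.i_mul ha)
      (GradedInterior.Point.mul_i ha)
    exact ⟨y, rfl, (GradedEmbedding.map_mem_intertwiner_iff hi).1 ha⟩
  have hE'mem : ∀ {x y}, ε.f y ∈ γ.intertwiner (eDegree H P N x) →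
      y ∈ γ'.intertwiner (eDegree H P N' (εE x)) := fun h => by
    rw [hdeg]
    exact (GradedEmbedding.map_mem_intertwiner_iff hi).1 h
  have hcorner : ∀ {y : A'}, γ'.i * y = y → y * γ'.i = y →
      γ.i * ε.f y = ε.f y ∧ ε.f y * γ.i = ε.f y := fun h1 h2 =>
    ⟨by rw [← hi, ← map_mul, h1], by rw [← hi, ← map_mul, h2]⟩
  refine ⟨κ, κ', α, δ, fun r hr => hE.algebraMap_eq_zero hr, fun r hr => hF.algebraMap_eq_zero hr,
    hE.isGradedBy (range_crossedProj ε₀ N hq), hF.isGradedBy range_fusionProj, hκ1, hκ1',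
    fun x => ?_, fun x => ?_, fun x => ?_, fun φ => ?_, fun x y φ h1 h2 h => ?_,
    fun x y φ h1 h2 h => ?_, fun x y φ h1 h2 h => ?_, fun φ y h h1 h2 hh => ?_, fun φ => ?_,
    fun hloc => ?_⟩
  · rw [← range_crossedProj ε₀ N hq, hκ2, range_fusionProj]
  · rw [← range_crossedProj ε N' hq', hκ2', range_fusionProj]
  · rw [← range_crossedProj ε₀ N hq, ← range_crossedProj ε N' hq']
    exact hα1 x
  · rw [← range_fusionProj, ← range_fusionProj]
    exact hδ1 φ
  · obtain ⟨hy, rfl⟩ := (isEndRightMulBy_iff ε₀ N hq h1 h2).1 h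
    exact ⟨fusionMul γ (θ x) ⟨y, hy⟩, FAlg.isFRightMulBy_iff.2 ⟨hy, rfl⟩, hκ x y hy hy⟩
  · obtain ⟨hy, rfl⟩ := (isEndRightMulBy_iff ε N' hq' h1 h2).1 h
    exact ⟨fusionMul γ' (θ' x) ⟨y, hy⟩, FAlg.isFRightMulBy_iff.2 ⟨hy, rfl⟩, hκ' x y hy hy⟩
  · obtain ⟨hy, rfl⟩ := (isEndRightMulBy_iff ε₀ N hq (hcorner h1 h2).1 (hcorner h1 h2).2).1 h
    exact (isEndRightMulBy_iff ε N' hq' h1 h2).2 ⟨hE'mem hy, hα x y hy (hE'mem hy)⟩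
  · obtain ⟨hy, rfl⟩ := FAlg.isFRightMulBy_iff.1 hh
    have hy' : y ∈ γ'.intertwiner (εF φ).1 := (GradedEmbedding.map_mem_intertwiner_iff hi).1 hy
    exact ⟨fusionMul γ' (εF φ) ⟨y, hy'⟩, FAlg.isFRightMulBy_iff.2 ⟨hy', rfl⟩, hδ φ y hy hy'⟩
  · induction φ using hE.induction with
    | hadd φ φ' h h' => rw [map_add, map_add, map_add, map_add, h, h']
    | hπ x a =>
      obtain ⟨a, ha⟩ := a
      obtain ⟨y, rfl, hy⟩ := hpre ha
      rw [hκ x _ ha ha, hδ (θ x) y ha hy, hα x y ha (hE'mem ha),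
        hκ' (εE x) y (hE'mem ha) (hE'mem ha)]
      -- the two images have the same degree `εF (θ x) = θ' (εE x)`
      have key : ∀ (ψ : fusionGroup γ') (_ : εF (θ x) = ψ) (h : y ∈ γ'.intertwiner ψ.1),
          fusionProj γ' (εF (θ x)) ⟨y, hy⟩ = fusionProj γ' ψ ⟨y, h⟩ := by
        rintro _ rfl _
        rfl
      exact key _ (hθ x).symm _
  have hloc' : γ'.IsLocal := GradedEmbedding.isLocal hi hloc
  refine ⟨exists_isBlock hγ hloc, exists_isBlock hγ' hloc', fun b b' hb hb' => ?_⟩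
  have hl := toLocalQuotient_surjective γ hb
  have hl' := toLocalQuotient_surjective γ' hb'
  have hL := isResidual_crossedProj ε₀ N hl hγ hN₀.le
    fun a h1 h2 => toLocalQuotient_eq_zero_iff hγ hloc hb h1 h2
  have hL' := isResidual_crossedProj ε N' hl' hγ' le_rfl
    fun a h1 h2 => toLocalQuotient_eq_zero_iff hγ' hloc' hb' h1 h2
  obtain ⟨β, hβ1, hβ⟩ := hE.exists_algEquiv_self hL
  obtain ⟨β', hβ1', hβ'⟩ := hE'.exists_algEquiv_self hL'
  obtain ⟨η, hη1, hη⟩ := IsResidual.exists_algEquiv hi hL' hL εE hdeg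
  refine ⟨β, β', η, fun x => ?_, fun x => ?_, fun x => ?_, fun x y φ h1 h2 h => ?_,
    fun x y φ h1 h2 h => ?_, fun x y φ h1 h2 h => ?_, fun φ => ?_⟩
  · rw [← range_crossedProj ε₀ N hq, ← range_crossedProj ε₀ N hl]
    exact hβ1 x
  · rw [← range_crossedProj ε N' hq', ← range_crossedProj ε N' hl']
    exact hβ1' x
  · rw [← range_crossedProj ε₀ N hl, ← range_crossedProj ε N' hl']
    exact hη1 x
  · obtain ⟨hy, rfl⟩ := (isEndRightMulBy_iff ε₀ N hq h1 h2).1 h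
    exact (isEndRightMulBy_iff ε₀ N hl h1 h2).2 ⟨hy, hβ x ⟨y, hy⟩⟩
  · obtain ⟨hy, rfl⟩ := (isEndRightMulBy_iff ε N' hq' h1 h2).1 h
    exact (isEndRightMulBy_iff ε N' hl' h1 h2).2 ⟨hy, hβ' x ⟨y, hy⟩⟩
  · obtain ⟨hy, rfl⟩ := (isEndRightMulBy_iff ε₀ N hl (hcorner h1 h2).1 (hcorner h1 h2).2).1 h
    exact (isEndRightMulBy_iff ε N' hl' h1 h2).2 ⟨hE'mem hy, hη x y hy (hE'mem hy)⟩
  · induction φ using hE.induction with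
    | hadd φ φ' h h' => rw [map_add, map_add, map_add, map_add, h, h']
    | hπ x a =>
      obtain ⟨a, ha⟩ := a
      obtain ⟨y, rfl, hy⟩ := hpre ha
      rw [hβ, hη x y ha (hE'mem ha), hα x y ha (hE'mem ha), hβ']
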